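/- **Setting.** Let $L,h_1,h_2,h_3,\rho_1,\rho_3,\alpha^1,\alpha^3,G_2,\mu,\varepsilon_1,\varepsilon_3>0$ and $\gamma\in\mathbb R$, and put $\xi=\frac{\varepsilon_1h_3^2}{12\varepsilon_3}$, $H=\frac{h_1+2h_2+h_3}{2}$, $m=\rho_1h_1+\rho_3h_3$, $K_1=\frac{\rho_1h_1^3+\rho_3h_3^3}{12}$, $K_2=\frac{\alpha^1h_1^3+\alpha^3h_3^3}{12}$. All function spaces are complex. Let $P_\xi=(-\xi D_x^2+I)^{-1}$ on $L^2(0,L)$, where $\mathrm{Dom}(D_x^2)=\{v\in H^2(0,L):v_x(0)=v_x(L)=0\}$. *Energy space.* Let $\mathrm V$ be the space of $\vec y=(y_1,\dots,y_5)\in H^1\times H^1\times H^2\times H^1\times H^1$ on $(0,L)$ with $y_1(0)=y_2(0)=y_3(0)=(y_3)_x(0)=0$, $y_4(0)=y_4(L)=0$ and $y_5=\xi(y_4)_x$, with inner product $$\langle u,v\rangle_{\mathrm V}=\int_0^L\Big\{\alpha^1h_1(u_1)_x(\bar v_1)_x+\alpha^3h_3(u_2)_x(\bar v_2)_x+\tfrac{\gamma^2h_3}{\varepsilon_3}\big(P_\xi(u_2)_x\big)(\bar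 v_2)_x+K_2(u_3)_{xx}(\bar v_3)_{xx}$$ $$\qquad+\tfrac{G_2}{h_2}(-u_1+u_2+H(u_3)_x)(-\bar v_1+\bar v_2+H(\bar v_3)_x)+\mu h_3(u_4-(u_5)_x)(\bar v_4-(\bar v_5)_x)\Big\}dx .$$ Let $\mathrm H$ be the space of $\vec z\in L^2\times L^2\times H^1\times L^2\times L^2$ on $(0,L)$ with $z_3(0)=0$ that satisfy the gauge condition weakly, $\int_0^L(\xi z_4\psi_x+z_5\psi)\,dx=0$ for all $\psi\in H^1(0,L)$, with inner product $$\langle u,v\rangle_{\mathrm H}=\int_0^L\{\rho_1h_1u_1\bar v_1+\rho_3h_3u_2\bar v_2+m\,u_3\bar v_3+K_1(u_3)_x(\bar v_3)_x+\xi h_3\varepsilon_3u_4\bar v_4+\varepsilon_3h_3u_5\bar v_5\}dx .$$ Then $\mathrm V\subset\mathrm H$, and the energy space is $\mathcal H=\mathrm V\times\mathrm H$ with $\|(\vec y,\vec z)\|^2_{\mathcal H}=\|\vec y\|^2_{\mathrm V}+\|\vec z\|_{\mathrm H}^2$. *Operators.* Define $A,D:\mathrm V\to\mathrm V'$ and $M:\mathrm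 H\to\mathrm H'$ by $\langle Ay,\psi\rangle=\langle y,\psi\rangle_{\mathrm V}$, $\langle Dz,\psi\rangle=\gamma h_3\int_0^L\big(z_5(\bar\psi_2)_x-(z_2)_x\bar\psi_5\big)dx$ and $\langle Mz,\psi\rangle=\langle z,\psi\rangle_{\mathrm H}$. Let $$\mathcal A(y,z)=\big(-z,\;M^{-1}(Ay+Dz)\big),\qquad \mathrm{Dom}(\mathcal A)=\{(y,z)\in\mathrm V\times\mathrm V:\ Ay+Dz\in\mathrm H'\}.$$ Let $B_0:\mathbb C^8\to\mathrm V'$ be given by $\langle B_0c,\psi\rangle=\sum_{j=1}^8c_j\overline{(B_0^*\psi)_j}$, where $$B_0^*\psi=\Big(\psi_1(L),\int_0^L\!\psi_1,\,-\tfrac{\gamma}{\varepsilon_3}\psi_2(L),\int_0^L\!\psi_2,\,\psi_3(L),\,-K_2(\psi_3)_x(L),\int_0^L\!\psi_3,\,\tfrac1{h_3\varepsilon_3}\int_0^L\!\psi_4\Big),$$ and let $B=\begin{pmatrix}0\\ M^{-1}B_0\end{pmatrix}$. With $\varphi=(v^1,v^3,w,\theta,\eta,\dot v^1,\dot v^3,\dot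 w,\dot\theta,\dot\eta)$ and controls $F=(g^1,f^1,\sigma_s,f^3,g,M,f,i_s^1)$ (here $M$ is the boundary bending moment), the fully dynamic, current- or charge-controlled reduced Rao–Nakra active constrained layer beam is the system $$\dot\varphi+\mathcal A\varphi=BF(t),\qquad\varphi(0)=\varphi^0.\tag{1}$$ A solution of (1) on $[0,T]$ is a $\varphi=(y,z)\in C([0,T];\mathcal H)$ with $\varphi(0)=\varphi^0$ such that for all $t\in[0,T]$ $$y(t)-y(0)=\int_0^tz\,ds\ \text{ in }\mathrm H,\qquad M(z(t)-z(0))+A\int_0^ty\,ds+D\,(y(t)-y(0))=\int_0^tB_0F\,ds\ \text{ in }\mathrm V' .$$ **Theorem.** (i) $-\mathcal A$ is the infinitesimal generator of a $C_0$-semigroup of contractions $(S(t))_{t\ge0}$ on $\mathcal H$, and $B$ is an admissible control operator for it: for all $T>0$ and $F\in(L^2(0,T))^8$ the integral $\int_0^TS(T-s)BF(s)\,ds$, formed in the extrapolation space, belongs to $\mathcal H$; equivalently, $\int_0^TS(T-s)(I+\mathcal A)^{-1}BF(s)\,ds\in\mathrm{Dom}(\mathcal A)$. (ii) For every $T>0$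 there is a constant $c_1(T)>0$ such that for all $\varphi^0\in\mathcal H$ and $F\in(L^2(0,T))^8$ the system (1) has exactly one solution $\varphi\in C([0,T];\mathcal H)$, and $$\|\varphi(T)\|^2_{\mathcal H}\le c_1(T)\big\{\|\varphi^0\|^2_{\mathcal H}+\|F\|^2_{(L^2(0,T))^8}\big\}.$$ -/

import Mathlib

open MeasureTheory Set Filter Topology
open scoped InnerProductSpace ComplexConjugate

noncomputable section

namespace RaoNakra

/-- The physical constants of the three-layer beam: length `L`, thicknesses `hᵢ`, densities `ρᵢ` and
elastic stiffnesses `αᵢ` of the outer layers, piezoelectric coefficient `γ`, shear modulus `G₂` of the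
core, magnetic permeability `μ` and permittivities `ε₁`, `ε₃` of the piezoelectric layer. -/
structure BeamParams where
  (L h₁ h₂ h₃ ρ₁ ρ₃ α₁ α₃ γ G₂ μ ε₁ ε₃ : ℝ)
  L_pos : 0 < L
  h₁_pos : 0 < h₁
  h₂_pos : 0 < h₂
  h₃_pos : 0 < h₃
  ρ₁_pos : 0 < ρ₁
  ρ₃_pos : 0 < ρ₃
  α₁_pos : 0 < α₁
  α₃_pos : 0 < α₃
  G₂_pos : 0 < G₂
  μ_pos : 0 < μ
  ε₁_pos : 0 < ε₁
  ε₃_pos : 0 < ε₃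

/-- Primitives of integrable complex functions are absolutely continuous. -/
theorem absolutelyContinuous_primitive {L : ℝ} {f : ℝ → ℂ} (hf : IntervalIntegrable f volume 0 L) :
    AbsolutelyContinuousOnInterval (fun x => ∫ s in (0 : ℝ)..x, f s) 0 L := by
  have hre : IntervalIntegrable (fun s => (f s).re) volume 0 L := ⟨hf.1.re, hf.2.re⟩
  have him : IntervalIntegrable (fun s => (f s).im) volume 0 L := ⟨hf.1.im, hf.2.im⟩
  have hc : ∀ z : ℂ, AbsolutelyContinuousOnInterval (fun _ : ℝ => z) 0 L := fun z =>
    (contDiff_const.contDiffOn).absolutelyContinuousOnInterval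
  have h1 := (hre.absolutelyContinuousOnInterval_intervalIntegral (c := 0) (by simp)).smul (hc 1)
  have h2 := (him.absolutelyContinuousOnInterval_intervalIntegral (c := 0)
    (by simp)).smul (hc Complex.I)
  have h3 := h1.add h2
  rw [absolutelyContinuousOnInterval_iff] at h3 ⊢
  intro ε hε
  obtain ⟨δ, hδ, h⟩ := h3 ε hε
  refine ⟨δ, hδ, fun E hE hl => ?_⟩
  have key : ∀ x ∈ uIcc 0 L, (∫ s in (0 : ℝ)..x, f s) =
      ((fun x => ∫ s in (0 : ℝ)..x, (f s).re) • (fun _ : ℝ => (1 : ℂ)) +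
        (fun x => ∫ s in (0 : ℝ)..x, (f s).im) • (fun _ : ℝ => Complex.I)) x := by
    intro x hx
    have hfx : IntervalIntegrable f volume 0 x :=
      hf.mono_set (uIcc_subset_uIcc left_mem_uIcc hx)
    have e1 : (∫ s in (0 : ℝ)..x, (f s).re) = (∫ s in (0 : ℝ)..x, f s).re := by
      simpa using (Complex.reCLM.intervalIntegral_comp_comm hfx)
    have e2 : (∫ s in (0 : ℝ)..x, (f s).im) = (∫ s in (0 : ℝ)..x, f s).im := by
      simpa using (Complex.imCLM.intervalIntegral_comp_comm hfx)
    simp only [Pi.add_apply, Pi.smul_apply', e1, e2, Complex.real_smul, mul_one]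
    exact (Complex.re_add_im _).symm
  convert h E hE hl using 1
  refine Finset.sum_congr rfl fun i hi => ?_
  have := hE.1 i hi
  rw [key _ this.1, key _ this.2]

/-- Product rule for absolutely continuous functions, in integrated form. -/
theorem primitive_mul {L : ℝ} (hL : 0 ≤ L) {f g : ℝ → ℂ} (a b : ℂ)
    (hf : IntervalIntegrable f volume 0 L) (hg : IntervalIntegrable g volume 0 L)
    {x : ℝ} (hx : x ∈ Icc 0 L) :
    (a + ∫ s in (0 : ℝ)..x, f s) * (b + ∫ s in (0 : ℝ)..x, g s) =
      a * b + ∫ t in (0 : ℝ)..x,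
        (f t * (b + ∫ s in (0 : ℝ)..t, g s) + (a + ∫ s in (0 : ℝ)..t, f s) * g t) := by
  have hc : ∀ z : ℂ, AbsolutelyContinuousOnInterval (fun _ : ℝ => z) 0 L := fun z =>
    (contDiff_const.contDiffOn).absolutelyContinuousOnInterval
  have hF := (hc a).add (absolutelyContinuous_primitive hf)
  have hG := (hc b).add (absolutelyContinuous_primitive hg)
  have hint : IntervalIntegrable (fun t => f t * (b + ∫ s in (0 : ℝ)..t, g s) +
      (a + ∫ s in (0 : ℝ)..t, f s) * g t) volume 0 L :=
    (hf.mul_continuousOn hG.continuousOn).add (hg.continuousOn_mul hF.continuousOn)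
  have hH := (hF.smul hG).sub (absolutelyContinuous_primitive hint)
  obtain ⟨C, hC⟩ := hH.const_of_ae_hasDerivAt_zero (by
    filter_upwards [hf.ae_hasDerivAt_integral, hg.ae_hasDerivAt_integral,
      hint.ae_hasDerivAt_integral] with t h1 h2 h3 ht
    have h0 : (0 : ℝ) ∈ uIcc 0 L := left_mem_uIcc
    have e1 := (h1 ht 0 h0).const_add a
    have e2 := (h2 ht 0 h0).const_add b
    have e3 := (e1.mul e2).sub (h3 ht 0 h0)
    have e4 : (0 : ℂ) = f t * (b + ∫ s in (0 : ℝ)..t, g s) +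
        (a + ∫ s in (0 : ℝ)..t, f s) * g t - (f t * (b + ∫ s in (0 : ℝ)..t, g s) +
        (a + ∫ s in (0 : ℝ)..t, f s) * g t) := (sub_self _).symm
    change HasDerivAt _ (0 : ℂ) t
    rw [e4]
    exact e3)
  rw [uIcc_of_le hL] at hC
  have h1 := hC x hx
  have h0 := hC 0 ⟨le_rfl, hL⟩
  simp only [Pi.sub_apply, smul_eq_mul, Pi.mul_apply, Pi.add_apply,
    intervalIntegral.integral_same, add_zero, sub_zero] at h1 h0
  rw [h0, ← h1]; ring

variable (p : BeamParams)

/-- The end `x = 0` of the beam. -/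
def BeamParams.left : Icc (0 : ℝ) p.L := ⟨0, le_rfl, p.L_pos.le⟩
/-- The end `x = L` of the beam. -/
def BeamParams.right : Icc (0 : ℝ) p.L := ⟨p.L, p.L_pos.le, le_rfl⟩

/-- The complex space `L²(0,L)`. -/
abbrev X : Type := Lp ℂ 2 (volume.restrict (Ioc 0 p.L))

variable {p}

theorem X.intervalIntegrable (g : X p) : IntervalIntegrable (g : ℝ → ℂ) volume 0 p.L := by
  rw [intervalIntegrable_iff_integrableOn_Ioc_of_le p.L_pos.le]
  exact (Lp.memLp g).integrable (by norm_num)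

theorem X.intervalIntegrable_of_mem (g : X p) {x : ℝ} (hx : x ∈ Icc 0 p.L) :
    IntervalIntegrable (g : ℝ → ℂ) volume 0 x :=
  (X.intervalIntegrable g).mono_set (by
    rw [uIcc_of_le hx.1, uIcc_of_le p.L_pos.le]; exact Icc_subset_Icc le_rfl hx.2)

theorem X.integral_congr {f g : ℝ → ℂ} (h : f =ᵐ[volume.restrict (Ioc 0 p.L)] g) {x : ℝ}
    (hx : x ∈ Icc 0 p.L) : ∫ s in (0 : ℝ)..x, f s = ∫ s in (0 : ℝ)..x, g s := by
  rw [intervalIntegral.integral_of_le hx.1, intervalIntegral.integral_of_le hx.1]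
  exact integral_congr_ae (ae_restrict_of_ae_restrict_of_subset (Ioc_subset_Ioc le_rfl hx.2) h)

theorem X.primitive_add (f g : X p) {x : ℝ} (hx : x ∈ Icc 0 p.L) :
    ∫ s in (0 : ℝ)..x, (f + g : X p) s =
      (∫ s in (0 : ℝ)..x, f s) + ∫ s in (0 : ℝ)..x, g s := by
  rw [X.integral_congr (Lp.coeFn_add f g) hx]
  exact intervalIntegral.integral_add (X.intervalIntegrable_of_mem f hx)
    (X.intervalIntegrable_of_mem g hx)

theorem X.primitive_smul (c : ℂ) (g : X p) {x : ℝ} (hx : x ∈ Icc 0 p.L) :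
    ∫ s in (0 : ℝ)..x, (c • g : X p) s = c * ∫ s in (0 : ℝ)..x, g s := by
  rw [X.integral_congr (Lp.coeFn_smul c g) hx]
  exact intervalIntegral.integral_const_mul c _

variable (p)

/-- The pairs `(u, u_x)` with `u` continuous on `[0,L]`, `u_x ∈ L²(0,L)` and
`u(x) = u(0) + ∫₀ˣ u_x`: the absolutely continuous functions with square integrable derivative. -/
def H1Submodule : Submodule ℂ (C(Icc (0 : ℝ) p.L, ℂ) × X p) where
  carrier := {u | ∀ x : Icc (0 : ℝ) p.L, u.1 x = u.1 p.left + ∫ s in (0 : ℝ)..x, u.2 s}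
  zero_mem' := fun x => by
    have h := X.primitive_smul (p := p) 0 0 x.2
    rw [zero_smul, zero_mul] at h
    change (0 : ℂ) = 0 + ∫ s in (0 : ℝ)..x, (0 : X p) s
    rw [h, add_zero]
  add_mem' := fun {u v} hu hv x => by
    have h1 := hu x
    have h2 := hv x
    simp only [Prod.fst_add, Prod.snd_add, ContinuousMap.add_apply]
    rw [X.primitive_add _ _ x.2, h1, h2]; ring
  smul_mem' := fun c u hu x => by
    have h1 := hu x
    simp only [Prod.smul_fst, Prod.smul_snd, ContinuousMap.smul_apply, smul_eq_mul]
    rw [X.primitive_smul _ _ x.2, h1]; ring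

/-- The complex Sobolev space `H¹(0,L)`. -/
def H1 : Type := H1Submodule p

instance : AddCommGroup (H1 p) := inferInstanceAs (AddCommGroup (H1Submodule p))
instance : Module ℂ (H1 p) := inferInstanceAs (Module ℂ (H1Submodule p))

variable {p}

namespace H1

/-- Point value `u(x)`. -/
def eval (x : Icc (0 : ℝ) p.L) : H1 p →ₗ[ℂ] ℂ where
  toFun u := u.1.1 x
  map_add' _ _ := rfl
  map_smul' _ _ := rfl

/-- The derivative `u_x ∈ L²(0,L)`. -/
def deriv : H1 p →ₗ[ℂ] X p where
  toFun u := u.1.2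
  map_add' _ _ := rfl
  map_smul' _ _ := rfl

/-- `u` as a function on the line, extended by constants outside `[0,L]`. -/
def fn (u : H1 p) : ℝ → ℂ := IccExtend p.L_pos.le u.1.1

theorem continuous_fn (u : H1 p) : Continuous (fn u) := u.1.1.continuous.Icc_extend'

theorem fn_eq (u : H1 p) {x : ℝ} (hx : x ∈ Icc 0 p.L) :
    fn u x = eval p.left u + ∫ s in (0 : ℝ)..x, deriv u s := by
  rw [fn, IccExtend_of_mem _ _ hx]; exact u.2 ⟨x, hx⟩

theorem eval_eq_fn (u : H1 p) (x : Icc (0 : ℝ) p.L) : eval x u = fn u x := by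
  rw [fn, IccExtend_val]; rfl

theorem memLp_of_continuous {f : ℝ → ℂ} (hf : ContinuousOn f (Icc 0 p.L)) :
    MemLp f 2 (volume.restrict (Ioc 0 p.L)) := by
  obtain ⟨C, hC⟩ := isCompact_Icc.exists_bound_of_continuousOn hf
  refine MemLp.of_bound ((hf.mono Ioc_subset_Icc_self).aestronglyMeasurable measurableSet_Ioc) C ?_
  filter_upwards [ae_restrict_mem measurableSet_Ioc] with x hx using hC x (Ioc_subset_Icc_self hx)

theorem memLp_fn (u : H1 p) : MemLp (fn u) 2 (volume.restrict (Ioc 0 p.L)) :=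
  memLp_of_continuous (continuous_fn u).continuousOn

/-- The inclusion of `H¹(0,L)` in `L²(0,L)`. -/
def toX : H1 p →ₗ[ℂ] X p where
  toFun u := (memLp_fn u).toLp
  map_add' u v := (MemLp.toLp_add (memLp_fn u) (memLp_fn v))
  map_smul' c u := (MemLp.toLp_const_smul c (memLp_fn u))

theorem coeFn_toX (u : H1 p) : toX u =ᵐ[volume.restrict (Ioc 0 p.L)] fn u :=
  (memLp_fn u).coeFn_toLp

theorem eq_of {u v : H1 p} (h0 : eval p.left u = eval p.left v) (h1 : deriv u = deriv v) :
    u = v := by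
  refine Subtype.ext (Prod.ext (ContinuousMap.ext fun x => ?_) h1)
  have hu := u.2 x
  have hv := v.2 x
  have h1' : u.1.2 = v.1.2 := h1
  have h0' : u.1.1 p.left = v.1.1 p.left := h0
  rw [hu, hv, h1', h0']

theorem toX_injective : Function.Injective (toX : H1 p →ₗ[ℂ] X p) := by
  intro u v h
  have e : fn u =ᵐ[volume.restrict (Ioc 0 p.L)] fn v :=
    (coeFn_toX u).symm.trans (h ▸ coeFn_toX v)
  rw [Measure.restrict_congr_set Ioc_ae_eq_Icc] at e
  have e' := Measure.eqOn_Icc_of_ae_eq volume p.L_pos.ne e (continuous_fn u).continuousOn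
    (continuous_fn v).continuousOn
  have h1 : u.1.1 = v.1.1 := ContinuousMap.ext fun x => by
    have h2 := e' x.2
    rwa [← eval_eq_fn, ← eval_eq_fn] at h2
  have h0 : (0 : ℝ) ∈ uIcc 0 p.L := left_mem_uIcc
  refine Subtype.ext (Prod.ext h1 (Lp.ext ?_))
  have hm : ∀ᵐ x ∂volume.restrict (Ioc 0 p.L), x ∈ Ioo 0 p.L := by
    rw [← Measure.restrict_congr_set Ioo_ae_eq_Ioc]
    exact ae_restrict_mem measurableSet_Ioo
  filter_upwards [hm,
    ae_restrict_of_ae (X.intervalIntegrable (deriv u)).ae_hasDerivAt_integral,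
    ae_restrict_of_ae (X.intervalIntegrable (deriv v)).ae_hasDerivAt_integral] with x hx hu hv
  have hxI : x ∈ uIcc 0 p.L := by
    rw [uIcc_of_le p.L_pos.le]; exact Ioo_subset_Icc_self hx
  refine (hu hxI 0 h0).unique ((hv hxI 0 h0).congr_of_eventuallyEq ?_)
  filter_upwards [Ioo_mem_nhds hx.1 hx.2] with y hy
  have hy' := Ioo_subset_Icc_self hy
  have e2 := e' hy'
  have e0 := e' ⟨le_rfl, p.L_pos.le⟩
  have e0' : eval p.left u = eval p.left v := by rw [eval_eq_fn, eval_eq_fn]; exact e0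
  rw [fn_eq u hy', fn_eq v hy', e0'] at e2
  exact add_left_cancel e2

/-- The function `x ↦ c + ∫₀ˣ g`. -/
def mk (c : ℂ) (g : X p) : H1 p :=
  ⟨(⟨fun x => c + ∫ s in (0 : ℝ)..x, g s, by
      have h := (absolutelyContinuous_primitive (X.intervalIntegrable g)).continuousOn
      rw [uIcc_of_le p.L_pos.le] at h
      exact continuous_const.add h.domRestrict⟩, g), fun x => by
      simp [BeamParams.left]⟩

@[simp] theorem eval_left_mk (c : ℂ) (g : X p) : eval p.left (mk c g) = c := by
  simp [eval, mk, BeamParams.left]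

@[simp] theorem deriv_mk (c : ℂ) (g : X p) : deriv (mk c g) = g := rfl

theorem inner_X (f g : X p) : ⟪f, g⟫_ℂ = ∫ x in (0 : ℝ)..p.L, conj (f x) * g x := by
  rw [intervalIntegral.integral_of_le p.L_pos.le, L2.inner_def]
  simp [RCLike.inner_apply, mul_comm]

/-- Integration by parts in `H¹(0,L)`. -/
theorem integration_by_parts (u v : H1 p) :
    ⟪deriv u, toX v⟫_ℂ + ⟪toX u, deriv v⟫_ℂ =
      conj (eval p.right u) * eval p.right v - conj (eval p.left u) * eval p.left v := by
  have hu := X.intervalIntegrable (deriv u)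
  have hv := X.intervalIntegrable (deriv v)
  have hcu : IntervalIntegrable (fun s => conj (deriv u s)) volume 0 p.L := by
    rw [intervalIntegrable_iff_integrableOn_Ioc_of_le p.L_pos.le] at hu ⊢
    exact (Complex.conjCLE.toContinuousLinearMap.integrable_comp hu)
  have hLm : p.L ∈ Icc 0 p.L := ⟨p.L_pos.le, le_rfl⟩
  have hce : ∀ x ∈ Icc 0 p.L, conj (fn u x) =
      conj (eval p.left u) + ∫ s in (0 : ℝ)..x, conj (deriv u s) := by
    intro x hx
    rw [fn_eq u hx, map_add, intervalIntegral.integral_of_le hx.1,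
      intervalIntegral.integral_of_le hx.1, integral_conj]
  have key := primitive_mul p.L_pos.le (conj (eval p.left u)) (eval p.left v) hcu hv hLm
  rw [← hce _ hLm, ← fn_eq v hLm] at key
  rw [eval_eq_fn u p.right, eval_eq_fn v p.right]
  change _ = conj (fn u p.L) * fn v p.L - _
  rw [key, add_sub_cancel_left, inner_X, inner_X, ← intervalIntegral.integral_add]
  · rw [intervalIntegral.integral_of_le p.L_pos.le, intervalIntegral.integral_of_le p.L_pos.le]
    apply integral_congr_ae
    filter_upwards [coeFn_toX u, coeFn_toX v, ae_restrict_mem measurableSet_Ioc] with x h1 h2 hx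
    rw [h1, h2, hce x (Ioc_subset_Icc_self hx), fn_eq v (Ioc_subset_Icc_self hx)]
  · rw [intervalIntegrable_iff_integrableOn_Ioc_of_le p.L_pos.le]
    exact (L2.integrable_inner (𝕜 := ℂ) (deriv u) (toX v)).congr
      (Filter.Eventually.of_forall fun x => mul_comm _ _)
  · rw [intervalIntegrable_iff_integrableOn_Ioc_of_le p.L_pos.le]
    exact (L2.integrable_inner (𝕜 := ℂ) (toX u) (deriv v)).congr
      (Filter.Eventually.of_forall fun x => mul_comm _ _)

end H1

variable (p)

/-- The pairs `(w, w_x)` of elements of `H¹(0,L)` such that `w_x` is the derivative of `w`. -/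
def H2Submodule : Submodule ℂ (H1 p × H1 p) where
  carrier := {w | H1.deriv w.1 = H1.toX w.2}
  zero_mem' := by simp
  add_mem' := fun {u v} hu hv => by
    simp only [mem_ofPred_eq, Prod.fst_add, Prod.snd_add, map_add] at hu hv ⊢; rw [hu, hv]
  smul_mem' := fun c u hu => by
    simp only [mem_ofPred_eq, Prod.smul_fst, Prod.smul_snd, map_smul] at hu ⊢; rw [hu]

/-- The complex Sobolev space `H²(0,L)`. -/
def H2 : Type := H2Submodule p

instance : AddCommGroup (H2 p) := inferInstanceAs (AddCommGroup (H2Submodule p))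
instance : Module ℂ (H2 p) := inferInstanceAs (Module ℂ (H2Submodule p))

variable {p}

namespace H2

/-- The function `w`, as an element of `H¹(0,L)`. -/
def toH1 : H2 p →ₗ[ℂ] H1 p := LinearMap.fst ℂ _ _ ∘ₗ (H2Submodule p).subtype

/-- The derivative `w_x ∈ H¹(0,L)`. -/
def dx : H2 p →ₗ[ℂ] H1 p := LinearMap.snd ℂ _ _ ∘ₗ (H2Submodule p).subtype

/-- The second derivative `w_xx ∈ L²(0,L)`. -/
def dxx : H2 p →ₗ[ℂ] X p := H1.deriv ∘ₗ dx

theorem deriv_toH1 (w : H2 p) : H1.deriv (toH1 w) = H1.toX (dx w) := w.2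

theorem eq_of {w z : H2 p} (h0 : H1.eval p.left (toH1 w) = H1.eval p.left (toH1 z))
    (h1 : dx w = dx z) : w = z := by
  refine Subtype.ext (Prod.ext (H1.eq_of h0 ?_) h1)
  change H1.deriv (toH1 w) = H1.deriv (toH1 z)
  rw [deriv_toH1, deriv_toH1, h1]

/-- The function `x ↦ c + ∫₀ˣ v`. -/
def mk (c : ℂ) (v : H1 p) : H2 p := ⟨(H1.mk c (H1.toX v), v), rfl⟩

end H2

namespace BeamParams
variable (p)
/-- `ξ = ε₁h₃²/(12ε₃)` -/
def ξ : ℝ := p.ε₁ * p.h₃ ^ 2 / (12 * p.ε₃)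
/-- `m = ρ₁h₁ + ρ₃h₃` -/
def m : ℝ := p.ρ₁ * p.h₁ + p.ρ₃ * p.h₃
/-- `K₁ = ρ₁h₁³/12 + ρ₃h₃³/12` -/
def K₁ : ℝ := p.ρ₁ * p.h₁ ^ 3 / 12 + p.ρ₃ * p.h₃ ^ 3 / 12
/-- `K₂ = α₁h₁³/12 + α₃h₃³/12` -/
def K₂ : ℝ := p.α₁ * p.h₁ ^ 3 / 12 + p.α₃ * p.h₃ ^ 3 / 12
/-- `H = (h₁ + 2h₂ + h₃)/2` -/
def H : ℝ := (p.h₁ + 2 * p.h₂ + p.h₃) / 2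
theorem ξ_pos : 0 < p.ξ := by
  have := p.ε₁_pos; have := p.ε₃_pos; have := p.h₃_pos
  unfold ξ; positivity
theorem m_pos : 0 < p.m := by
  have := p.ρ₁_pos; have := p.ρ₃_pos; have := p.h₁_pos; have := p.h₃_pos
  unfold m; positivity
theorem K₁_pos : 0 < p.K₁ := by
  have := p.ρ₁_pos; have := p.ρ₃_pos; have := p.h₁_pos; have := p.h₃_pos
  unfold K₁; positivity
theorem K₂_pos : 0 < p.K₂ := by
  have := p.α₁_pos; have := p.α₃_pos; have := p.h₁_pos; have := p.h₃_pos
  unfold K₂; positivity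
end BeamParams

variable (p) in
/-- `v ∈ H²(0,L)`, `v_x(0) = v_x(L) = 0` and `v - ξ v_xx = f`. -/
def IsNeumannSolution (f : X p) (v : H2 p) : Prop :=
  H1.eval p.left (H2.dx v) = 0 ∧ H1.eval p.right (H2.dx v) = 0 ∧
    H1.toX (H2.toH1 v) - (p.ξ : ℂ) • H2.dxx v = f

theorem IsNeumannSolution.inner_eq {f : X p} {v : H2 p} (h : IsNeumannSolution p f v) (u : H1 p) :
    ⟪H1.toX u, f⟫_ℂ = ⟪H1.toX u, H1.toX (H2.toH1 v)⟫_ℂ +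
      (p.ξ : ℂ) * ⟪H1.deriv u, H1.toX (H2.dx v)⟫_ℂ := by
  have hi := H1.integration_by_parts u (H2.dx v)
  rw [h.1, h.2.1, mul_zero, mul_zero, sub_zero] at hi
  have h3 := h.2.2
  rw [← h3, inner_sub_right, inner_smul_right, eq_neg_of_add_eq_zero_left hi]
  change _ - _ * ⟪H1.toX u, H1.deriv (H2.dx v)⟫_ℂ = _
  ring

theorem IsNeumannSolution.zero {v : H2 p} (h : IsNeumannSolution p 0 v) : v = 0 := by
  have hi := h.inner_eq (H2.toH1 v)
  rw [inner_zero_right, H2.deriv_toH1, inner_self_eq_norm_sq_to_K,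
    inner_self_eq_norm_sq_to_K] at hi
  have hr : 0 = ‖H1.toX (H2.toH1 v)‖ ^ 2 + p.ξ * ‖H1.toX (H2.dx v)‖ ^ 2 := by
    apply Complex.ofReal_injective
    push_cast
    exact hi
  have hξ := p.ξ_pos
  have n1 : ‖H1.toX (H2.toH1 v)‖ ^ 2 = 0 := by
    have := mul_nonneg hξ.le (sq_nonneg ‖H1.toX (H2.dx v)‖)
    have := sq_nonneg ‖H1.toX (H2.toH1 v)‖
    linarith
  have n2 : ‖H1.toX (H2.dx v)‖ ^ 2 = 0 := by
    rw [n1, zero_add] at hr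
    exact (mul_eq_zero.mp hr.symm).resolve_left hξ.ne'
  have z1 : H1.toX (H2.toH1 v) = 0 := by simpa using n1
  have z2 : H1.toX (H2.dx v) = 0 := by simpa using n2
  have h3 := h.2.2
  rw [z1, zero_sub, neg_eq_zero, smul_eq_zero] at h3
  have z3 : H1.deriv (H2.dx v) = 0 :=
    h3.resolve_left (by exact_mod_cast hξ.ne')
  have z4 : H2.dx v = 0 := H1.eq_of (by rw [h.1, map_zero]) (by rw [z3, map_zero])
  have z5 : H2.toH1 v = 0 := H1.toX_injective (by rw [z1, map_zero])
  exact H2.eq_of (by rw [z5, map_zero, map_zero, map_zero]) (by rw [z4, map_zero])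

theorem IsNeumannSolution.add {f g : X p} {v w : H2 p} (hv : IsNeumannSolution p f v)
    (hw : IsNeumannSolution p g w) : IsNeumannSolution p (f + g) (v + w) := by
  refine ⟨by rw [map_add, map_add, hv.1, hw.1, add_zero],
    by rw [map_add, map_add, hv.2.1, hw.2.1, add_zero], ?_⟩
  rw [← hv.2.2, ← hw.2.2, map_add, map_add, map_add, smul_add]; abel

theorem IsNeumannSolution.smul (c : ℂ) {f : X p} {v : H2 p} (hv : IsNeumannSolution p f v) :
    IsNeumannSolution p (c • f) (c • v) := by
  refine ⟨by rw [map_smul, map_smul, hv.1, smul_zero],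
    by rw [map_smul, map_smul, hv.2.1, smul_zero], ?_⟩
  rw [← hv.2.2, map_smul, map_smul, map_smul, smul_sub, smul_comm]

theorem IsNeumannSolution.unique {f : X p} {v w : H2 p} (hv : IsNeumannSolution p f v)
    (hw : IsNeumannSolution p f w) : v = w := by
  have h := hv.add (hw.smul (-1))
  rw [neg_one_smul, neg_one_smul, ← sub_eq_add_neg, ← sub_eq_add_neg, sub_self] at h
  exact sub_eq_zero.mp h.zero

theorem exists_isNeumannSolution (f : X p) : ∃ v : H2 p, IsNeumannSolution p f v := by
  have hξ := p.ξ_pos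
  have hL := p.L_pos
  have hLm : p.L ∈ Icc 0 p.L := ⟨hL.le, le_rfl⟩
  obtain ⟨k, hk, hkξ⟩ : ∃ k : ℝ, 0 < k ∧ p.ξ * k ^ 2 = 1 :=
    ⟨(Real.sqrt p.ξ)⁻¹, by positivity, by
      rw [inv_pow, Real.sq_sqrt hξ.le]; exact mul_inv_cancel₀ hξ.ne'⟩
  -- hyperbolic functions and their primitives
  let ch : ℝ → ℂ := fun x => (Real.cosh (k * x) : ℂ)
  let sh : ℝ → ℂ := fun x => (Real.sinh (k * x) : ℂ)
  have hchc : Continuous ch := by fun_prop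
  have hshc : Continuous sh := by fun_prop
  have dch : ∀ x, HasDerivAt ch (k * sh x) x := fun x => by
    have h := ((Real.hasDerivAt_cosh (k * x)).comp x ((hasDerivAt_id x).const_mul k)).ofReal_comp
    convert! h using 1
    simp [sh, mul_comm]
  have dsh : ∀ x, HasDerivAt sh (k * ch x) x := fun x => by
    have h := ((Real.hasDerivAt_sinh (k * x)).comp x ((hasDerivAt_id x).const_mul k)).ofReal_comp
    convert! h using 1
    simp [ch, mul_comm]
  have i1 : ∀ {φ : ℝ → ℂ}, Continuous φ → IntervalIntegrable φ volume 0 p.L :=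
    fun h => h.intervalIntegrable _ _
  have pch : ∀ x, ch x = 1 + ∫ s in (0 : ℝ)..x, k * sh s := fun x => by
    rw [intervalIntegral.integral_eq_sub_of_hasDerivAt (fun y _ => dch y)
      ((continuous_const.mul hshc).intervalIntegrable _ _)]
    simp [ch]
  have psh : ∀ x, sh x = 0 + ∫ s in (0 : ℝ)..x, k * ch s := fun x => by
    rw [intervalIntegral.integral_eq_sub_of_hasDerivAt (fun y _ => dsh y)
      ((continuous_const.mul hchc).intervalIntegrable _ _)]
    simp [sh]
  have hsq : ∀ x, ch x ^ 2 - sh x ^ 2 = 1 := fun x => by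
    have := Real.cosh_sq_sub_sinh_sq (k * x)
    simp only [ch, sh]; exact_mod_cast this
  have hfi := X.intervalIntegrable f
  have icf : IntervalIntegrable (fun s => ch s * f s) volume 0 p.L :=
    hfi.continuousOn_mul hchc.continuousOn
  have isf : IntervalIntegrable (fun s => sh s * f s) volume 0 p.L :=
    hfi.continuousOn_mul hshc.continuousOn
  let C : ℝ → ℂ := fun x => ∫ s in (0 : ℝ)..x, ch s * f s
  let S : ℝ → ℂ := fun x => ∫ s in (0 : ℝ)..x, sh s * f s
  have hshL : sh p.L ≠ 0 := by
    have : 0 < Real.sinh (k * p.L) := Real.sinh_pos_iff.mpr (by positivity)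
    simp only [sh]; exact_mod_cast this.ne'
  let a : ℂ := k * ch p.L * C p.L / sh p.L - k * S p.L
  have ikf : IntervalIntegrable (fun s => k * (sh s * f s)) volume 0 p.L := isf.const_mul _
  have ikc : IntervalIntegrable (fun s => k * (ch s * f s)) volume 0 p.L := icf.const_mul _
  have pS : ∀ x, a + k * S x = a + ∫ s in (0 : ℝ)..x, k * (sh s * f s) := fun x => by
    rw [intervalIntegral.integral_const_mul]
  have pC : ∀ x, k * C x = 0 + ∫ s in (0 : ℝ)..x, k * (ch s * f s) := fun x => by
    rw [intervalIntegral.integral_const_mul, zero_add]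
  -- the solution and its derivative
  let V : ℝ → ℂ := fun x => ch x * (a + k * S x) - sh x * (k * C x)
  let W : ℝ → ℂ := fun x => k * (sh x * (a + k * S x) - ch x * (k * C x))
  have cS : ContinuousOn (fun x => a + k * S x) (Icc 0 p.L) := by
    have h := (absolutelyContinuous_primitive isf).continuousOn
    rw [uIcc_of_le hL.le] at h
    exact continuousOn_const.add (continuousOn_const.mul h)
  have cC : ContinuousOn (fun x => k * C x) (Icc 0 p.L) := by
    have h := (absolutelyContinuous_primitive icf).continuousOn
    rw [uIcc_of_le hL.le] at h
    exact continuousOn_const.mul h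
  have cV : ContinuousOn V (Icc 0 p.L) :=
    (hchc.continuousOn.mul cS).sub (hshc.continuousOn.mul cC)
  have cW : ContinuousOn W (Icc 0 p.L) :=
    continuousOn_const.mul ((hshc.continuousOn.mul cS).sub (hchc.continuousOn.mul cC))
  have iV : IntervalIntegrable V volume 0 p.L := by
    rw [← uIcc_of_le hL.le] at cV; exact cV.intervalIntegrable
  have iW : IntervalIntegrable W volume 0 p.L := by
    rw [← uIcc_of_le hL.le] at cW; exact cW.intervalIntegrable
  have mono : ∀ {φ : ℝ → ℂ} {x : ℝ}, IntervalIntegrable φ volume 0 p.L → x ∈ Icc 0 p.L →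
      IntervalIntegrable φ volume 0 x := fun h hx => h.mono_set (by
    rw [uIcc_of_le hx.1, uIcc_of_le hL.le]; exact Icc_subset_Icc le_rfl hx.2)
  have hcS : ContinuousOn (fun x => a + k * S x) (uIcc 0 p.L) := by rwa [uIcc_of_le hL.le]
  have hcC : ContinuousOn (fun x => k * C x) (uIcc 0 p.L) := by rwa [uIcc_of_le hL.le]
  have sub_eq : ∀ {φ ψ χ : ℝ → ℂ} {x : ℝ}, x ∈ Icc 0 p.L → IntervalIntegrable φ volume 0 p.L →
      IntervalIntegrable ψ volume 0 p.L → (∀ s, φ s - ψ s = χ s) →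
      (∫ s in (0 : ℝ)..x, φ s) - ∫ s in (0 : ℝ)..x, ψ s = ∫ s in (0 : ℝ)..x, χ s := by
    intro φ ψ χ x hx h1 h2 h
    rw [← intervalIntegral.integral_sub (mono h1 hx) (mono h2 hx)]
    exact intervalIntegral.integral_congr fun s _ => h s
  have prod : ∀ {φ ψ : ℝ → ℂ} (b c : ℂ) {Φ Ψ : ℝ → ℂ}, IntervalIntegrable φ volume 0 p.L →
      IntervalIntegrable ψ volume 0 p.L → (∀ x, Φ x = b + ∫ s in (0 : ℝ)..x, φ s) →
      (∀ x, Ψ x = c + ∫ s in (0 : ℝ)..x, ψ s) → ∀ x ∈ Icc 0 p.L,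
      Φ x * Ψ x = b * c + ∫ s in (0 : ℝ)..x, (φ s * Ψ s + Φ s * ψ s) := by
    intro φ ψ b c Φ Ψ h1 h2 hΦ hΨ x hx
    rw [hΦ x, hΨ x, primitive_mul hL.le b c h1 h2 hx]
    simp only [hΦ, hΨ]
  have ksh : IntervalIntegrable (fun s => k * sh s) volume 0 p.L := i1 (continuous_const.mul hshc)
  have kch : IntervalIntegrable (fun s => k * ch s) volume 0 p.L := i1 (continuous_const.mul hchc)
  have hV : ∀ x ∈ Icc 0 p.L, V x = a + ∫ s in (0 : ℝ)..x, W s := by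
    intro x hx
    simp only [V]
    rw [prod 1 a ksh ikf pch pS x hx, prod 0 0 kch ikc psh pC x hx]
    rw [one_mul, zero_mul, zero_add, add_sub_assoc, sub_eq hx
      ((ksh.mul_continuousOn hcS).add (ikf.continuousOn_mul hchc.continuousOn))
      ((kch.mul_continuousOn hcC).add (ikc.continuousOn_mul hshc.continuousOn))]
    intro s; simp only [W]; ring
  have hW : ∀ x ∈ Icc 0 p.L, W x = 0 + ∫ s in (0 : ℝ)..x, (k ^ 2 : ℂ) * (V s - f s) := by
    intro x hx
    simp only [W]
    rw [prod 0 a kch ikf psh pS x hx, prod 1 0 ksh ikc pch pC x hx, mul_zero, zero_mul,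
      zero_add, zero_add, zero_add, sub_eq hx
      ((kch.mul_continuousOn hcS).add (ikf.continuousOn_mul hshc.continuousOn))
      ((ksh.mul_continuousOn hcC).add (ikc.continuousOn_mul hchc.continuousOn)) (fun s => rfl),
      ← intervalIntegral.integral_const_mul]
    refine intervalIntegral.integral_congr fun s _ => ?_
    have := hsq s
    simp only [V]
    linear_combination (-(k ^ 2 : ℂ) * f s) * this
  let VX : X p := (H1.memLp_of_continuous cV).toLp
  have eVX : VX =ᵐ[volume.restrict (Ioc 0 p.L)] V := MemLp.coeFn_toLp _
  let w : H1 p := H1.mk 0 ((k ^ 2 : ℂ) • (VX - f))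
  have hw : ∀ x ∈ Icc 0 p.L, H1.fn w x = W x := by
    intro x hx
    rw [H1.fn_eq w hx, hW x hx, H1.eval_left_mk, H1.deriv_mk, X.primitive_smul _ _ hx,
      intervalIntegral.integral_const_mul]
    congr 2
    refine X.integral_congr ?_ hx
    filter_upwards [Lp.coeFn_sub VX f, eVX] with s h1 h2
    rw [h1, Pi.sub_apply, h2]
  let v : H2 p := H2.mk a w
  have hv : ∀ x ∈ Icc 0 p.L, H1.fn (H2.toH1 v) x = V x := by
    intro x hx
    rw [H1.fn_eq _ hx, hV x hx, H2.deriv_toH1]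
    congr 1
    · exact H1.eval_left_mk _ _
    · change ∫ s in (0 : ℝ)..x, H1.toX w s = _
      rw [X.integral_congr (H1.coeFn_toX w) hx]
      refine intervalIntegral.integral_congr fun s hs => hw s ?_
      rw [uIcc_of_le hx.1] at hs
      exact ⟨hs.1, hs.2.trans hx.2⟩
  refine ⟨v, H1.eval_left_mk _ _, ?_, ?_⟩
  · change H1.eval p.right w = 0
    rw [H1.eval_eq_fn]
    change H1.fn w p.L = 0
    rw [hw _ hLm]
    simp only [W, a]
    field_simp
    ring
  · have e1 : H1.toX (H2.toH1 v) = VX := by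
      refine Lp.ext ?_
      filter_upwards [H1.coeFn_toX (H2.toH1 v), eVX, ae_restrict_mem measurableSet_Ioc]
        with s h1 h2 hs
      rw [h1, h2, hv s (Ioc_subset_Icc_self hs)]
    have e2 : H2.dxx v = (k ^ 2 : ℂ) • (VX - f) := rfl
    have e3 : (p.ξ : ℂ) * (k : ℂ) ^ 2 = 1 := by exact_mod_cast hkξ
    rw [e1, e2, smul_smul, e3, one_smul, sub_sub_cancel]

/-- The unique `v ∈ H²(0,L)` with `v_x(0) = v_x(L) = 0` and `v - ξ v_xx = f`. -/
def neumannSol : X p →ₗ[ℂ] H2 p where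
  toFun f := (exists_isNeumannSolution f).choose
  map_add' f g := (exists_isNeumannSolution (f + g)).choose_spec.unique
    ((exists_isNeumannSolution f).choose_spec.add (exists_isNeumannSolution g).choose_spec)
  map_smul' c f := (exists_isNeumannSolution (c • f)).choose_spec.unique
    ((exists_isNeumannSolution f).choose_spec.smul c)

theorem neumannSol_spec (f : X p) : IsNeumannSolution p f (neumannSol f) :=
  (exists_isNeumannSolution f).choose_spec

/-- `P_ξ = (-ξ D_x² + I)⁻¹`, with `Dom (D_x²) = {v ∈ H²(0,L) : v_x(0) = v_x(L) = 0}`. -/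
def Pξ : X p →ₗ[ℂ] X p := H1.toX ∘ₗ H2.toH1 ∘ₗ neumannSol

theorem inner_Pξ (f g : X p) : ⟪f, Pξ g⟫_ℂ = ⟪Pξ f, Pξ g⟫_ℂ +
    (p.ξ : ℂ) * ⟪H1.toX (H2.dx (neumannSol f)), H1.toX (H2.dx (neumannSol g))⟫_ℂ := by
  have h := (neumannSol_spec f).inner_eq (H2.toH1 (neumannSol g))
  rw [H2.deriv_toH1] at h
  have h' := congrArg (starRingEnd ℂ) h
  rw [map_add, map_mul, inner_conj_symm, inner_conj_symm, inner_conj_symm,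
    Complex.conj_ofReal] at h'
  exact h'

theorem Pξ_symm (f g : X p) : ⟪Pξ f, g⟫_ℂ = ⟪f, Pξ g⟫_ℂ := by
  rw [← inner_conj_symm, inner_Pξ g f, inner_Pξ f g, map_add, map_mul, Complex.conj_ofReal,
    inner_conj_symm, inner_conj_symm]

variable (p)

/-- The tuples `(y₁, y₂, y₃, y₄, y₅) = (v¹, v³, w, θ, η)` in `H¹ × H¹ × H² × H¹ × H¹` with
`y₁(0) = y₂(0) = y₃(0) = (y₃)_x(0) = 0`, `y₄(0) = y₄(L) = 0` and the gauge condition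
`-ξ (y₄)_x + y₅ = 0`. -/
def VSubmodule : Submodule ℂ (H1 p × H1 p × H2 p × H1 p × H1 p) where
  carrier := {y |
    H1.eval p.left y.1 = 0 ∧
    H1.eval p.left y.2.1 = 0 ∧
    H1.eval p.left (H2.toH1 y.2.2.1) = 0 ∧ H1.eval p.left (H2.dx y.2.2.1) = 0 ∧
    H1.eval p.left y.2.2.2.1 = 0 ∧ H1.eval p.right y.2.2.2.1 = 0 ∧
    H1.toX y.2.2.2.2 = (p.ξ : ℂ) • H1.deriv y.2.2.2.1}
  zero_mem' := by
    refine ⟨?_, ?_, ?_, ?_, ?_, ?_, ?_⟩ <;> simp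
  add_mem' := fun {u v} ⟨a1, a2, a3, a4, a5, a6, a7⟩ ⟨b1, b2, b3, b4, b5, b6, b7⟩ => by
    refine ⟨?_, ?_, ?_, ?_, ?_, ?_, ?_⟩ <;>
    simp only [Prod.fst_add, Prod.snd_add, map_add, smul_add, *, add_zero]
  smul_mem' := fun c u ⟨a1, a2, a3, a4, a5, a6, a7⟩ => by
    refine ⟨?_, ?_, ?_, ?_, ?_, ?_, ?_⟩ <;>
    simp only [Prod.smul_fst, Prod.smul_snd, map_smul, smul_zero, *]
    rw [smul_comm]

/-- The space `V` of positions. -/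
def V : Type := VSubmodule p

instance : AddCommGroup (V p) := inferInstanceAs (AddCommGroup (VSubmodule p))
instance : Module ℂ (V p) := inferInstanceAs (Module ℂ (VSubmodule p))

variable {p}

namespace V

/-- The underlying tuple. -/
def incl : V p →ₗ[ℂ] H1 p × H1 p × H2 p × H1 p × H1 p := (VSubmodule p).subtype
/-- Component `y₁`. -/
def y₁ : V p →ₗ[ℂ] H1 p := LinearMap.fst ℂ _ _ ∘ₗ incl
/-- Component `y₂`. -/
def y₂ : V p →ₗ[ℂ] H1 p := LinearMap.fst ℂ _ _ ∘ₗ LinearMap.snd ℂ _ _ ∘ₗ incl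
/-- Component `y₃`. -/
def y₃ : V p →ₗ[ℂ] H2 p :=
  LinearMap.fst ℂ _ _ ∘ₗ LinearMap.snd ℂ _ _ ∘ₗ LinearMap.snd ℂ _ _ ∘ₗ incl
/-- Component `y₄`. -/
def y₄ : V p →ₗ[ℂ] H1 p :=
  LinearMap.fst ℂ _ _ ∘ₗ LinearMap.snd ℂ _ _ ∘ₗ LinearMap.snd ℂ _ _ ∘ₗ LinearMap.snd ℂ _ _ ∘ₗ incl
/-- Component `y₅`. -/
def y₅ : V p →ₗ[ℂ] H1 p :=
  LinearMap.snd ℂ _ _ ∘ₗ LinearMap.snd ℂ _ _ ∘ₗ LinearMap.snd ℂ _ _ ∘ₗ LinearMap.snd ℂ _ _ ∘ₗ incl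

theorem spec (y : V p) :
    H1.eval p.left (y₁ y) = 0 ∧ H1.eval p.left (y₂ y) = 0 ∧
    H1.eval p.left (H2.toH1 (y₃ y)) = 0 ∧ H1.eval p.left (H2.dx (y₃ y)) = 0 ∧
    H1.eval p.left (y₄ y) = 0 ∧ H1.eval p.right (y₄ y) = 0 ∧
    H1.toX (y₅ y) = (p.ξ : ℂ) • H1.deriv (y₄ y) := y.2

/-- `-y₁ + y₂ + H (y₃)_x`, that is `h₂ φ²`. -/
def shear : V p →ₗ[ℂ] X p :=
  -(H1.toX ∘ₗ y₁) + H1.toX ∘ₗ y₂ + (p.H : ℂ) • (H1.toX ∘ₗ H2.dx ∘ₗ y₃)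

/-- `y₄ - (y₅)_x`. -/
def curl : V p →ₗ[ℂ] X p := H1.toX ∘ₗ y₄ - H1.deriv ∘ₗ y₅

/-- The inner product of `V` (conjugate linear in the first argument); the associated operator
`A : V → V'` is `⟨A y, ψ⟩ = ⟪ψ, y⟫`. -/
def innerV (x y : V p) : ℂ :=
  (p.α₁ * p.h₁ : ℝ) * ⟪H1.deriv (y₁ x), H1.deriv (y₁ y)⟫_ℂ +
  (p.α₃ * p.h₃ : ℝ) * ⟪H1.deriv (y₂ x), H1.deriv (y₂ y)⟫_ℂ +
  (p.γ ^ 2 * p.h₃ / p.ε₃ : ℝ) * ⟪H1.deriv (y₂ x), Pξ (H1.deriv (y₂ y))⟫_ℂ +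
  (p.K₂ : ℝ) * ⟪H2.dxx (y₃ x), H2.dxx (y₃ y)⟫_ℂ +
  (p.G₂ / p.h₂ : ℝ) * ⟪shear x, shear y⟫_ℂ +
  (p.μ * p.h₃ : ℝ) * ⟪curl x, curl y⟫_ℂ

theorem innerV_self (x : V p) : innerV x x =
    ((p.α₁ * p.h₁) * ‖H1.deriv (y₁ x)‖ ^ 2 + (p.α₃ * p.h₃) * ‖H1.deriv (y₂ x)‖ ^ 2 +
      (p.γ ^ 2 * p.h₃ / p.ε₃) * (‖Pξ (H1.deriv (y₂ x))‖ ^ 2 +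
        p.ξ * ‖H1.toX (H2.dx (neumannSol (H1.deriv (y₂ x))))‖ ^ 2) +
      p.K₂ * ‖H2.dxx (y₃ x)‖ ^ 2 + (p.G₂ / p.h₂) * ‖shear x‖ ^ 2 +
      (p.μ * p.h₃) * ‖curl x‖ ^ 2 : ℝ) := by
  rw [innerV, inner_Pξ]
  simp only [inner_self_eq_norm_sq_to_K]
  push_cast
  rfl

theorem eq_zero_of_curl {x : V p} (h : curl x = 0) : y₄ x = 0 ∧ y₅ x = 0 := by
  obtain ⟨-, -, -, -, s5, s6, s7⟩ := spec x
  have hξ := p.ξ_pos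
  have he : H1.toX (y₄ x) = H1.deriv (y₅ x) := sub_eq_zero.mp h
  have hi := H1.integration_by_parts (y₄ x) (y₅ x)
  rw [s5, s6, map_zero, zero_mul, zero_mul, sub_zero, s7, inner_smul_right,
    ← he, inner_self_eq_norm_sq_to_K, inner_self_eq_norm_sq_to_K] at hi
  have hr : p.ξ * ‖H1.deriv (y₄ x)‖ ^ 2 + ‖H1.toX (y₄ x)‖ ^ 2 = 0 := by
    apply Complex.ofReal_injective
    push_cast
    exact hi
  have n2 : ‖H1.toX (y₄ x)‖ ^ 2 = 0 := by
    have := mul_nonneg hξ.le (sq_nonneg ‖H1.deriv (y₄ x)‖)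
    have := sq_nonneg ‖H1.toX (y₄ x)‖
    linarith
  have z4 : y₄ x = 0 := H1.toX_injective (by
    rw [map_zero, ← norm_eq_zero]; exact pow_eq_zero_iff (two_ne_zero) |>.mp n2)
  refine ⟨z4, H1.toX_injective ?_⟩
  rw [s7, z4, map_zero, map_zero, smul_zero]

/-- `innerV` is an inner product. -/
@[reducible] def core : InnerProductSpace.Core ℂ (V p) where
  inner := innerV
  conj_inner_symm x y := by
    simp only [innerV, map_add, map_mul, Complex.conj_ofReal, inner_conj_symm]
    rw [Pξ_symm]
  re_inner_nonneg x := by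
    rw [innerV_self]
    have := p.α₁_pos; have := p.α₃_pos; have := p.h₁_pos; have := p.h₂_pos; have := p.h₃_pos
    have := p.ε₃_pos; have := p.G₂_pos; have := p.μ_pos; have := p.K₂_pos; have := p.ξ_pos
    simp only [RCLike.re_eq_complex_re, Complex.ofReal_re]
    positivity
  add_left x y z := by
    simp only [innerV, map_add, inner_add_left]; ring
  smul_left x y c := by
    simp only [innerV, map_smul, inner_smul_left]; ring
  definite x h := by
    change innerV x x = 0 at h
    rw [innerV_self] at h
    have h := Complex.ofReal_eq_zero.mp h
    have c1 := p.α₁_pos; have c2 := p.α₃_pos; have c3 := p.h₁_pos; have c4 := p.h₂_pos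
    have c5 := p.h₃_pos; have c6 := p.ε₃_pos; have c7 := p.G₂_pos; have c8 := p.μ_pos
    have c9 := p.K₂_pos; have c10 := p.ξ_pos
    have n1 : 0 ≤ (p.α₁ * p.h₁) * ‖H1.deriv (y₁ x)‖ ^ 2 := by positivity
    have n2 : 0 ≤ (p.α₃ * p.h₃) * ‖H1.deriv (y₂ x)‖ ^ 2 := by positivity
    have n3 : 0 ≤ (p.γ ^ 2 * p.h₃ / p.ε₃) * (‖Pξ (H1.deriv (y₂ x))‖ ^ 2 +
        p.ξ * ‖H1.toX (H2.dx (neumannSol (H1.deriv (y₂ x))))‖ ^ 2) := by positivity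
    have n4 : 0 ≤ p.K₂ * ‖H2.dxx (y₃ x)‖ ^ 2 := by positivity
    have n5 : 0 ≤ (p.G₂ / p.h₂) * ‖shear x‖ ^ 2 := by positivity
    have n6 : 0 ≤ (p.μ * p.h₃) * ‖curl x‖ ^ 2 := by positivity
    have key : ∀ {c : ℝ} {v : X p}, 0 < c → c * ‖v‖ ^ 2 = 0 → v = 0 := fun hc h => by
      simpa [hc.ne'] using h
    have z1 := key (mul_pos c1 c3) (le_antisymm (by linarith) n1)
    have z2 := key (mul_pos c2 c5) (le_antisymm (by linarith) n2)
    have z4 := key c9 (le_antisymm (by linarith) n4)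
    have z6 := key (mul_pos c8 c5) (le_antisymm (by linarith) n6)
    obtain ⟨s1, s2, s3, s4, -, -, -⟩ := spec x
    have w1 : y₁ x = 0 := H1.eq_of (by rw [s1, map_zero]) (by rw [z1, map_zero])
    have w2 : y₂ x = 0 := H1.eq_of (by rw [s2, map_zero]) (by rw [z2, map_zero])
    have w3' : H2.dx (y₃ x) = 0 := H1.eq_of (by rw [s4, map_zero]) (by
      rw [map_zero]; exact z4)
    have w3 : y₃ x = 0 := H2.eq_of (by rw [s3, map_zero, map_zero]) (by rw [w3', map_zero])
    obtain ⟨w4, w5⟩ := eq_zero_of_curl z6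
    exact Subtype.ext (Prod.ext w1 (Prod.ext w2 (Prod.ext w3 (Prod.ext w4 w5))))

end V

instance : NormedAddCommGroup (V p) := V.core.toNormedAddCommGroup
instance : InnerProductSpace ℂ (V p) := InnerProductSpace.ofCore V.core.toCore

variable (p)

/-- The tuples in `L² × L² × H¹ × L² × L²` with `z₃(0) = 0` that satisfy the gauge condition
`-ξ (z₄)_x + z₅ = 0`, `z₄(0) = z₄(L) = 0` weakly: `∫ (ξ z₄ ψ_x + z₅ ψ) = 0` for all `ψ ∈ H¹(0,L)`. -/
def HSubmodule : Submodule ℂ (X p × X p × H1 p × X p × X p) where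
  carrier := {z |
    H1.eval p.left z.2.2.1 = 0 ∧
    ∀ ψ : H1 p, (p.ξ : ℂ) * ⟪H1.deriv ψ, z.2.2.2.1⟫_ℂ + ⟪H1.toX ψ, z.2.2.2.2⟫_ℂ = 0}
  zero_mem' := by
    refine ⟨by simp, fun ψ => by simp⟩
  add_mem' := fun {u v} ⟨a1, a2⟩ ⟨b1, b2⟩ => by
    refine ⟨?_, fun ψ => ?_⟩
    · simp only [Prod.fst_add, Prod.snd_add, map_add, a1, b1, add_zero]
    · simp only [Prod.fst_add, Prod.snd_add, inner_add_right]
      linear_combination a2 ψ + b2 ψ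
  smul_mem' := fun c u ⟨a1, a2⟩ => by
    refine ⟨?_, fun ψ => ?_⟩
    · simp only [Prod.smul_fst, Prod.smul_snd, map_smul, a1, smul_zero]
    · simp only [Prod.smul_fst, Prod.smul_snd, inner_smul_right]
      linear_combination c * a2 ψ

/-- The space `H` of velocities. -/
def H : Type := HSubmodule p

instance : AddCommGroup (H p) := inferInstanceAs (AddCommGroup (HSubmodule p))
instance : Module ℂ (H p) := inferInstanceAs (Module ℂ (HSubmodule p))

variable {p}

namespace H

/-- The underlying tuple. -/
def incl : H p →ₗ[ℂ] X p × X p × H1 p × X p × X p := (HSubmodule p).subtype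
/-- Component `z₁`. -/
def z₁ : H p →ₗ[ℂ] X p := LinearMap.fst ℂ _ _ ∘ₗ incl
/-- Component `z₂`. -/
def z₂ : H p →ₗ[ℂ] X p := LinearMap.fst ℂ _ _ ∘ₗ LinearMap.snd ℂ _ _ ∘ₗ incl
/-- Component `z₃`. -/
def z₃ : H p →ₗ[ℂ] H1 p :=
  LinearMap.fst ℂ _ _ ∘ₗ LinearMap.snd ℂ _ _ ∘ₗ LinearMap.snd ℂ _ _ ∘ₗ incl
/-- Component `z₄`. -/
def z₄ : H p →ₗ[ℂ] X p :=
  LinearMap.fst ℂ _ _ ∘ₗ LinearMap.snd ℂ _ _ ∘ₗ LinearMap.snd ℂ _ _ ∘ₗ LinearMap.snd ℂ _ _ ∘ₗ incl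
/-- Component `z₅`. -/
def z₅ : H p →ₗ[ℂ] X p :=
  LinearMap.snd ℂ _ _ ∘ₗ LinearMap.snd ℂ _ _ ∘ₗ LinearMap.snd ℂ _ _ ∘ₗ LinearMap.snd ℂ _ _ ∘ₗ incl

/-- The inner product of `H` (conjugate linear in the first argument); the mass operator
`M : H → H'` is `⟨M z, ψ⟩ = ⟪ψ, z⟫`. -/
def innerH (x y : H p) : ℂ :=
  (p.ρ₁ * p.h₁ : ℝ) * ⟪z₁ x, z₁ y⟫_ℂ +
  (p.ρ₃ * p.h₃ : ℝ) * ⟪z₂ x, z₂ y⟫_ℂ +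
  (p.m : ℝ) * ⟪H1.toX (z₃ x), H1.toX (z₃ y)⟫_ℂ +
  (p.K₁ : ℝ) * ⟪H1.deriv (z₃ x), H1.deriv (z₃ y)⟫_ℂ +
  (p.ξ * p.h₃ * p.ε₃ : ℝ) * ⟪z₄ x, z₄ y⟫_ℂ +
  (p.ε₃ * p.h₃ : ℝ) * ⟪z₅ x, z₅ y⟫_ℂ

theorem innerH_self (x : H p) : innerH x x =
    ((p.ρ₁ * p.h₁) * ‖z₁ x‖ ^ 2 + (p.ρ₃ * p.h₃) * ‖z₂ x‖ ^ 2 +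
      p.m * ‖H1.toX (z₃ x)‖ ^ 2 + p.K₁ * ‖H1.deriv (z₃ x)‖ ^ 2 +
      (p.ξ * p.h₃ * p.ε₃) * ‖z₄ x‖ ^ 2 + (p.ε₃ * p.h₃) * ‖z₅ x‖ ^ 2 : ℝ) := by
  rw [innerH]
  simp only [inner_self_eq_norm_sq_to_K]
  push_cast
  rfl

/-- `innerH` is an inner product. -/
@[reducible] def core : InnerProductSpace.Core ℂ (H p) where
  inner := innerH
  conj_inner_symm x y := by
    simp only [innerH, map_add, map_mul, Complex.conj_ofReal, inner_conj_symm]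
  re_inner_nonneg x := by
    rw [innerH_self]
    have := p.ρ₁_pos; have := p.ρ₃_pos; have := p.h₁_pos; have := p.h₃_pos
    have := p.ε₃_pos; have := p.m_pos; have := p.K₁_pos; have := p.ξ_pos
    simp only [RCLike.re_eq_complex_re, Complex.ofReal_re]
    positivity
  add_left x y z := by
    simp only [innerH, map_add, inner_add_left]; ring
  smul_left x y c := by
    simp only [innerH, map_smul, inner_smul_left]; ring
  definite x h := by
    change innerH x x = 0 at h
    rw [innerH_self] at h
    have h := Complex.ofReal_eq_zero.mp h
    have c1 := p.ρ₁_pos; have c2 := p.ρ₃_pos; have c3 := p.h₁_pos; have c4 := p.h₃_pos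
    have c5 := p.ε₃_pos; have c6 := p.m_pos; have c7 := p.K₁_pos; have c8 := p.ξ_pos
    have n1 : 0 ≤ (p.ρ₁ * p.h₁) * ‖z₁ x‖ ^ 2 := by positivity
    have n2 : 0 ≤ (p.ρ₃ * p.h₃) * ‖z₂ x‖ ^ 2 := by positivity
    have n3 : 0 ≤ p.m * ‖H1.toX (z₃ x)‖ ^ 2 := by positivity
    have n4 : 0 ≤ p.K₁ * ‖H1.deriv (z₃ x)‖ ^ 2 := by positivity
    have n5 : 0 ≤ (p.ξ * p.h₃ * p.ε₃) * ‖z₄ x‖ ^ 2 := by positivity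
    have n6 : 0 ≤ (p.ε₃ * p.h₃) * ‖z₅ x‖ ^ 2 := by positivity
    have key : ∀ {c : ℝ} {v : X p}, 0 < c → c * ‖v‖ ^ 2 = 0 → v = 0 := fun hc h => by
      simpa [hc.ne'] using h
    have w1 := key (mul_pos c1 c3) (le_antisymm (by linarith) n1)
    have w2 := key (mul_pos c2 c4) (le_antisymm (by linarith) n2)
    have w3 := key c6 (le_antisymm (by linarith) n3)
    have w4 := key (mul_pos (mul_pos c8 c4) c5) (le_antisymm (by linarith) n5)
    have w5 := key (mul_pos c5 c4) (le_antisymm (by linarith) n6)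
    have w3' : z₃ x = 0 := H1.toX_injective (by rw [w3, map_zero])
    exact Subtype.ext (Prod.ext w1 (Prod.ext w2 (Prod.ext w3' (Prod.ext w4 w5))))

end H

instance : NormedAddCommGroup (H p) := H.core.toNormedAddCommGroup
instance : InnerProductSpace ℂ (H p) := InnerProductSpace.ofCore H.core.toCore

/-- The inclusion of `V` in `H`. -/
def ι : V p →ₗ[ℂ] H p where
  toFun y := ⟨(H1.toX (V.y₁ y), H1.toX (V.y₂ y), H2.toH1 (V.y₃ y), H1.toX (V.y₄ y),
    H1.toX (V.y₅ y)), y.spec.2.2.1, fun ψ => by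
      obtain ⟨-, -, -, -, s5, s6, s7⟩ := V.spec y
      have hi := H1.integration_by_parts ψ (V.y₄ y)
      rw [s5, s6, mul_zero, mul_zero, sub_zero] at hi
      change _ * ⟪_, H1.toX (V.y₄ y)⟫_ℂ + ⟪_, H1.toX (V.y₅ y)⟫_ℂ = 0
      rw [s7, inner_smul_right]
      linear_combination (p.ξ : ℂ) * hi⟩
  map_add' x y := by
    apply Subtype.ext
    change _ = (_, _, _, _, _)
    simp only [map_add]
  map_smul' c x := by
    apply Subtype.ext
    change _ = (_, _, _, _, _)
    simp only [map_smul]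
    rfl

variable (p) in
/-- The energy space `V × H`, with `‖(y,z)‖² = ‖y‖² + ‖z‖²`. -/
abbrev EnergySpace : Type := WithLp 2 (V p × H p)

/-- The operator `D : V → V'`, `⟨D z, ψ⟩ = γ h₃ ∫ (z₅ (ψ₂)_x - (z₂)_x ψ₅)` (second factor conjugated). -/
def formD (z ψ : V p) : ℂ :=
  (p.γ * p.h₃ : ℝ) * (⟪H1.deriv (V.y₂ ψ), H1.toX (V.y₅ z)⟫_ℂ -
    ⟪H1.toX (V.y₅ ψ), H1.deriv (V.y₂ z)⟫_ℂ)

/-- `φ ∈ Dom 𝒜` and `𝒜 φ = g`, where `𝒜 (y,z) = (-z, M⁻¹ (A y + D z))` on the domain of those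
`(y,z) ∈ V × V` for which the functional `A y + D z` on `V` belongs to `H'`, that is, has the form
`ψ ↦ ⟪ψ, k⟫_H` with `k = M⁻¹ (A y + D z) ∈ H`. -/
def IsAValue (φ g : EnergySpace p) : Prop :=
  ∃ y z : V p, φ = WithLp.toLp 2 (y, ι z) ∧ g.fst = -z ∧
    ∀ ψ : V p, ⟪ψ, y⟫_ℂ + formD z ψ = ⟪ι ψ, g.snd⟫_ℂ

/-- The dual control operator `B₀* : V → ℂ⁸`. -/
def B₀star (ψ : V p) : Fin 8 → ℂ :=
  ![H1.eval p.right (V.y₁ ψ),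
    ∫ x in (0 : ℝ)..p.L, H1.fn (V.y₁ ψ) x,
    (-p.γ / p.ε₃ : ℝ) * H1.eval p.right (V.y₂ ψ),
    ∫ x in (0 : ℝ)..p.L, H1.fn (V.y₂ ψ) x,
    H1.eval p.right (H2.toH1 (V.y₃ ψ)),
    -(p.K₂ : ℝ) * H1.eval p.right (H2.dx (V.y₃ ψ)),
    ∫ x in (0 : ℝ)..p.L, H1.fn (H2.toH1 (V.y₃ ψ)) x,
    (1 / (p.h₃ * p.ε₃) : ℝ) * ∫ x in (0 : ℝ)..p.L, H1.fn (V.y₄ ψ) x]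

/-- The control operator `B₀ : ℂ⁸ → V'`, `⟨B₀ v, ψ⟩ = ⟨v, B₀* ψ⟩`; the controls are
`v = (g¹, f¹, σ_s, f³, g, M, f, i_s¹)`. -/
def B₀ (v : Fin 8 → ℂ) (ψ : V p) : ℂ := ∑ j, v j * conj (B₀star ψ j)

/-- Controls on `(0,T)`: elements of `(L²(0,T))⁸`. -/
abbrev Control (T : ℝ) : Type := Fin 8 → Lp ℂ 2 (volume.restrict (Ioc 0 T))

/-- `φ = (y,z)` is a solution in `C([0,T]; V × H)` of `φ' + 𝒜 φ = B F`, `φ(0) = φ₀`. The equation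
is read in `H × V'` in the form integrated from `0` to `t`, that is `y(t) - y(0) = ∫₀ᵗ z` and
`M (z(t) - z(0)) + A ∫₀ᵗ y + D ∫₀ᵗ z = B₀ ∫₀ᵗ F`, where `∫₀ᵗ z = y(t) - y(0) ∈ V`. -/
structure IsSolution (T : ℝ) (φ₀ : EnergySpace p) (F : Control T) (φ : ℝ → EnergySpace p) :
    Prop where
  continuousOn : ContinuousOn φ (Icc 0 T)
  initial : φ 0 = φ₀
  position : ∀ t ∈ Icc 0 T, ∀ h : H p,
    ⟪h, ι ((φ t).fst - φ₀.fst)⟫_ℂ = ∫ s in (0 : ℝ)..t, ⟪h, (φ s).snd⟫_ℂ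
  velocity : ∀ t ∈ Icc 0 T, ∀ ψ : V p,
    ⟪ι ψ, (φ t).snd - φ₀.snd⟫_ℂ + (∫ s in (0 : ℝ)..t, ⟪ψ, (φ s).fst⟫_ℂ) +
      formD ((φ t).fst - φ₀.fst) ψ = ∫ s in (0 : ℝ)..t, B₀ (fun j => F j s) ψ

/-- `(S t)`, `t ≥ 0`, is a strongly continuous semigroup of contractions. -/
structure IsContractionSemigroup (S : ℝ → EnergySpace p →L[ℂ] EnergySpace p) : Prop where
  zero : S 0 = ContinuousLinearMap.id ℂ _
  add : ∀ s t, 0 ≤ s → 0 ≤ t → S (s + t) = (S s).comp (S t)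
  continuous : ∀ φ, ContinuousOn (fun t => S t φ) (Ici 0)
  contraction : ∀ t, 0 ≤ t → ‖S t‖ ≤ 1

/-- The infinitesimal generator of `S` is exactly `-𝒜` (with domain `Dom 𝒜`). -/
def IsGeneratedByNegA (S : ℝ → EnergySpace p →L[ℂ] EnergySpace p) : Prop :=
  ∀ φ g : EnergySpace p, IsAValue φ g ↔
    Tendsto (fun t : ℝ => ((t : ℂ)⁻¹) • (S t φ - φ)) (𝓝[>] 0) (𝓝 (-g))

/-- `b = (I + 𝒜)⁻¹ B v`, with `𝒜` extended to `V × V → V × V'`, `𝒜 (y,z) = (-z, A y + D z)` and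
`B v = (0, B₀ v)`. -/
def IsResolventOfInput (v : Fin 8 → ℂ) (b : EnergySpace p) : Prop :=
  ∃ y z : V p, b = WithLp.toLp 2 (y, ι z) ∧ y - z = 0 ∧
    ∀ ψ : V p, ⟪ι ψ, ι z⟫_ℂ + (⟪ψ, y⟫_ℂ + formD z ψ) = B₀ v ψ

/-- Admissibility of the control operator `B` for the semigroup `S` generated by `-𝒜`: for every
`T > 0` and `F ∈ (L²(0,T))⁸` the integral `∫₀ᵀ S(T-s) B F(s) ds` of the extrapolated semigroup lies in
the energy space. As `(I + 𝒜)⁻¹` commutes with the semigroup, this says that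
`∫₀ᵀ S(T-s) (I + 𝒜)⁻¹ B F(s) ds` lies in `Dom 𝒜`. -/
def IsAdmissible (S : ℝ → EnergySpace p →L[ℂ] EnergySpace p) : Prop :=
  ∃ b : Fin 8 → EnergySpace p, (∀ j, IsResolventOfInput (Pi.single j 1) (b j)) ∧
    ∀ T : ℝ, 0 < T → ∀ F : Control T, ∃ g : EnergySpace p,
      IsAValue (∫ s in (0 : ℝ)..T, S (T - s) (∑ j, (F j s : ℂ) • b j)) g

end RaoNakra

end

/-!
The operator `𝒜` is skew-adjoint: `V` is dense in `H`, the coupling `D` is skew-symmetric, and the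
range condition for `l + 𝒜`, `l ≠ 0` real, is a coercive stationary problem in `V`
(`isSkewAdjointGraph_graphA`). Hence `-𝒜` generates a unitary group. It is built here as the limit of
the exponentials of bounded skew-adjoint operators formed from the resolvents
(`IsSkewAdjointGraph.isUnitaryGroup_group`), and its generator is exactly `-𝒜`
(`IsUnitaryGroup.mem_iff_tendsto`).

Admissibility of the control operator `B` is dual to a hidden regularity estimate: along orbits
`φ = (y, z)` of the group, the traces of `z₁`, `z₂` and `(z₃)_x` at `x = L` are square integrable in time,
with a bound by the energy. This follows from the multiplier `x ∂ₓ`. A quadratic form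
`q(φ) = Re ∫ x (…)` of velocities against strains is bounded by the energy, and its rate of change along
orbits dominates the squared traces up to a multiple of the energy. Since the rate of change at `φ` only
involves `φ` and `𝒜 φ`, this is an inequality for the stationary equation `A y + D z = M k`
(`exists_multiplierForm_ge`), and orbits need no regularity beyond `Dom 𝒜`. The stationary equation
splits into scalar equations, from which the stresses are of class `H¹`; tested with `x` times the
strains, each of them yields a boundary term at `L` of the same sign. The terms in which the
piezoelectric coupling puts a derivative on both factors cancel, because the form `q` contains the term
`γ h₃ Re ∫ x (ȳ₂)_x (y₄ - (y₅)_x)`. In the magnetic equation the gauge condition creates an auxiliary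
elliptic field `r`, which is controlled by the trace of `z₂` and is absorbed (`V.exists_norm_sq_le`).

Integrated over time, the inequality bounds the observation `B*` of orbits
(`IsMultiplier.integral_observation_le`), and by duality the input integral lies in the energy space and
depends continuously on the time (`IsMultiplier.exists_input`). The variation of constants formula then
solves the system in the integrated form (`IsMultiplier.exists_solution`), and the difference of two
solutions integrates to an orbit of constant norm that starts at `0`
(`IsSkewAdjointGraph.eq_zero_of_integral_mem`).
-/

/-! ### Resolvents of skew-adjoint operators -/

namespace RaoNakra

section Stone

variable {E : Type*} [NormedAddCommGroup E] [InnerProductSpace ℂ E]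

/-- The graph of a skew-adjoint operator `A`: `A` is skew-symmetric, single-valued, and `l + A` is
onto for every real `l ≠ 0`. -/
structure IsSkewAdjointGraph (Γ : Submodule ℂ (E × E)) : Prop where
  skew : ∀ a ∈ Γ, ∀ b ∈ Γ, ⟪a.1, b.2⟫_ℂ = -⟪a.2, b.1⟫_ℂ
  surj : ∀ l : ℝ, l ≠ 0 → ∀ f : E, ∃ x, (x, f - (l : ℂ) • x) ∈ Γ
  single : ∀ f : E, ((0 : E), f) ∈ Γ → f = 0

namespace IsSkewAdjointGraph

variable {Γ : Submodule ℂ (E × E)} (hΓ : IsSkewAdjointGraph Γ)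
include hΓ

theorem re_inner_eq_zero {x x' : E} (h : (x, x') ∈ Γ) : (⟪x, x'⟫_ℂ).re = 0 := by
  have h1 := congrArg Complex.re (hΓ.skew _ h _ h)
  have h2 := inner_re_symm (𝕜 := ℂ) x x'
  simp only [RCLike.re_eq_complex_re, Complex.neg_re] at h1 h2
  linarith

theorem norm_le {x x' : E} (h : (x, x') ∈ Γ) (l : ℝ) : |l| * ‖x‖ ≤ ‖x' + (l : ℂ) • x‖ := by
  have h1 : (⟪x, x' + (l : ℂ) • x⟫_ℂ).re = l * ‖x‖ ^ 2 := by
    rw [inner_add_right, Complex.add_re, hΓ.re_inner_eq_zero h, inner_smul_right,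
      inner_self_eq_norm_sq_to_K, zero_add, Complex.re_ofReal_mul]
    norm_cast
  have h2 : |l| * ‖x‖ ^ 2 ≤ ‖x‖ * ‖x' + (l : ℂ) • x‖ := by
    rw [← abs_of_nonneg (sq_nonneg ‖x‖), ← abs_mul, ← h1]
    exact (Complex.abs_re_le_norm _).trans (norm_inner_le_norm _ _)
  rcases eq_or_lt_of_le (norm_nonneg x) with h0 | h0
  · rw [← h0, mul_zero]; positivity
  · nlinarith

theorem eq_of_mem {x y f : E} {l : ℝ} (hl : l ≠ 0) (hx : (x, f - (l : ℂ) • x) ∈ Γ)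
    (hy : (y, f - (l : ℂ) • y) ∈ Γ) : x = y := by
  have h := hΓ.norm_le (Γ.sub_mem hx hy) l
  have e : f - (l : ℂ) • x - (f - (l : ℂ) • y) + (l : ℂ) • (x - y) = 0 := by
    rw [smul_sub]; abel
  rw [e, norm_zero] at h
  have hl' := abs_pos.mpr hl
  have : ‖x - y‖ = 0 := le_antisymm (by by_contra hc; push Not at hc; nlinarith) (norm_nonneg _)
  exact sub_eq_zero.mp (norm_eq_zero.mp this)

/-- The resolvent `(l + A)⁻¹` at a real `l ≠ 0`. -/
noncomputable def res (l : ℝ) (hl : l ≠ 0) : E →L[ℂ] E :=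
  LinearMap.mkContinuous
    { toFun := fun f => (hΓ.surj l hl f).choose
      map_add' := fun f g => by
        refine hΓ.eq_of_mem hl (hΓ.surj l hl (f + g)).choose_spec ?_
        convert Γ.add_mem (hΓ.surj l hl f).choose_spec (hΓ.surj l hl g).choose_spec using 1
        rw [Prod.mk_add_mk, smul_add]; congr 1; abel
      map_smul' := fun c f => by
        refine hΓ.eq_of_mem hl (hΓ.surj l hl (c • f)).choose_spec ?_
        convert Γ.smul_mem c (hΓ.surj l hl f).choose_spec using 1
        rw [Prod.smul_mk, smul_sub, RingHom.id_apply, smul_comm] }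
    |l|⁻¹ (fun f => by
      have h := hΓ.norm_le (hΓ.surj l hl f).choose_spec l
      rw [sub_add_cancel] at h
      have := abs_pos.mpr hl
      rw [inv_mul_eq_div, le_div_iff₀ this, mul_comm]
      exact h)

variable {l : ℝ} (hl : l ≠ 0)

theorem res_mem (f : E) : (hΓ.res l hl f, f - (l : ℂ) • hΓ.res l hl f) ∈ Γ :=
  (hΓ.surj l hl f).choose_spec

theorem res_apply {x x' : E} (h : (x, x') ∈ Γ) : hΓ.res l hl (x' + (l : ℂ) • x) = x :=
  hΓ.eq_of_mem hl (hΓ.res_mem hl _) (by rwa [add_sub_cancel_right])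

theorem norm_res_apply_le (f : E) : ‖hΓ.res l hl f‖ ≤ |l|⁻¹ * ‖f‖ := by
  have h := hΓ.norm_le (hΓ.res_mem hl f) l
  rw [sub_add_cancel] at h
  rwa [inv_mul_eq_div, le_div_iff₀ (abs_pos.mpr hl), mul_comm]

theorem res_injective {f : E} (h : hΓ.res l hl f = 0) : f = 0 := by
  have h1 := hΓ.res_mem hl f
  rw [h, smul_zero, sub_zero] at h1
  exact hΓ.single _ h1

theorem resolvent_identity {m : ℝ} (hm : m ≠ 0) (f : E) :
    ((l - m : ℝ) : ℂ) • hΓ.res l hl (hΓ.res m hm f) = hΓ.res m hm f - hΓ.res l hl f := by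
  have h := hΓ.res_apply hl (hΓ.res_mem hm f)
  rw [map_add, map_sub, map_smul, map_smul] at h
  push_cast
  rw [sub_smul]
  linear_combination (norm := module) (1 : ℂ) • h

theorem res_comm {m : ℝ} (hm : m ≠ 0) : Commute (hΓ.res l hl) (hΓ.res m hm) := by
  rcases eq_or_ne l m with rfl | hlm
  · exact Commute.refl _
  ext f
  have h1 := hΓ.resolvent_identity hl hm f
  have h2 := hΓ.resolvent_identity hm hl f
  have h3 : ((l - m : ℝ) : ℂ) ≠ 0 := by exact_mod_cast sub_ne_zero.mpr hlm
  apply smul_right_injective E h3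
  change ((l - m : ℝ) : ℂ) • hΓ.res l hl (hΓ.res m hm f) =
    ((l - m : ℝ) : ℂ) • hΓ.res m hm (hΓ.res l hl f)
  rw [h1, ← neg_sub, ← h2, ← neg_smul]; congr 1; push_cast; ring

theorem inner_res (hl' : -l ≠ 0) (f g : E) :
    ⟪hΓ.res l hl f, g⟫_ℂ = -⟪f, hΓ.res (-l) hl' g⟫_ℂ := by
  have h := hΓ.skew _ (hΓ.res_mem hl f) _ (hΓ.res_mem hl' g)
  simp only [inner_sub_right, inner_sub_left, inner_smul_left, inner_smul_right,
    Complex.conj_ofReal] at h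
  push_cast at h
  linear_combination h

theorem dense_domain [CompleteSpace E] : Dense {x : E | ∃ x', (x, x') ∈ Γ} := by
  have h : (Γ.map (LinearMap.fst ℂ E E)).topologicalClosure = ⊤ := by
    rw [Submodule.topologicalClosure_eq_top_iff, eq_bot_iff]
    intro f hf
    rw [Submodule.mem_orthogonal] at hf
    have h1 : (1 : ℝ) ≠ 0 := one_ne_zero
    have h2 := hΓ.res_mem h1 f
    have h3 := hf _ ⟨_, h2, rfl⟩
    have h4 := hΓ.re_inner_eq_zero h2
    simp only [LinearMap.fst_apply] at h3
    rw [inner_sub_right, h3, zero_sub, inner_smul_right, inner_self_eq_norm_sq_to_K] at h4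
    have h5 : ‖hΓ.res 1 h1 f‖ = 0 := by
      simp only [Complex.ofReal_one, one_mul, Complex.neg_re, Complex.coe_algebraMap] at h4
      rw [← Complex.ofReal_pow, Complex.ofReal_re] at h4
      exact pow_eq_zero_iff two_ne_zero |>.mp (neg_eq_zero.mp h4)
    exact hΓ.res_injective h1 (norm_eq_zero.mp h5)
  refine (Submodule.dense_iff_topologicalClosure_eq_top.mpr h).mono ?_
  rintro x ⟨a, ha, rfl⟩
  exact ⟨a.2, ha⟩

/-- `l (l + A)⁻¹` tends strongly to the identity as `|l| → ∞`. -/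
theorem tendsto_smul_res [CompleteSpace E] {l : ℕ → ℝ} (hl : ∀ n, l n ≠ 0)
    (h : Tendsto (fun n => |l n|⁻¹) atTop (𝓝 0)) (f : E) :
    Tendsto (fun n => (l n : ℂ) • hΓ.res (l n) (hl n) f) atTop (𝓝 f) := by
  have hb : ∀ n f, ‖(l n : ℂ) • hΓ.res (l n) (hl n) f‖ ≤ ‖f‖ := fun n f => by
    rw [norm_smul, Complex.norm_real, Real.norm_eq_abs]
    have h1 := hΓ.norm_res_apply_le (hl n) f
    have h2 := abs_pos.mpr (hl n)
    calc _ ≤ |l n| * (|l n|⁻¹ * ‖f‖) := by gcongr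
      _ = ‖f‖ := by rw [mul_inv_cancel_left₀ h2.ne']
  rw [Metric.tendsto_atTop]
  intro ε hε
  obtain ⟨d, hd, d', hdd⟩ := Metric.dense_iff.mp hΓ.dense_domain f (ε / 3) (by positivity)
  rw [Metric.mem_ball, dist_eq_norm] at hd
  have hlim : Tendsto (fun n => |l n|⁻¹ * ‖d'‖) atTop (𝓝 0) := by simpa using h.mul_const ‖d'‖
  obtain ⟨N, hN⟩ := Metric.tendsto_atTop.mp hlim (ε / 3) (by positivity)
  refine ⟨N, fun n hn => ?_⟩
  have h1 := hN n hn
  rw [Real.dist_eq, sub_zero] at h1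
  have h1' := (le_abs_self _).trans_lt h1
  have h2 : (l n : ℂ) • hΓ.res (l n) (hl n) d - d = -hΓ.res (l n) (hl n) d' := by
    nth_rewrite 2 [← hΓ.res_apply (hl n) hdd]
    rw [map_add, map_smul]; abel
  have h3 : (l n : ℂ) • hΓ.res (l n) (hl n) f - f =
      (l n : ℂ) • hΓ.res (l n) (hl n) (f - d) + (-hΓ.res (l n) (hl n) d') + (d - f) := by
    rw [← h2, map_sub, smul_sub]; abel
  rw [dist_eq_norm, h3]
  have h4 := hb n (f - d)
  rw [norm_sub_rev] at hd
  have h5 := hΓ.norm_res_apply_le (hl n) d'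
  calc _ ≤ _ := norm_add₃_le
    _ < ε := by rw [norm_neg, norm_sub_rev d f]; linarith

end IsSkewAdjointGraph

end Stone

end RaoNakra

/-! ### The unitary group of a skew-adjoint operator -/

namespace RaoNakra

section Stone

variable {E : Type*} [NormedAddCommGroup E] [InnerProductSpace ℂ E] [CompleteSpace E]

section Exponential

variable {c : E →L[ℂ] E} (hc : c ∈ skewAdjoint (E →L[ℂ] E))
include hc

theorem norm_exp_apply_of_skewAdjoint (x : E) : ‖NormedSpace.exp c x‖ = ‖x‖ := by
  let _ : NormedAlgebra ℚ (E →L[ℂ] E) := NormedAlgebra.restrictScalars ℚ ℂ _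
  have h := NormedSpace.exp_mem_unitary_of_mem_skewAdjoint hc
  exact ContinuousLinearMap.norm_map_of_mem_unitary h x

theorem real_smul_mem_skewAdjoint (s : ℝ) : s • c ∈ skewAdjoint (E →L[ℂ] E) := by
  rw [skewAdjoint.mem_iff] at hc ⊢
  rw [star_smul, hc, star_trivial, smul_neg]

omit hc in
theorem hasDerivAt_exp_smul_apply (c : E →L[ℂ] E) (x : E) (s : ℝ) :
    HasDerivAt (fun s : ℝ => NormedSpace.exp (s • c) x) (NormedSpace.exp (s • c) (c x)) s :=
  ((ContinuousLinearMap.apply ℂ E x).restrictScalars ℝ).hasFDerivAt.comp_hasDerivAt s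
    (hasDerivAt_exp_smul_const (𝕂 := ℝ) c s)

theorem norm_exp_apply_sub_le (x : E) : ‖NormedSpace.exp c x - x‖ ≤ ‖c x‖ := by
  have h := norm_image_sub_le_of_norm_deriv_le_segment_01' (C := ‖c x‖)
    (f := fun s : ℝ => NormedSpace.exp (s • c) x)
    (fun s _ => (hasDerivAt_exp_smul_apply c x s).hasDerivWithinAt)
    (fun s _ => (norm_exp_apply_of_skewAdjoint (real_smul_mem_skewAdjoint hc s) _).le)
  simpa using h

/-- The first-order Taylor remainder of `exp c x`; `w` stands for a nearby vector at which `c w` is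
under control. -/
theorem norm_exp_apply_sub_sub_le (x w : E) :
    ‖NormedSpace.exp c x - x - c x‖ ≤ 2 * ‖c x - w‖ + ‖c w‖ := by
  have h := norm_image_sub_le_of_norm_deriv_le_segment_01' (C := 2 * ‖c x - w‖ + ‖c w‖)
    (f := fun s : ℝ => NormedSpace.exp (s • c) x - s • c x)
    (fun s _ => ((hasDerivAt_exp_smul_apply c x s).sub
      ((hasDerivAt_id s).smul_const (c x))).hasDerivWithinAt)
    (fun s hs => by
      have hs' := real_smul_mem_skewAdjoint hc s
      have e : NormedSpace.exp (s • c) (c x) - (1 : ℝ) • c x =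
          NormedSpace.exp (s • c) (c x - w) - (c x - w) + (NormedSpace.exp (s • c) w - w) := by
        rw [map_sub, one_smul]; abel
      have h1 := norm_exp_apply_sub_le hs' w
      have h2 := norm_exp_apply_of_skewAdjoint hs' (c x - w)
      have h3 : ‖(s • c) w‖ ≤ ‖c w‖ := by
        rw [smul_apply, norm_smul, Real.norm_of_nonneg hs.1]
        exact mul_le_of_le_one_left (norm_nonneg _) hs.2.le
      rw [e]
      calc _ ≤ _ := norm_add_le _ _
        _ ≤ (‖NormedSpace.exp (s • c) (c x - w)‖ + ‖c x - w‖) + ‖c w‖ :=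
          add_le_add (norm_sub_le _ _) (h1.trans h3)
        _ = _ := by rw [h2]; ring)
  simp only [one_smul, zero_smul, NormedSpace.exp_zero, sub_zero,
    one_apply_eq_self] at h
  rwa [sub_right_comm] at h

end Exponential

theorem norm_exp_sub_exp_apply_le {c d : E →L[ℂ] E} (hc : c ∈ skewAdjoint (E →L[ℂ] E))
    (hd : d ∈ skewAdjoint (E →L[ℂ] E)) (h : Commute c d) (x : E) :
    ‖NormedSpace.exp c x - NormedSpace.exp d x‖ ≤ ‖c x - d x‖ := by
  have e : NormedSpace.exp c = NormedSpace.exp d * NormedSpace.exp (c - d) := by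
    let _ : NormedAlgebra ℚ (E →L[ℂ] E) := NormedAlgebra.restrictScalars ℚ ℂ _
    have h' : Commute d (c - d) := h.symm.sub_right (Commute.refl d)
    rw [← NormedSpace.exp_add_of_commute h', add_sub_cancel]
  rw [e, mul_apply_eq_comp, ← map_sub, norm_exp_apply_of_skewAdjoint hd]
  exact norm_exp_apply_sub_le (sub_mem hc hd) x

/-- `S` is the strongly continuous unitary group `t ↦ exp (-t A)`, where `A` has the graph `Γ`. -/
structure IsUnitaryGroup (Γ : Submodule ℂ (E × E)) (S : ℝ → E →L[ℂ] E) : Prop where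
  zero_apply : ∀ x, S 0 x = x
  add_apply : ∀ s t x, S (s + t) x = S s (S t x)
  norm_apply : ∀ t x, ‖S t x‖ = ‖x‖
  continuous_apply : ∀ x, Continuous fun t => S t x
  apply_mem : ∀ t x x', (x, x') ∈ Γ → (S t x, S t x') ∈ Γ
  hasDerivAt : ∀ x x', (x, x') ∈ Γ → ∀ t, HasDerivAt (fun t => S t x) (-S t x') t

namespace IsSkewAdjointGraph

variable {Γ : Submodule ℂ (E × E)} (hΓ : IsSkewAdjointGraph Γ)
include hΓ

/-- The bounded skew-adjoint operators `-n² A (n² - A²)⁻¹`, with `n + 1` in place of `n`, written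
as half the sum of `n² (n + A)⁻¹` and `n² (-n + A)⁻¹`; they tend strongly to `-A`. -/
noncomputable def approx (n : ℕ) : E →L[ℂ] E :=
  (((n + 1 : ℝ) ^ 2 / 2 : ℝ) : ℂ) • (hΓ.res (n + 1 : ℝ) (by positivity) +
    hΓ.res (-(n + 1 : ℝ)) (neg_ne_zero.mpr (by positivity)))

theorem approx_mem_skewAdjoint (n : ℕ) : hΓ.approx n ∈ skewAdjoint (E →L[ℂ] E) := by
  rw [skewAdjoint.mem_iff, ContinuousLinearMap.star_eq_adjoint]
  symm
  rw [ContinuousLinearMap.eq_adjoint_iff]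
  intro x y
  have hn : (n + 1 : ℝ) ≠ 0 := by positivity
  have h1 := hΓ.inner_res hn (neg_ne_zero.mpr hn) x y
  have h2 := hΓ.inner_res hn (neg_ne_zero.mpr hn) y x
  have h3 := congrArg (starRingEnd ℂ) h2
  rw [map_neg, inner_conj_symm, inner_conj_symm] at h3
  simp only [approx, neg_apply, smul_apply,
    add_apply, inner_neg_left, inner_smul_left, inner_smul_right,
    inner_add_left, inner_add_right, Complex.conj_ofReal, h1, h3]
  ring

omit [CompleteSpace E] in
theorem commute_approx_res (n : ℕ) {l : ℝ} (hl : l ≠ 0) :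
    Commute (hΓ.approx n) (hΓ.res l hl) :=
  ((hΓ.res_comm _ hl).add_left (hΓ.res_comm _ hl)).smul_left _

omit [CompleteSpace E] in
theorem commute_approx (n m : ℕ) : Commute (hΓ.approx n) (hΓ.approx m) :=
  ((hΓ.commute_approx_res n _).add_right (hΓ.commute_approx_res n _)).smul_right _

theorem tendsto_approx {x x' : E} (h : (x, x') ∈ Γ) :
    Tendsto (fun n => hΓ.approx n x) atTop (𝓝 (-x')) := by
  have hp : ∀ n : ℕ, (n + 1 : ℝ) ≠ 0 := fun n => by positivity
  have hm : ∀ n : ℕ, -(n + 1 : ℝ) ≠ 0 := fun n => neg_ne_zero.mpr (hp n)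
  have hl : Tendsto (fun n : ℕ => |(n + 1 : ℝ)|⁻¹) atTop (𝓝 0) := by
    refine tendsto_one_div_add_atTop_nhds_zero_nat.congr fun n => ?_
    rw [abs_of_pos (by positivity), one_div]
  have hl' : Tendsto (fun n : ℕ => |-(n + 1 : ℝ)|⁻¹) atTop (𝓝 0) := by simpa only [abs_neg] using hl
  have h1 := hΓ.tendsto_smul_res hp hl x'
  have h2 := hΓ.tendsto_smul_res hm hl' x'
  have h3 := ((h1.add h2).const_smul (-(1 / 2) : ℂ))
  have e : (-(1 / 2) : ℂ) • (x' + x') = -x' := by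
    rw [← two_smul ℂ x', smul_smul]; norm_num
  rw [e] at h3
  refine h3.congr fun n => ?_
  have e1 := hΓ.res_apply (hp n) h
  have e2 := hΓ.res_apply (hm n) h
  rw [map_add, map_smul] at e1 e2
  simp only [approx, smul_apply, add_apply]
  push_cast at e1 e2 ⊢
  linear_combination (norm := module) (-((n + 1 : ℂ) / 2)) • e1 + ((n + 1 : ℂ) / 2) • e2

theorem exp_approx_comm (n : ℕ) (t : ℝ) {l : ℝ} (hl : l ≠ 0) (x : E) :
    NormedSpace.exp (t • hΓ.approx n) (hΓ.res l hl x) =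
      hΓ.res l hl (NormedSpace.exp (t • hΓ.approx n) x) :=
  congrArg (fun f : E →L[ℂ] E => f x)
    (((hΓ.commute_approx_res n hl).smul_left t).exp_left).eq

theorem exp_approx_mem (n : ℕ) (t : ℝ) : t • hΓ.approx n ∈ skewAdjoint (E →L[ℂ] E) :=
  real_smul_mem_skewAdjoint (hΓ.approx_mem_skewAdjoint n) t

theorem cauchySeq_exp_approx (t : ℝ) (x : E) :
    CauchySeq fun n => NormedSpace.exp (t • hΓ.approx n) x := by
  rw [Metric.cauchySeq_iff']
  intro ε hε
  obtain ⟨d, hd, d', hdd⟩ := Metric.dense_iff.mp hΓ.dense_domain x (ε / 3) (by positivity)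
  rw [Metric.mem_ball, dist_eq_norm] at hd
  have hc : CauchySeq fun n => t • hΓ.approx n d :=
    ((hΓ.tendsto_approx hdd).const_smul t).cauchySeq
  obtain ⟨N, hN⟩ := Metric.cauchySeq_iff'.mp hc (ε / 3) (by positivity)
  refine ⟨N, fun n hn => ?_⟩
  have h1 := hN n hn
  rw [dist_eq_norm] at h1 ⊢
  have h2 := norm_exp_sub_exp_apply_le (hΓ.exp_approx_mem n t) (hΓ.exp_approx_mem N t)
    (((hΓ.commute_approx n N).smul_left t).smul_right t) d
  have h3 := norm_exp_apply_of_skewAdjoint (hΓ.exp_approx_mem n t) (d - x)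
  have h4 := norm_exp_apply_of_skewAdjoint (hΓ.exp_approx_mem N t) (d - x)
  have e : NormedSpace.exp (t • hΓ.approx n) x - NormedSpace.exp (t • hΓ.approx N) x =
      (NormedSpace.exp (t • hΓ.approx n) d - NormedSpace.exp (t • hΓ.approx N) d) -
      NormedSpace.exp (t • hΓ.approx n) (d - x) + NormedSpace.exp (t • hΓ.approx N) (d - x) := by
    rw [map_sub, map_sub]; abel
  rw [e]
  calc _ ≤ _ := norm_add_le _ _
    _ ≤ _ := add_le_add_left (norm_sub_le _ _) _
    _ < ε := by
      rw [h3, h4]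
      have h5 := h2.trans_lt h1
      linarith

/-- The unitary group generated by `-A`, as the limit of the exponentials of `hΓ.approx n`. -/
noncomputable def group (t : ℝ) : E →L[ℂ] E :=
  LinearMap.mkContinuous
    { toFun := fun x => (cauchySeq_tendsto_of_complete (hΓ.cauchySeq_exp_approx t x)).choose
      map_add' := fun x y => by
        refine tendsto_nhds_unique (cauchySeq_tendsto_of_complete
          (hΓ.cauchySeq_exp_approx t (x + y))).choose_spec ?_
        simp only [map_add]
        exact (cauchySeq_tendsto_of_complete (hΓ.cauchySeq_exp_approx t x)).choose_spec.add
          (cauchySeq_tendsto_of_complete (hΓ.cauchySeq_exp_approx t y)).choose_spec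
      map_smul' := fun c x => by
        refine tendsto_nhds_unique (cauchySeq_tendsto_of_complete
          (hΓ.cauchySeq_exp_approx t (c • x))).choose_spec ?_
        simp only [map_smul]
        exact (cauchySeq_tendsto_of_complete
          (hΓ.cauchySeq_exp_approx t x)).choose_spec.const_smul c }
    1 (fun x => by
      refine le_of_tendsto (cauchySeq_tendsto_of_complete
          (hΓ.cauchySeq_exp_approx t x)).choose_spec.norm (Eventually.of_forall fun n => ?_)
      rw [norm_exp_apply_of_skewAdjoint (hΓ.exp_approx_mem n t), one_mul])

theorem tendsto_group (t : ℝ) (x : E) :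
    Tendsto (fun n => NormedSpace.exp (t • hΓ.approx n) x) atTop (𝓝 (hΓ.group t x)) :=
  (cauchySeq_tendsto_of_complete (hΓ.cauchySeq_exp_approx t x)).choose_spec

theorem norm_group_apply (t : ℝ) (x : E) : ‖hΓ.group t x‖ = ‖x‖ := by
  refine tendsto_nhds_unique (hΓ.tendsto_group t x).norm ?_
  simp only [norm_exp_apply_of_skewAdjoint (hΓ.exp_approx_mem _ t)]
  exact tendsto_const_nhds

theorem group_zero_apply (x : E) : hΓ.group 0 x = x := by
  refine tendsto_nhds_unique (hΓ.tendsto_group 0 x) ?_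
  simp only [zero_smul, NormedSpace.exp_zero]
  exact tendsto_const_nhds

theorem group_add_apply (s t : ℝ) (x : E) :
    hΓ.group (s + t) x = hΓ.group s (hΓ.group t x) := by
  refine tendsto_nhds_unique (hΓ.tendsto_group (s + t) x) ?_
  have e : ∀ n, NormedSpace.exp ((s + t) • hΓ.approx n) x =
      NormedSpace.exp (s • hΓ.approx n) (hΓ.group t x) + NormedSpace.exp (s • hΓ.approx n)
        (NormedSpace.exp (t • hΓ.approx n) x - hΓ.group t x) := fun n => by
    let _ : NormedAlgebra ℚ (E →L[ℂ] E) := NormedAlgebra.restrictScalars ℚ ℂ _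
    rw [add_smul, NormedSpace.exp_add_of_commute
      (((Commute.refl (hΓ.approx n)).smul_left s).smul_right t), map_sub, add_sub_cancel]
    rfl
  have h0 : Tendsto (fun n => NormedSpace.exp (s • hΓ.approx n)
      (NormedSpace.exp (t • hΓ.approx n) x - hΓ.group t x)) atTop (𝓝 0) := by
    rw [tendsto_zero_iff_norm_tendsto_zero]
    simp only [norm_exp_apply_of_skewAdjoint (hΓ.exp_approx_mem _ s)]
    rw [← tendsto_zero_iff_norm_tendsto_zero]
    exact tendsto_sub_nhds_zero_iff.mpr (hΓ.tendsto_group t x)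
  simp only [e]
  simpa using (hΓ.tendsto_group s (hΓ.group t x)).add h0

theorem group_res (t : ℝ) {l : ℝ} (hl : l ≠ 0) (x : E) :
    hΓ.group t (hΓ.res l hl x) = hΓ.res l hl (hΓ.group t x) := by
  refine tendsto_nhds_unique (hΓ.tendsto_group t _) ?_
  simp only [hΓ.exp_approx_comm]
  exact ((hΓ.res l hl).continuous.tendsto _).comp (hΓ.tendsto_group t x)

theorem group_mem (t : ℝ) {x x' : E} (h : (x, x') ∈ Γ) :
    (hΓ.group t x, hΓ.group t x') ∈ Γ := by
  have h1 := hΓ.res_mem one_ne_zero (hΓ.group t (x' + ((1 : ℝ) : ℂ) • x))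
  rw [← hΓ.group_res, hΓ.res_apply _ h, map_add, map_smul, add_sub_cancel_right] at h1
  exact h1

theorem norm_group_apply_sub_le (t : ℝ) {x x' : E} (h : (x, x') ∈ Γ) :
    ‖hΓ.group t x - x‖ ≤ |t| * ‖x'‖ := by
  have h1 := ((hΓ.tendsto_group t x).sub_const x).norm
  have h2 := (((hΓ.tendsto_approx h).const_smul t)).norm
  rw [norm_smul, norm_neg, Real.norm_eq_abs] at h2
  exact le_of_tendsto_of_tendsto' h1 h2 fun n =>
    norm_exp_apply_sub_le (hΓ.exp_approx_mem n t) x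

/-- Differentiability of the orbit of `x ∈ Dom A` at `t = 0`, with `A x` approximated by `w ∈ Dom A`. -/
theorem norm_group_apply_sub_add_le (t : ℝ) {x x' w w' : E} (h : (x, x') ∈ Γ) (hw : (w, w') ∈ Γ) :
    ‖hΓ.group t x - x + t • x'‖ ≤ |t| * (2 * ‖x' - w‖ + |t| * ‖w'‖) := by
  have h1 := (((hΓ.tendsto_group t x).sub_const x).sub ((hΓ.tendsto_approx h).const_smul t)).norm
  have h2 := ((((hΓ.tendsto_approx h).const_smul t).add_const (t • w)).norm.const_mul 2).add
    ((((hΓ.tendsto_approx hw).const_smul t).const_smul t).norm)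
  have h3 := le_of_tendsto_of_tendsto' h1 h2 fun n => by
    have h4 := norm_exp_apply_sub_sub_le (hΓ.exp_approx_mem n t) x (-(t • w))
    simp only [smul_apply, map_neg, norm_neg, sub_neg_eq_add,
      ContinuousLinearMap.map_smul_of_tower] at h4
    exact h4
  rw [smul_neg, sub_neg_eq_add, smul_neg, smul_neg, norm_neg, norm_smul, norm_smul,
    neg_add_eq_sub, ← smul_sub, norm_smul, norm_sub_rev, Real.norm_eq_abs] at h3
  linarith

theorem continuous_group_apply (x : E) : Continuous fun t => hΓ.group t x := by
  have hsub : ∀ s t x, ‖hΓ.group t x - hΓ.group s x‖ = ‖hΓ.group (t - s) x - x‖ := by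
    intro s t x
    rw [← hΓ.norm_group_apply s (hΓ.group (t - s) x - x), map_sub, ← hΓ.group_add_apply,
      add_sub_cancel]
  rw [Metric.continuous_iff]
  intro s ε hε
  obtain ⟨d, hd, d', hdd⟩ := Metric.dense_iff.mp hΓ.dense_domain x (ε / 4) (by positivity)
  rw [Metric.mem_ball, dist_eq_norm] at hd
  refine ⟨ε / (4 * (‖d'‖ + 1)), by positivity, fun t ht => ?_⟩
  rw [dist_eq_norm, hsub]
  rw [Real.dist_eq, lt_div_iff₀ (by positivity)] at ht
  have h1 := hΓ.norm_group_apply_sub_le (t - s) hdd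
  have h2 := hΓ.norm_group_apply (t - s) (d - x)
  have e : hΓ.group (t - s) x - x =
      (hΓ.group (t - s) d - d) - hΓ.group (t - s) (d - x) + (d - x) := by
    rw [map_sub]; abel
  rw [e]
  calc _ ≤ _ := norm_add_le _ _
    _ ≤ _ := add_le_add_left (norm_sub_le _ _) _
    _ < ε := by rw [h2]; nlinarith [abs_nonneg (t - s)]

theorem hasDerivAt_group {x x' : E} (h : (x, x') ∈ Γ) (t : ℝ) :
    HasDerivAt (fun t => hΓ.group t x) (-hΓ.group t x') t := by
  rw [hasDerivAt_iff_isLittleO, Asymptotics.isLittleO_iff]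
  intro ε hε
  obtain ⟨w, hw, w', hww⟩ := Metric.dense_iff.mp hΓ.dense_domain x' (ε / 4) (by positivity)
  rw [Metric.mem_ball, dist_comm, dist_eq_norm] at hw
  filter_upwards [Metric.ball_mem_nhds t (show 0 < ε / (2 * (‖w'‖ + 1)) by positivity)] with s hs
  rw [Metric.mem_ball, Real.dist_eq, lt_div_iff₀ (by positivity)] at hs
  have h1 := hΓ.norm_group_apply_sub_add_le (s - t) h hww
  rw [← hΓ.norm_group_apply t, map_add, map_sub, ← hΓ.group_add_apply, add_sub_cancel,
    ContinuousLinearMap.map_smul_of_tower] at h1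
  rw [smul_neg, sub_neg_eq_add, Real.norm_eq_abs, mul_comm ε]
  refine h1.trans ?_
  gcongr
  nlinarith [abs_nonneg (s - t)]

theorem isUnitaryGroup_group : IsUnitaryGroup Γ hΓ.group where
  zero_apply := hΓ.group_zero_apply
  add_apply := hΓ.group_add_apply
  norm_apply := hΓ.norm_group_apply
  continuous_apply := hΓ.continuous_group_apply
  apply_mem t _ _ h := hΓ.group_mem t h
  hasDerivAt _ _ h t := hΓ.hasDerivAt_group h t

end IsSkewAdjointGraph

end Stone

end RaoNakra

/-! ### Generators and multipliers -/

namespace RaoNakra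

section Group

variable {E : Type*} [NormedAddCommGroup E] [InnerProductSpace ℂ E]
  {Γ : Submodule ℂ (E × E)} {S : ℝ → E →L[ℂ] E}

namespace IsUnitaryGroup

variable (hS : IsUnitaryGroup Γ S)
include hS

theorem inner_apply_apply (t : ℝ) (x y : E) : ⟪S t x, S t y⟫_ℂ = ⟪x, y⟫_ℂ :=
  LinearIsometry.inner_map_map ⟨(S t).toLinearMap, hS.norm_apply t⟩ x y

theorem apply_neg_apply (t : ℝ) (x : E) : S t (S (-t) x) = x := by
  rw [← hS.add_apply, add_neg_cancel, hS.zero_apply]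

theorem inner_apply (t : ℝ) (x y : E) : ⟪x, S t y⟫_ℂ = ⟪S (-t) x, y⟫_ℂ := by
  rw [← hS.inner_apply_apply t (S (-t) x), hS.apply_neg_apply]

theorem apply_res (hΓ : IsSkewAdjointGraph Γ) (t : ℝ) {l : ℝ} (hl : l ≠ 0) (x : E) :
    S t (hΓ.res l hl x) = hΓ.res l hl (S t x) := by
  have h := hS.apply_mem t _ _ (hΓ.res_mem hl x)
  rw [map_sub, map_smul] at h
  have h1 := hΓ.res_apply hl h
  rw [sub_add_cancel] at h1
  exact h1.symm

theorem continuous_comp {X : Type*} [TopologicalSpace X] {f : X → ℝ} {g : X → E} {s : Set X}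
    (hf : ContinuousOn f s) (hg : ContinuousOn g s) : ContinuousOn (fun x => S (f x) (g x)) s := by
  intro x hx
  rw [ContinuousWithinAt, tendsto_iff_norm_sub_tendsto_zero]
  have h1 : Tendsto (fun y => ‖g y - g x‖) (𝓝[s] x) (𝓝 0) :=
    tendsto_iff_norm_sub_tendsto_zero.mp (hg x hx)
  have h2 : Tendsto (fun y => ‖S (f y) (g x) - S (f x) (g x)‖) (𝓝[s] x) (𝓝 0) :=
    tendsto_iff_norm_sub_tendsto_zero.mp
      (((hS.continuous_apply (g x)).tendsto (f x)).comp (hf x hx))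
  refine squeeze_zero (fun _ => norm_nonneg _) (fun y => ?_) (by simpa using h1.add h2)
  rw [← hS.norm_apply (f y) (g y - g x), map_sub]
  exact norm_sub_le_norm_sub_add_norm_sub _ _ _

/-- The infinitesimal generator of the group is `-A` with its full domain: skew-adjointness of `A`
rules out a proper extension. -/
theorem mem_iff_tendsto [CompleteSpace E] (hΓ : IsSkewAdjointGraph Γ) (x g : E) : (x, g) ∈ Γ ↔
    Tendsto (fun t : ℝ => ((t : ℂ)⁻¹) • (S t x - x)) (𝓝[>] 0) (𝓝 (-g)) := by
  have key : ∀ x g, (x, g) ∈ Γ →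
      Tendsto (fun t : ℝ => ((t : ℂ)⁻¹) • (S t x - x)) (𝓝[≠] 0) (𝓝 (-g)) := by
    intro x g h
    have h1 := (hasDerivAt_iff_tendsto_slope.mp (hS.hasDerivAt x g h 0))
    rw [hS.zero_apply] at h1
    refine h1.congr fun t => ?_
    rw [slope_def_module, sub_zero, hS.zero_apply, ← Complex.ofReal_inv]
    rfl
  refine ⟨fun h => (key x g h).mono_left (nhdsWithin_mono _ fun t ht => ne_of_gt ht), fun h => ?_⟩
  have hadj : ∀ u u', (u, u') ∈ Γ → ⟪u', x⟫_ℂ = -⟪u, g⟫_ℂ := by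
    intro u u' hu
    have h1 : Tendsto (fun t : ℝ => ⟪u, ((t : ℂ)⁻¹) • (S t x - x)⟫_ℂ) (𝓝[>] 0) (𝓝 ⟪u, -g⟫_ℂ) :=
      tendsto_const_nhds.inner h
    have hneg : Tendsto (fun t : ℝ => -t) (𝓝[>] 0) (𝓝[≠] 0) := by
      refine tendsto_nhdsWithin_iff.mpr ⟨?_, ?_⟩
      · have : Tendsto (fun t : ℝ => -t) (𝓝 0) (𝓝 (-0)) := tendsto_id.neg
        rw [neg_zero] at this
        exact this.mono_left nhdsWithin_le_nhds
      · filter_upwards [self_mem_nhdsWithin] with t ht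
        exact neg_ne_zero.mpr (ne_of_gt ht)
    have h2 := (((key u u' hu).comp hneg).neg).inner
      (tendsto_const_nhds (x := x)) (𝕜 := ℂ)
    rw [neg_neg] at h2
    rw [← inner_neg_right]
    refine tendsto_nhds_unique h2 (h1.congr fun t => ?_)
    simp only [Function.comp_apply, inner_smul_right, inner_sub_right, hS.inner_apply,
      inner_neg_left, inner_smul_left, inner_sub_left, map_inv₀, Complex.conj_ofReal,
      Complex.ofReal_neg, inv_neg, map_neg]
    ring
  -- `(1 + A)⁻¹ (g + x)` is tested against the dense range of `1 - A`
  have h1 : (1 : ℝ) ≠ 0 := one_ne_zero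
  have hm : (-1 : ℝ) ≠ 0 := by norm_num
  have hx : hΓ.res 1 h1 (g + x) = x := by
    refine ext_inner_left ℂ fun v => ?_
    have h2 := hΓ.res_mem hm v
    have h3 := hadj _ _ h2
    have h4 := hΓ.inner_res hm (by norm_num) v (g + x)
    simp only [neg_neg] at h4
    rw [inner_sub_left, inner_smul_left] at h3
    rw [inner_add_right] at h4
    simp only [Complex.ofReal_neg, Complex.ofReal_one, map_neg, map_one] at h3
    linear_combination h4 - h3
  have h2 := hΓ.res_mem h1 (g + x)
  rw [hx] at h2
  simpa using h2

end IsUnitaryGroup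

/-- The range of `(1 + A)⁻¹` in terms of its adjoint `(1 - A)⁻¹`. -/
theorem IsSkewAdjointGraph.exists_res_eq [CompleteSpace E] (hΓ : IsSkewAdjointGraph Γ) {w : E}
    {C : ℝ} (hC : 0 ≤ C) (h : ∀ u u', (u, u') ∈ Γ → ‖⟪u - u', w⟫_ℂ‖ ≤ C * ‖u‖) :
    ∃ g, hΓ.res 1 one_ne_zero g = w ∧ ‖g‖ ≤ C := by
  have hm : (-1 : ℝ) ≠ 0 := by norm_num
  let R : E →ₗ[ℂ] E := -(hΓ.res (-1) hm : E →ₗ[ℂ] E)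
  have hR : Function.Injective R := by
    rw [injective_iff_map_eq_zero]
    intro f hf
    exact hΓ.res_injective hm (neg_eq_zero.mp hf)
  have hRb : ∀ x, ‖⟪w, x⟫_ℂ‖ ≤ C * ‖R x‖ := fun x => by
    have h1 := Γ.neg_mem (hΓ.res_mem hm x)
    have h2 := h _ _ h1
    have e : -hΓ.res (-1) hm x - -(x - ((-1 : ℝ) : ℂ) • hΓ.res (-1) hm x) = x := by
      push_cast; rw [neg_one_smul]; abel
    rw [e, norm_inner_symm] at h2
    exact h2
  let e := LinearEquiv.ofInjective R hR
  let f : StrongDual ℂ R.range :=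
    LinearMap.mkContinuous ((innerSL ℂ w : E →ₗ[ℂ] ℂ) ∘ₗ e.symm.toLinearMap) C (fun y => by
      obtain ⟨x, rfl⟩ := e.surjective y
      simp only [LinearMap.comp_apply, LinearEquiv.coe_coe, LinearEquiv.symm_apply_apply]
      exact hRb x)
  obtain ⟨g₀, hg₀, hn⟩ := exists_extension_norm_eq _ f
  refine ⟨(InnerProductSpace.toDual ℂ E).symm g₀, ?_, ?_⟩
  · refine ext_inner_right ℂ fun x => ?_
    rw [hΓ.inner_res one_ne_zero hm, ← inner_neg_right]
    have h1 := hg₀ (e x)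
    have h2 : f (e x) = ⟪w, x⟫_ℂ := by
      change ⟪w, e.symm (e x)⟫_ℂ = _
      rw [LinearEquiv.symm_apply_apply]
    rw [h2] at h1
    rw [← h1]
    exact InnerProductSpace.toDual_symm_apply
  · rw [LinearIsometryEquiv.norm_map, hn]
    exact LinearMap.mkContinuous_norm_le _ hC _

/-- A function `q` that dominates the observation `x ↦ ⟪b j, (1 - A) x⟫` along the flow: the rate of
change `q' x (-A x)` of `q` bounds the squared observation up to `K ‖x‖²`. -/
structure IsMultiplier {ι : Type*} [Fintype ι] (Γ : Submodule ℂ (E × E)) (b : ι → E) (K : ℝ)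
    (q : E → ℝ) (q' : E → E → ℝ) : Prop where
  hasDerivAt : ∀ (f : ℝ → E) (f' : E) (t : ℝ), HasDerivAt f f' t →
    HasDerivAt (fun s => q (f s)) (q' (f t) f') t
  abs_le : ∀ x, |q x| ≤ K * ‖x‖ ^ 2
  sum_le : ∀ x x', (x, x') ∈ Γ → ∑ j, ‖⟪b j, x - x'⟫_ℂ‖ ^ 2 ≤ q' x (-x') + K * ‖x‖ ^ 2

section Admissible

variable {ι : Type*} [Fintype ι] {b : ι → E} {K : ℝ} {q : E → ℝ} {q' : E → E → ℝ}

/-- Hidden regularity: the observation of an orbit is square integrable in time, with a bound by the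
energy. -/
theorem IsMultiplier.integral_observation_le (hq : IsMultiplier Γ b K q q')
    (hS : IsUnitaryGroup Γ S) {u u' : E} (hu : (u, u') ∈ Γ) {T : ℝ} (hT : 0 ≤ T) :
    ∫ s in (0 : ℝ)..T, ∑ j, ‖⟪b j, S s (u - u')⟫_ℂ‖ ^ 2 ≤ K * (2 + T) * ‖u‖ ^ 2 := by
  have hc : Continuous fun s => ∑ j, ‖⟪b j, S s (u - u')⟫_ℂ‖ ^ 2 :=
    continuous_finsetSum _ fun j _ =>
      ((continuous_const.inner (hS.continuous_apply (u - u'))).norm.pow 2)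
  let h : ℝ → ℝ := fun t => q (S t u) + K * ‖u‖ ^ 2 * t -
    ∫ s in (0 : ℝ)..t, ∑ j, ‖⟪b j, S s (u - u')⟫_ℂ‖ ^ 2
  have hd : ∀ t, HasDerivAt h (q' (S t u) (-S t u') + K * ‖u‖ ^ 2 * 1 -
      ∑ j, ‖⟪b j, S t (u - u')⟫_ℂ‖ ^ 2) t := fun t =>
    ((hq.hasDerivAt _ _ t (hS.hasDerivAt u u' hu t)).add
      ((hasDerivAt_id t).const_mul (K * ‖u‖ ^ 2))).sub (hc.integral_hasStrictDerivAt 0 t).hasDerivAt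
  have hm : Monotone h := monotone_of_deriv_nonneg (fun t => (hd t).differentiableAt) fun t => by
    rw [(hd t).deriv]
    have h1 := hq.sum_le _ _ (hS.apply_mem t _ _ hu)
    rw [hS.norm_apply, ← map_sub] at h1
    linarith
  have h1 := hm hT
  simp only [h, intervalIntegral.integral_same, hS.zero_apply, mul_zero, add_zero, sub_zero] at h1
  have h2 := (_root_.abs_le.mp (hq.abs_le u)).1
  have h3 := (_root_.abs_le.mp (hq.abs_le (S T u))).2
  rw [hS.norm_apply] at h3
  linarith

/-- Integration by parts of a locally integrable scalar function against a differentiable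
vector-valued function. -/
theorem integral_smul_eq_sub [CompleteSpace E] {f : ℝ → ℂ} {v v' : ℝ → E} {t : ℝ} (ht : 0 ≤ t)
    (hf : IntervalIntegrable f volume 0 t) (hv : ∀ s, HasDerivAt v (v' s) s) (hv' : Continuous v') :
    ∫ s in (0 : ℝ)..t, f s • v s =
      (∫ s in (0 : ℝ)..t, f s) • v t - ∫ s in (0 : ℝ)..t, (∫ r in (0 : ℝ)..s, f r) • v' s := by
  have hvc : Continuous v := continuous_iff_continuousAt.mpr fun s => (hv s).continuousAt
  have hpc : ContinuousOn (fun s => ∫ r in (0 : ℝ)..s, f r) (uIcc 0 t) :=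
    (absolutelyContinuous_primitive hf).continuousOn
  refine ext_inner_left ℂ fun x => ?_
  have i1 : IntervalIntegrable (fun s => f s • v s) volume 0 t :=
    hf.smul_continuousOn hvc.continuousOn
  have i2 : IntervalIntegrable (fun s => (∫ r in (0 : ℝ)..s, f r) • v' s) volume 0 t :=
    (hpc.smul hv'.continuousOn).intervalIntegrable
  have e1 := (innerSL ℂ x).intervalIntegral_comp_comm i1
  have e2 := (innerSL ℂ x).intervalIntegral_comp_comm i2
  simp only [innerSL_apply_apply, inner_smul_right] at e1 e2
  have hcv : Continuous fun s => ⟪x, v' s⟫_ℂ := continuous_const.inner hv'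
  have e3 : ∀ s, ⟪x, v s⟫_ℂ = ⟪x, v 0⟫_ℂ + ∫ r in (0 : ℝ)..s, ⟪x, v' r⟫_ℂ := fun s => by
    rw [intervalIntegral.integral_eq_sub_of_hasDerivAt
      (f := fun s => ⟪x, v s⟫_ℂ) (fun r _ => ?_) (hcv.intervalIntegrable _ _)]
    · ring
    · have := (hasDerivAt_const r x).inner ℂ (hv r)
      simpa using this
  have key := primitive_mul ht 0 ⟪x, v 0⟫_ℂ hf (hcv.intervalIntegrable 0 t) ⟨ht, le_rfl⟩
  simp only [← e3, zero_add, zero_mul] at key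
  rw [intervalIntegral.integral_add (hf.mul_continuousOn (continuous_const.inner hvc).continuousOn)
    (ContinuousOn.intervalIntegrable (u := fun s => (∫ r in (0 : ℝ)..s, f r) * ⟪x, v' s⟫_ℂ)
      (hpc.mul hcv.continuousOn)), e1, e2] at key
  rw [inner_sub_right, inner_smul_right, key]
  ring

end Admissible

end Group

end RaoNakra

/-! ### Admissible inputs and mild solutions -/

namespace RaoNakra

section Control

variable {E : Type*} [NormedAddCommGroup E] [InnerProductSpace ℂ E] [CompleteSpace E]
  {Γ : Submodule ℂ (E × E)} {S : ℝ → E →L[ℂ] E} {ι : Type*} [Fintype ι] {b : ι → E} {K : ℝ}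
  {q : E → ℝ} {q' : E → E → ℝ} {F : ι → ℝ → ℂ}

/-- Cauchy–Schwarz inequality for finite families of functions. -/
theorem sq_integral_sum_mul_le {f g : ι → ℝ → ℝ} {a t : ℝ} (hat : a ≤ t)
    (hff : IntervalIntegrable (fun s => ∑ j, f j s ^ 2) volume a t)
    (hfg : IntervalIntegrable (fun s => ∑ j, f j s * g j s) volume a t)
    (hgg : IntervalIntegrable (fun s => ∑ j, g j s ^ 2) volume a t) :
    (∫ s in a..t, ∑ j, f j s * g j s) ^ 2 ≤
      (∫ s in a..t, ∑ j, f j s ^ 2) * ∫ s in a..t, ∑ j, g j s ^ 2 := by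
  have h := discrim_le_zero (a := ∫ s in a..t, ∑ j, f j s ^ 2)
    (b := 2 * ∫ s in a..t, ∑ j, f j s * g j s) (c := ∫ s in a..t, ∑ j, g j s ^ 2) fun x => by
      have h1 : 0 ≤ ∫ s in a..t, ∑ j, (x * f j s + g j s) ^ 2 :=
        intervalIntegral.integral_nonneg hat fun s _ => Finset.sum_nonneg fun j _ => sq_nonneg _
      have e : ∀ s, ∑ j, (x * f j s + g j s) ^ 2 =
          (x * x) * (∑ j, f j s ^ 2) + (2 * x) * (∑ j, f j s * g j s) + ∑ j, g j s ^ 2 := fun s => by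
        rw [Finset.mul_sum, Finset.mul_sum, ← Finset.sum_add_distrib, ← Finset.sum_add_distrib]
        exact Finset.sum_congr rfl fun j _ => by ring
      simp only [e] at h1
      rw [intervalIntegral.integral_add ((hff.const_mul _).add (hfg.const_mul _)) hgg,
        intervalIntegral.integral_add (hff.const_mul _) (hfg.const_mul _),
        intervalIntegral.integral_const_mul, intervalIntegral.integral_const_mul] at h1
      linarith
  rw [discrim] at h
  linarith

theorem intervalIntegrable_of_memLp_two {f : ℝ → ℂ} (hf : MemLp f 2) (a t : ℝ) :
    IntervalIntegrable f volume a t := by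
  rw [intervalIntegrable_iff]
  have : IsFiniteMeasure (volume.restrict (uIoc a t)) := ⟨by simp [uIoc]⟩
  exact (hf.restrict _).integrable (by norm_num)

theorem intervalIntegrable_norm_sq {f : ℝ → ℂ} (hf : MemLp f 2) (a t : ℝ) :
    IntervalIntegrable (fun s => ‖f s‖ ^ 2) volume a t :=
  (hf.integrable_norm_pow (p := 2) two_ne_zero).intervalIntegrable

theorem intervalIntegrable_sum {G : Type*} [NormedAddCommGroup G] {f : ι → ℝ → G} {a t : ℝ}
    (h : ∀ j, IntervalIntegrable (f j) volume a t) :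
    IntervalIntegrable (fun s => ∑ j, f j s) volume a t := by
  have := IntervalIntegrable.sum Finset.univ (fun j _ => h j)
  convert! this using 1
  ext s; simp

omit [CompleteSpace E] in
theorem intervalIntegrable_input (hS : IsUnitaryGroup Γ S) (hF : ∀ j, MemLp (F j) 2) (a t : ℝ) :
    IntervalIntegrable (fun s => ∑ j, F j s • S (-s) (b j)) volume a t :=
  intervalIntegrable_sum fun j => (intervalIntegrable_of_memLp_two (hF j) a t).smul_continuousOn
    ((hS.continuous_apply (b j)).comp continuous_neg).continuousOn

/-- The duality estimate for the input map: the input integral, paired with `(1 - A) u`, is the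
time integral of the control against the observation of the orbit of `u`. -/
theorem IsMultiplier.norm_inner_input_sq_le (hq : IsMultiplier Γ b K q q')
    (hS : IsUnitaryGroup Γ S) (hF : ∀ j, MemLp (F j) 2) {a t T : ℝ} (ha : 0 ≤ a) (hat : a ≤ t)
    (htT : t ≤ T) {u u' : E} (hu : (u, u') ∈ Γ) :
    ‖⟪u - u', ∫ s in a..t, ∑ j, F j s • S (-s) (b j)⟫_ℂ‖ ^ 2 ≤
      (∫ s in a..t, ∑ j, ‖F j s‖ ^ 2) * (K * (2 + T) * ‖u‖ ^ 2) := by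
  have hT : 0 ≤ T := ha.trans (hat.trans htT)
  have hoc : ∀ j, Continuous fun s => ‖⟪b j, S s (u - u')⟫_ℂ‖ := fun j =>
    (continuous_const.inner (hS.continuous_apply (u - u'))).norm
  have hoo : Continuous fun s => ∑ j, ‖⟪b j, S s (u - u')⟫_ℂ‖ ^ 2 :=
    continuous_finsetSum _ fun j _ => (hoc j).pow 2
  have hFF : IntervalIntegrable (fun s => ∑ j, ‖F j s‖ ^ 2) volume a t :=
    intervalIntegrable_sum fun j => intervalIntegrable_norm_sq (hF j) a t
  have hFo : IntervalIntegrable (fun s => ∑ j, ‖F j s‖ * ‖⟪b j, S s (u - u')⟫_ℂ‖) volume a t :=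
    intervalIntegrable_sum fun j => (intervalIntegrable_of_memLp_two (hF j) a t).norm.mul_continuousOn
      (hoc j).continuousOn
  have h1 : ‖⟪u - u', ∫ s in a..t, ∑ j, F j s • S (-s) (b j)⟫_ℂ‖ ≤
      ∫ s in a..t, ∑ j, ‖F j s‖ * ‖⟪b j, S s (u - u')⟫_ℂ‖ := by
    have e := (innerSL ℂ (u - u')).intervalIntegral_comp_comm
      (intervalIntegrable_input (b := b) hS hF a t)
    simp only [innerSL_apply_apply] at e
    rw [← e]
    refine intervalIntegral.norm_integral_le_of_norm_le hat (Eventually.of_forall fun s _ => ?_) hFo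
    rw [inner_sum]
    refine (norm_sum_le _ _).trans (Finset.sum_le_sum fun j _ => ?_)
    rw [inner_smul_right, norm_mul, hS.inner_apply, neg_neg, norm_inner_symm]
  have h2 := sq_integral_sum_mul_le hat hFF hFo (hoo.intervalIntegrable a t)
  have h3 := hq.integral_observation_le hS hu hT
  have h4 : ∫ s in a..t, ∑ j, ‖⟪b j, S s (u - u')⟫_ℂ‖ ^ 2 ≤
      ∫ s in (0 : ℝ)..T, ∑ j, ‖⟪b j, S s (u - u')⟫_ℂ‖ ^ 2 :=
    intervalIntegral.integral_mono_interval ha hat htT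
      (Eventually.of_forall fun s => Finset.sum_nonneg fun j _ => sq_nonneg _)
      (hoo.intervalIntegrable 0 T)
  have h5 : 0 ≤ ∫ s in a..t, ∑ j, ‖F j s‖ ^ 2 :=
    intervalIntegral.integral_nonneg hat fun s _ => Finset.sum_nonneg fun j _ => sq_nonneg _
  calc _ ≤ _ := pow_le_pow_left₀ (norm_nonneg _) h1 2
    _ ≤ _ := h2
    _ ≤ _ := mul_le_mul_of_nonneg_left (h4.trans h3) h5

/-- By duality, the input integral over `[a, t]` lies in the range of `(1 + A)⁻¹`, that is, in `Dom A`. -/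
theorem IsMultiplier.exists_res_eq_input (hq : IsMultiplier Γ b K q q') (hK : 0 ≤ K)
    (hΓ : IsSkewAdjointGraph Γ) (hS : IsUnitaryGroup Γ S) (hF : ∀ j, MemLp (F j) 2)
    {a t T : ℝ} (ha : 0 ≤ a) (hat : a ≤ t) (htT : t ≤ T) :
    ∃ g, hΓ.res 1 one_ne_zero g = ∫ s in a..t, ∑ j, F j s • S (-s) (b j) ∧
      ‖g‖ ≤ √(K * (2 + T) * ∫ s in a..t, ∑ j, ‖F j s‖ ^ 2) := by
  refine hΓ.exists_res_eq (Real.sqrt_nonneg _) fun u u' hu => ?_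
  have h := hq.norm_inner_input_sq_le hS hF ha hat htT hu
  have hT : 0 ≤ T := ha.trans (hat.trans htT)
  have h5 : 0 ≤ ∫ s in a..t, ∑ j, ‖F j s‖ ^ 2 :=
    intervalIntegral.integral_nonneg hat fun s _ => Finset.sum_nonneg fun j _ => sq_nonneg _
  refine abs_le_of_sq_le_sq' ?_ (by positivity) |>.2
  rw [mul_pow, Real.sq_sqrt (by positivity)]
  linarith

/-- Admissibility: the input integral `∫₀ᵗ S(-s) B F(s) ds`, formed in the extrapolation space, is a
continuous function of `t` in `E`. -/
theorem IsMultiplier.exists_input (hq : IsMultiplier Γ b K q q') (hK : 0 ≤ K)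
    (hΓ : IsSkewAdjointGraph Γ) (hS : IsUnitaryGroup Γ S) (hF : ∀ j, MemLp (F j) 2)
    {T : ℝ} (hT : 0 ≤ T) :
    ∃ ψ : ℝ → E, ContinuousOn ψ (Icc 0 T) ∧ ψ 0 = 0 ∧
      (∀ t ∈ Icc 0 T, hΓ.res 1 one_ne_zero (ψ t) =
        ∫ s in (0 : ℝ)..t, ∑ j, F j s • S (-s) (b j)) ∧
      ‖ψ T‖ ≤ √(K * (2 + T) * ∫ s in (0 : ℝ)..T, ∑ j, ‖F j s‖ ^ 2) := by
  have hex : ∀ t, ∃ g, t ∈ Icc 0 T → hΓ.res 1 one_ne_zero g =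
      ∫ s in (0 : ℝ)..t, ∑ j, F j s • S (-s) (b j) := fun t => by
    by_cases ht : t ∈ Icc 0 T
    · obtain ⟨g, hg, -⟩ := hq.exists_res_eq_input hK hΓ hS hF le_rfl ht.1 ht.2
      exact ⟨g, fun _ => hg⟩
    · exact ⟨0, fun h => absurd h ht⟩
  choose ψ hψ using hex
  have hN : ∀ a t, IntervalIntegrable (fun s => ∑ j, ‖F j s‖ ^ 2) volume a t := fun a t =>
    intervalIntegrable_sum fun j => intervalIntegrable_norm_sq (hF j) a t
  have hinc : ∀ a ∈ Icc 0 T, ∀ t ∈ Icc 0 T, a ≤ t →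
      ‖ψ t - ψ a‖ ≤ √(K * (2 + T) * ∫ s in a..t, ∑ j, ‖F j s‖ ^ 2) := by
    intro a ha t ht hat
    obtain ⟨g, hg, hgn⟩ := hq.exists_res_eq_input hK hΓ hS hF ha.1 hat ht.2
    have e : ψ t - ψ a = g := by
      refine sub_eq_zero.mp (hΓ.res_injective one_ne_zero ?_)
      rw [map_sub, map_sub, hψ t ht, hψ a ha, hg, intervalIntegral.integral_interval_sub_left
        (intervalIntegrable_input hS hF _ _) (intervalIntegrable_input hS hF _ _), sub_self]
    rwa [e]
  have h0 : (0 : ℝ) ∈ Icc 0 T := ⟨le_rfl, hT⟩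
  have hψ0 : ψ 0 = 0 := hΓ.res_injective one_ne_zero (by rw [hψ 0 h0, intervalIntegral.integral_same])
  refine ⟨ψ, ?_, hψ0, hψ, ?_⟩
  · intro a ha
    have hNc : Continuous fun t => ∫ s in a..t, ∑ j, ‖F j s‖ ^ 2 :=
      intervalIntegral.continuous_primitive hN a
    have hlim : Tendsto (fun t => √(K * (2 + T) * |∫ s in a..t, ∑ j, ‖F j s‖ ^ 2|))
        (𝓝[Icc 0 T] a) (𝓝 0) := by
      have h1 : Continuous fun t => √(K * (2 + T) * |∫ s in a..t, ∑ j, ‖F j s‖ ^ 2|) := by fun_prop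
      have h2 := h1.tendsto a
      simp only [intervalIntegral.integral_same, abs_zero, mul_zero, Real.sqrt_zero] at h2
      exact h2.mono_left nhdsWithin_le_nhds
    rw [ContinuousWithinAt, tendsto_iff_norm_sub_tendsto_zero]
    refine squeeze_zero' (Eventually.of_forall fun _ => norm_nonneg _) ?_ hlim
    filter_upwards [self_mem_nhdsWithin] with t ht
    have h2T : 0 ≤ K * (2 + T) := by positivity
    rcases le_total a t with hat | hat
    · refine (hinc a ha t ht hat).trans (Real.sqrt_le_sqrt ?_)
      exact mul_le_mul_of_nonneg_left (le_abs_self _) h2T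
    · rw [norm_sub_rev]
      refine (hinc t ht a ha hat).trans (Real.sqrt_le_sqrt ?_)
      rw [intervalIntegral.integral_symm]
      exact mul_le_mul_of_nonneg_left (neg_le_abs _) h2T
  · have h := hinc 0 h0 T ⟨hT, le_rfl⟩ hT
    rwa [hψ0, sub_zero] at h

/-- Integration by parts in time of the input integral; `(1 + A)⁻¹` makes the orbits of the vectors
`b j` differentiable, with `1 - (1 + A)⁻¹ = A (1 + A)⁻¹`. -/
theorem res_apply_input (hΓ : IsSkewAdjointGraph Γ) (hS : IsUnitaryGroup Γ S)
    (hF : ∀ j, MemLp (F j) 2) {t : ℝ} (ht : 0 ≤ t) :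
    hΓ.res 1 one_ne_zero (∫ s in (0 : ℝ)..t, ∑ j, F j s • S (-s) (b j)) =
      S (-t) (hΓ.res 1 one_ne_zero (∑ j, (∫ s in (0 : ℝ)..t, F j s) • b j)) -
      ∫ s in (0 : ℝ)..t, S (-s) ((∑ j, (∫ r in (0 : ℝ)..s, F j r) • b j) -
        hΓ.res 1 one_ne_zero (∑ j, (∫ r in (0 : ℝ)..s, F j r) • b j)) := by
  set R := hΓ.res 1 one_ne_zero with hR
  have hFi := fun j => intervalIntegrable_of_memLp_two (hF j)
  have hv : ∀ j s, HasDerivAt (fun s => S (-s) (R (b j))) (S (-s) (b j - R (b j))) s := fun j s => by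
    have h1 := hΓ.res_mem one_ne_zero (b j)
    rw [Complex.ofReal_one, one_smul] at h1
    have h2 := (hS.hasDerivAt _ _ h1 (-s)).scomp s (hasDerivAt_neg s)
    simpa [Function.comp_def] using h2
  have hv' : ∀ j, Continuous fun s => S (-s) (b j - R (b j)) := fun j =>
    (hS.continuous_apply _).comp continuous_neg
  have hβ : ∀ j, Continuous fun s => ∫ r in (0 : ℝ)..s, F j r := fun j =>
    intervalIntegral.continuous_primitive (hFi j) 0
  rw [← R.intervalIntegral_comp_comm (intervalIntegrable_input hS hF 0 t)]
  simp only [map_sum, map_smul, ← Finset.sum_sub_distrib, ← smul_sub]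
  rw [intervalIntegral.integral_finsetSum, intervalIntegral.integral_finsetSum,
    ← Finset.sum_sub_distrib]
  · refine Finset.sum_congr rfl fun j _ => ?_
    have h := integral_smul_eq_sub ht (hFi j 0 t) (hv j) (hv' j)
    simp only [hR, ← hS.apply_res hΓ] at h ⊢
    exact h
  · exact fun j _ => ((hβ j).smul (hv' j)).intervalIntegrable 0 t
  · intro j _
    have : Continuous fun s => R (S (-s) (b j)) :=
      R.continuous.comp ((hS.continuous_apply _).comp continuous_neg)
    exact (hFi j 0 t).smul_continuousOn this.continuousOn

/-- Variation of constants: the hypothesis says that `d/ds S(s) ∫₀ˢ S(-r) v(r) dr` is `S(s) ψ(s)`; it is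
proved in the weak sense, by testing with `Dom A`. -/
theorem apply_integral_eq_integral (hΓ : IsSkewAdjointGraph Γ) (hS : IsUnitaryGroup Γ S)
    {v ψ : ℝ → E} (hv : Continuous v) {t : ℝ} (ht : 0 ≤ t) (hψ : ContinuousOn ψ (Icc 0 t))
    (hmem : ∀ s ∈ Icc 0 t, ((∫ r in (0 : ℝ)..s, S (-r) (v r)), S (-s) (v s) - ψ s) ∈ Γ) :
    S t (∫ s in (0 : ℝ)..t, S (-s) (v s)) = ∫ s in (0 : ℝ)..t, S s (ψ s) := by
  have hvc : Continuous fun s => S (-s) (v s) := by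
    rw [← continuousOn_univ]
    exact hS.continuous_comp continuous_neg.continuousOn hv.continuousOn
  have hp : ∀ s, HasDerivAt (fun s => ∫ r in (0 : ℝ)..s, S (-r) (v r)) (S (-s) (v s)) s :=
    fun s => (hvc.integral_hasStrictDerivAt 0 s).hasDerivAt
  have hpsi : ContinuousOn (fun s => S s (ψ s)) (uIcc 0 t) := by
    rw [uIcc_of_le ht]; exact hS.continuous_comp continuousOn_id hψ
  refine hΓ.dense_domain.eq_of_inner_right (𝕜 := ℂ) ?_
  rintro u ⟨u', hu⟩
  have hd : ∀ s ∈ uIcc 0 t, HasDerivAt (fun s => ⟪u, S s (∫ r in (0 : ℝ)..s, S (-r) (v r))⟫_ℂ)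
      ⟪u, S s (ψ s)⟫_ℂ s := by
    intro s hs
    rw [uIcc_of_le ht] at hs
    have h1 : HasDerivAt (fun s => S (-s) u) (S (-s) u') s := by
      have h2 := (hS.hasDerivAt _ _ hu (-s)).scomp s (hasDerivAt_neg s)
      simpa [Function.comp_def] using h2
    have h2 := h1.inner ℂ (hp s)
    simp only [hS.inner_apply]
    convert! h2 using 1
    have h3 := hΓ.skew _ (hS.apply_mem (-s) _ _ hu) _ (hmem s hs)
    simp only [inner_sub_right] at h3
    linear_combination -h3
  have h := intervalIntegral.integral_eq_sub_of_hasDerivAt hd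
    (continuousOn_const.inner hpsi).intervalIntegrable
  rw [intervalIntegral.integral_same, map_zero, inner_zero_right, sub_zero] at h
  rw [← h]
  exact (innerSL ℂ u).intervalIntegral_comp_comm hpsi.intervalIntegrable

/-- Existence for the equation `φ' + A φ = B F`, integrated in time, where `(1 + A)⁻¹ B` is given by
the vectors `b j`. -/
theorem IsMultiplier.exists_solution (hq : IsMultiplier Γ b K q q') (hK : 0 ≤ K)
    (hΓ : IsSkewAdjointGraph Γ) (hS : IsUnitaryGroup Γ S) (hF : ∀ j, MemLp (F j) 2)
    {T : ℝ} (hT : 0 ≤ T) (φ₀ : E) :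
    ∃ φ : ℝ → E, ContinuousOn φ (Icc 0 T) ∧ φ 0 = φ₀ ∧
      (∀ t ∈ Icc 0 T, ((∫ s in (0 : ℝ)..t, φ s) - ∑ j, (∫ s in (0 : ℝ)..t, F j s) • b j,
        φ₀ - φ t + ∑ j, (∫ s in (0 : ℝ)..t, F j s) • b j) ∈ Γ) ∧
      ‖φ T‖ ≤ ‖φ₀‖ + √(K * (2 + T) * ∫ s in (0 : ℝ)..T, ∑ j, ‖F j s‖ ^ 2) := by
  obtain ⟨ψ, hψc, hψ0, hψ, hψT⟩ := hq.exists_input hK hΓ hS hF hT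
  set R := hΓ.res 1 one_ne_zero with hR
  let G : ℝ → E := fun t => ∑ j, (∫ s in (0 : ℝ)..t, F j s) • b j
  have hGc : Continuous G := continuous_finsetSum _ fun j _ =>
    (intervalIntegral.continuous_primitive (intervalIntegrable_of_memLp_two (hF j)) 0).smul
      continuous_const
  have hΦ : ContinuousOn (fun t => S t (ψ t)) (Icc 0 T) := hS.continuous_comp continuousOn_id hψc
  have hΦ₀ : Continuous fun t => S t φ₀ := hS.continuous_apply φ₀
  have hSR := fun t x => hS.apply_res hΓ t one_ne_zero x
  have hmem : ∀ x, (R x, x - R x) ∈ Γ := fun x => by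
    simpa using hΓ.res_mem one_ne_zero x
  have hpull : ∀ t ∈ Icc 0 T, ∀ {f : ℝ → E}, ContinuousOn f (Icc 0 T) →
      ∫ s in (0 : ℝ)..t, (f s - R (f s)) =
        (∫ s in (0 : ℝ)..t, f s) - R (∫ s in (0 : ℝ)..t, f s) := by
    intro t ht f hf
    have hf' : ContinuousOn f (uIcc 0 t) := by
      rw [uIcc_of_le ht.1]; exact hf.mono (Icc_subset_Icc le_rfl ht.2)
    have hRf : ContinuousOn (fun s => R (f s)) (uIcc 0 t) := R.continuous.comp_continuousOn hf'
    rw [intervalIntegral.integral_sub hf'.intervalIntegrable hRf.intervalIntegrable,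
      R.intervalIntegral_comp_comm hf'.intervalIntegrable]
  -- the orbit of the input integral
  have hcontrol : ∀ t ∈ Icc 0 T, G t - S t (R (ψ t)) =
      (∫ s in (0 : ℝ)..t, S s (ψ s)) - R (∫ s in (0 : ℝ)..t, S s (ψ s)) := by
    intro t ht
    have h1 : ∀ s ∈ Icc 0 T, ∫ r in (0 : ℝ)..s, S (-r) (G r - R (G r)) =
        R (S (-s) (G s) - R (ψ s)) := fun s hs => by
      have h := res_apply_input (b := b) hΓ hS hF hs.1
      rw [map_sub, ← hSR, hψ s hs, h, sub_sub_cancel]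
    have h2 : Continuous fun s => G s - R (G s) := hGc.sub (R.continuous.comp hGc)
    have hRψ : ContinuousOn (fun s => R (ψ s) - R (R (ψ s))) (Icc 0 T) := by fun_prop
    have h3 := apply_integral_eq_integral hΓ hS h2 ht.1
      (hRψ.mono (Icc_subset_Icc le_rfl ht.2)) fun s hs => by
        have hs' : s ∈ Icc 0 T := ⟨hs.1, hs.2.trans ht.2⟩
        rw [h1 s hs']
        convert hmem (S (-s) (G s) - R (ψ s)) using 2
        simp only [map_sub, hR, hSR]
        abel
    rw [h1 t ht, hSR, map_sub, hS.apply_neg_apply] at h3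
    refine sub_eq_zero.mp (hΓ.res_injective one_ne_zero ?_)
    rw [map_sub, ← hR, h3, sub_eq_zero, ← hpull t ht hΦ,
      ← R.intervalIntegral_comp_comm]
    · refine intervalIntegral.integral_congr fun s _ => ?_
      simp only [map_sub, hR, hSR]
    · have : ContinuousOn (fun s => S s (ψ s) - R (S s (ψ s))) (uIcc 0 t) := by
        rw [uIcc_of_le ht.1]
        exact (hΦ.sub (R.continuous.comp_continuousOn hΦ)).mono (Icc_subset_Icc le_rfl ht.2)
      exact this.intervalIntegrable
  -- the orbit of the initial state
  have hfree : ∀ t ∈ Icc 0 T, R φ₀ - R (S t φ₀) =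
      (∫ s in (0 : ℝ)..t, S s φ₀) - R (∫ s in (0 : ℝ)..t, S s φ₀) := by
    intro t ht
    rw [← hpull t ht hΦ₀.continuousOn]
    have h1 := intervalIntegral.integral_eq_sub_of_hasDerivAt
      (fun s _ => hS.hasDerivAt _ _ (hmem φ₀) s)
      ((hS.continuous_apply (φ₀ - R φ₀)).neg.intervalIntegrable 0 t)
    rw [intervalIntegral.integral_neg, hS.zero_apply, neg_eq_iff_eq_neg, neg_sub, hSR] at h1
    rw [← h1]
    refine intervalIntegral.integral_congr fun s _ => ?_
    simp only [map_sub, hR, hSR]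
  refine ⟨fun t => S t φ₀ + S t (ψ t), hΦ₀.continuousOn.add hΦ, ?_, fun t ht => ?_, ?_⟩
  · simp only [hS.zero_apply, hψ0, add_zero]
  · have hsub : uIcc 0 t ⊆ Icc 0 T := by
      rw [uIcc_of_le ht.1]; exact Icc_subset_Icc le_rfl ht.2
    rw [intervalIntegral.integral_add (hΦ₀.intervalIntegrable 0 t)
      (hΦ.mono hsub).intervalIntegrable]
    have h1 := hcontrol t ht
    have h2 := hfree t ht
    rw [hSR, ← hR] at h1
    set Y₁ := ∫ s in (0 : ℝ)..t, S s φ₀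
    set Y₂ := ∫ s in (0 : ℝ)..t, S s (ψ s)
    change (Y₁ + Y₂ - G t, φ₀ - (S t φ₀ + S t (ψ t)) + G t) ∈ Γ
    have e : R (Y₁ + Y₂ + φ₀ - (S t φ₀ + S t (ψ t))) = Y₁ + Y₂ - G t := by
      rw [map_sub, map_add, map_add, map_add]
      linear_combination (norm := module) (1 : ℂ) • h1 + (1 : ℂ) • h2
    have h3 := hmem (Y₁ + Y₂ + φ₀ - (S t φ₀ + S t (ψ t)))
    rw [e] at h3
    convert h3 using 2
    abel
  · refine (norm_add_le _ _).trans ?_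
    rw [hS.norm_apply, hS.norm_apply]
    gcongr

/-- Uniqueness: an integrated orbit `Y` with `A Y = -Y'` and `Y(0) = 0` has constant norm. -/
theorem IsSkewAdjointGraph.eq_zero_of_integral_mem (hΓ : IsSkewAdjointGraph Γ) {T : ℝ} (hT : 0 ≤ T)
    {φ : ℝ → E} (hφ : ContinuousOn φ (Icc 0 T))
    (h : ∀ t ∈ Icc 0 T, ((∫ s in (0 : ℝ)..t, φ s), -φ t) ∈ Γ) : ∀ t ∈ Icc 0 T, φ t = 0 := by
  let φ' : ℝ → E := IccExtend hT ((Icc 0 T).domRestrict φ)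
  have hφ' : Continuous φ' := hφ.domRestrict.Icc_extend'
  have he : ∀ t ∈ Icc 0 T, φ' t = φ t := fun t ht => IccExtend_of_mem _ _ ht
  let Y : ℝ → E := fun t => ∫ s in (0 : ℝ)..t, φ' s
  have hY : ∀ t, HasDerivAt Y (φ' t) t := fun t => (hφ'.integral_hasStrictDerivAt 0 t).hasDerivAt
  have hYe : ∀ t ∈ Icc 0 T, Y t = ∫ s in (0 : ℝ)..t, φ s := fun t ht =>
    intervalIntegral.integral_congr fun s hs => by
      rw [uIcc_of_le ht.1] at hs
      exact he s ⟨hs.1, hs.2.trans ht.2⟩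
  have hd : ∀ t, HasDerivAt (fun t => (⟪Y t, Y t⟫_ℂ)) (⟪Y t, φ' t⟫_ℂ + ⟪φ' t, Y t⟫_ℂ) t :=
    fun t => (hY t).inner ℂ (hY t)
  have hYz : ∀ t ∈ Icc 0 T, Y t = 0 := by
    intro t ht
    have h1 := constant_of_has_deriv_right_zero (f := fun t => ⟪Y t, Y t⟫_ℂ) (a := 0) (b := T)
      (fun t _ => (hd t).continuousAt.continuousWithinAt) (fun t ht' => by
        have h2 := h t (Ico_subset_Icc_self ht')
        have h3 := hΓ.skew _ h2 _ h2
        rw [← hYe t (Ico_subset_Icc_self ht'), ← he t (Ico_subset_Icc_self ht')] at h3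
        simp only [inner_neg_right, inner_neg_left, neg_neg] at h3
        have h4 := hd t
        rw [← h3, add_neg_cancel] at h4
        exact h4.hasDerivWithinAt) t ht
    simp only [Y, intervalIntegral.integral_same, inner_zero_right] at h1
    exact inner_self_eq_zero.mp h1
  intro t ht
  have h1 := h t ht
  rw [← hYe t ht, hYz t ht] at h1
  exact neg_eq_zero.mp (hΓ.single _ h1)

end Control

end RaoNakra

/-! ### Calculus on the interval -/

namespace RaoNakra

section Interval

variable {p : BeamParams}

theorem memLp_ofReal_mul (f : X p) :
    MemLp (fun x : ℝ => (x : ℂ) * f x) 2 (volume.restrict (Ioc 0 p.L)) := by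
  refine (Lp.memLp f).of_le_mul (c := p.L)
    (Complex.continuous_ofReal.aestronglyMeasurable.mul (Lp.aestronglyMeasurable f)) ?_
  filter_upwards [ae_restrict_mem measurableSet_Ioc] with x hx
  rw [norm_mul, Complex.norm_real, Real.norm_of_nonneg hx.1.le]
  gcongr
  exact hx.2

/-- Multiplication by the coordinate `x` on `L²(0,L)`. -/
noncomputable def mulX : X p →L[ℂ] X p :=
  LinearMap.mkContinuous
    { toFun := fun f => (memLp_ofReal_mul f).toLp
      map_add' := fun f g => by
        rw [← MemLp.toLp_add]
        refine MemLp.toLp_congr _ _ ?_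
        filter_upwards [Lp.coeFn_add f g] with x h
        rw [h, Pi.add_apply, Pi.add_apply, mul_add]
      map_smul' := fun c f => by
        rw [RingHom.id_apply, ← MemLp.toLp_const_smul]
        refine MemLp.toLp_congr _ _ ?_
        filter_upwards [Lp.coeFn_smul c f] with x h
        rw [h, Pi.smul_apply, Pi.smul_apply, smul_eq_mul, smul_eq_mul, mul_left_comm] }
    p.L (fun f => by
      refine Lp.norm_le_mul_norm_of_ae_le_mul ?_
      filter_upwards [(memLp_ofReal_mul f).coeFn_toLp, ae_restrict_mem measurableSet_Ioc]
        with x h hx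
      change ‖(memLp_ofReal_mul f).toLp _ x‖ ≤ _
      rw [h, norm_mul, Complex.norm_real, Real.norm_of_nonneg hx.1.le]
      gcongr
      exact hx.2)

theorem coeFn_mulX (f : X p) :
    mulX f =ᵐ[volume.restrict (Ioc 0 p.L)] fun x : ℝ => (x : ℂ) * f x :=
  (memLp_ofReal_mul f).coeFn_toLp

theorem norm_mulX_le (f : X p) : ‖mulX f‖ ≤ p.L * ‖f‖ :=
  (mulX.le_opNorm f).trans (mul_le_mul_of_nonneg_right
    (LinearMap.mkContinuous_norm_le _ p.L_pos.le _) (norm_nonneg _))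

theorem inner_mulX_left (f g : X p) : ⟪mulX f, g⟫_ℂ = ⟪f, mulX g⟫_ℂ := by
  rw [L2.inner_def, L2.inner_def]
  refine integral_congr_ae ?_
  filter_upwards [coeFn_mulX f, coeFn_mulX g] with x h1 h2
  rw [h1, h2]
  simp only [RCLike.inner_apply, map_mul, Complex.conj_ofReal]
  ring

theorem norm_inner_mulX_le (f g : X p) : ‖⟪f, mulX g⟫_ℂ‖ ≤ p.L * (‖f‖ * ‖g‖) := by
  refine (norm_inner_le_norm _ _).trans ?_
  have := norm_mulX_le g
  nlinarith [norm_nonneg f]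

namespace H1

/-- The product `x u` for `u ∈ H¹(0,L)`. -/
noncomputable def xmul (u : H1 p) : H1 p := mk 0 (toX u + mulX (deriv u))

theorem fn_xmul (u : H1 p) {x : ℝ} (hx : x ∈ Icc 0 p.L) : fn (xmul u) x = x * fn u x := by
  have h1 : IntervalIntegrable (fun _ : ℝ => (1 : ℂ)) volume 0 p.L := intervalIntegrable_const
  have key := primitive_mul p.L_pos.le 0 (eval p.left u) h1 (X.intervalIntegrable (deriv u)) hx
  rw [← fn_eq u hx] at key
  simp only [intervalIntegral.integral_const, sub_zero, zero_add, one_mul, zero_mul,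
    Complex.real_smul, mul_one] at key
  rw [key, fn_eq _ hx, xmul, eval_left_mk, deriv_mk, zero_add]
  have e : ⇑(toX u + mulX (deriv u)) =ᵐ[volume.restrict (Ioc 0 p.L)] fun t : ℝ =>
      eval p.left u + (∫ s in (0 : ℝ)..t, deriv u s) + (t : ℂ) * deriv u t := by
    filter_upwards [Lp.coeFn_add (toX u) (mulX (deriv u)), coeFn_toX u, coeFn_mulX (deriv u),
      ae_restrict_mem measurableSet_Ioc] with t h1 h2 h3 ht
    rw [h1, Pi.add_apply, h2, h3, fn_eq u (Ioc_subset_Icc_self ht)]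
  exact X.integral_congr e hx

theorem toX_xmul (u : H1 p) : toX (xmul u) = mulX (toX u) := by
  refine Lp.ext ?_
  filter_upwards [coeFn_toX (xmul u), coeFn_mulX (toX u), coeFn_toX u,
    ae_restrict_mem measurableSet_Ioc] with x h1 h2 h3 hx
  rw [h1, h2, h3, fn_xmul u (Ioc_subset_Icc_self hx)]

/-- Integration by parts with the weight `x`. -/
theorem integration_by_parts_mulX (u v : H1 p) :
    ⟪deriv u, mulX (toX v)⟫_ℂ + ⟪toX u, mulX (deriv v)⟫_ℂ + ⟪toX u, toX v⟫_ℂ =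
      p.L * (conj (eval p.right u) * eval p.right v) := by
  have h := integration_by_parts (xmul u) v
  have h1 : eval p.right (xmul u) = p.L * eval p.right u := by
    rw [eval_eq_fn, eval_eq_fn]
    exact fn_xmul u p.right.2
  rw [h1, toX_xmul, xmul, eval_left_mk, deriv_mk, inner_add_left, inner_mulX_left,
    inner_mulX_left, map_zero, zero_mul, sub_zero, map_mul, Complex.conj_ofReal] at h
  linear_combination h

/-- The Pohozaev-type identity `2 Re ∫ x ū u_x = L |u(L)|² - ‖u‖²`. -/
theorem two_re_inner_mulX_deriv (u : H1 p) :
    2 * (⟪toX u, mulX (deriv u)⟫_ℂ).re = p.L * ‖eval p.right u‖ ^ 2 - ‖toX u‖ ^ 2 := by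
  have h := congrArg Complex.re (integration_by_parts_mulX u u)
  rw [← inner_mulX_left (deriv u), ← inner_conj_symm (mulX (deriv u)),
    inner_self_eq_norm_sq_to_K, mul_comm (conj _), Complex.mul_conj] at h
  simp only [Complex.add_re, Complex.conj_re, Complex.re_ofReal_mul, Complex.ofReal_re,
    Complex.normSq_eq_norm_sq, Complex.coe_algebraMap, ← Complex.ofReal_pow] at h
  linarith

theorem two_re_inner_deriv (u : H1 p) :
    2 * (⟪toX u, deriv u⟫_ℂ).re = ‖eval p.right u‖ ^ 2 - ‖eval p.left u‖ ^ 2 := by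
  have h := congrArg Complex.re (integration_by_parts u u)
  rw [← inner_conj_symm (deriv u), mul_comm (conj _), Complex.mul_conj, mul_comm (conj _),
    Complex.mul_conj] at h
  simp only [Complex.add_re, Complex.sub_re, Complex.conj_re, Complex.ofReal_re,
    Complex.normSq_eq_norm_sq] at h
  linarith

theorem norm_toX_le_of_right {u : H1 p} (h : eval p.right u = 0) :
    ‖toX u‖ ≤ 2 * p.L * ‖deriv u‖ := by
  have h1 := two_re_inner_mulX_deriv u
  have h2 := (Complex.abs_re_le_norm _).trans (norm_inner_mulX_le (toX u) (deriv u))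
  rw [h, norm_zero] at h1
  have h3 := (abs_le.mp h2).1
  have h4 := p.L_pos
  by_contra hc
  push Not at hc
  have h5 : 0 < ‖toX u‖ := lt_of_le_of_lt (by positivity) hc
  nlinarith

/-- Poincaré inequality. -/
theorem norm_toX_le_of_left {u : H1 p} (h : eval p.left u = 0) :
    ‖toX u‖ ≤ 4 * p.L * ‖deriv u‖ := by
  have h1 := two_re_inner_mulX_deriv u
  have h2 := (Complex.abs_re_le_norm _).trans (norm_inner_mulX_le (toX u) (deriv u))
  have h1' := two_re_inner_deriv u
  have h2' := (Complex.abs_re_le_norm _).trans (norm_inner_le_norm (𝕜 := ℂ) (toX u) (deriv u))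
  rw [h, norm_zero] at h1'
  have h3 := (abs_le.mp h2).1
  have h3' := (abs_le.mp h2').2
  have h4 := p.L_pos
  by_contra hc
  push Not at hc
  have h5 : 0 < ‖toX u‖ := lt_of_le_of_lt (by positivity) hc
  have h6 : p.L * ‖eval p.right u‖ ^ 2 ≤ p.L * (2 * (‖toX u‖ * ‖deriv u‖)) :=
    mul_le_mul_of_nonneg_left (by linarith) h4.le
  nlinarith

/-- Trace inequality at `x = L`. -/
theorem norm_eval_right_sq_le (u : H1 p) :
    p.L * ‖eval p.right u‖ ^ 2 ≤ 2 * p.L * (‖toX u‖ * ‖deriv u‖) + ‖toX u‖ ^ 2 := by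
  have h1 := two_re_inner_mulX_deriv u
  have h2 := (Complex.abs_re_le_norm _).trans (norm_inner_mulX_le (toX u) (deriv u))
  have h3 := (abs_le.mp h2).2
  linarith

theorem norm_eval_right_le_of_left {u : H1 p} (h : eval p.left u = 0) :
    ‖eval p.right u‖ ^ 2 ≤ 8 * p.L * ‖deriv u‖ ^ 2 := by
  have h1' := two_re_inner_deriv u
  have h2' := (Complex.abs_re_le_norm _).trans (norm_inner_le_norm (𝕜 := ℂ) (toX u) (deriv u))
  have h3' := (abs_le.mp h2').2
  have h4 := norm_toX_le_of_left h
  rw [h, norm_zero] at h1'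
  nlinarith [norm_nonneg (deriv u)]

/-- The function `x ↦ ∫ₓᴸ g`. -/
noncomputable def tail (g : X p) : H1 p := mk (∫ s in (0 : ℝ)..p.L, g s) (-g)

@[simp] theorem deriv_tail (g : X p) : deriv (tail g) = -g := rfl

theorem eval_right_tail (g : X p) : eval p.right (tail g) = 0 := by
  have hL : p.L ∈ Icc 0 p.L := ⟨p.L_pos.le, le_rfl⟩
  have h := X.primitive_smul (-1) g hL
  rw [eval_eq_fn]
  change fn (tail g) p.L = 0
  rw [fn_eq _ hL, tail, eval_left_mk, deriv_mk, ← neg_one_smul ℂ g, h]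
  ring

theorem eq_of_right {u v : H1 p} (h0 : eval p.right u = eval p.right v)
    (h1 : deriv u = deriv v) : u = v := by
  have h2 : deriv (u - v) = 0 := by rw [map_sub, h1, sub_self]
  have h3 := norm_toX_le_of_right (u := u - v) (by rw [map_sub, h0, sub_self])
  rw [h2, norm_zero, mul_zero] at h3
  have h4 : toX (u - v) = 0 := norm_eq_zero.mp (le_antisymm h3 (norm_nonneg _))
  exact sub_eq_zero.mp (toX_injective (by rw [h4, map_zero]))

theorem tail_add (f g : X p) : tail (f + g) = tail f + tail g :=
  eq_of_right (by simp only [map_add, eval_right_tail, add_zero])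
    (by simp only [map_add, deriv_tail, neg_add])

theorem tail_smul (c : ℂ) (f : X p) : tail (c • f) = c • tail f :=
  eq_of_right (by simp only [map_smul, eval_right_tail, smul_zero])
    (by simp only [map_smul, deriv_tail, smul_neg])

/-- The operator `g ↦ ∫ₓᴸ g` on `L²(0,L)`. -/
noncomputable def tailX : X p →L[ℂ] X p :=
  LinearMap.mkContinuous
    { toFun := fun g => toX (tail g)
      map_add' := fun f g => by rw [tail_add, map_add]
      map_smul' := fun c f => by rw [tail_smul, map_smul, RingHom.id_apply] }
    (2 * p.L) (fun g => by
      have := norm_toX_le_of_right (eval_right_tail g)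
      rwa [deriv_tail, norm_neg] at this)

theorem tailX_apply (g : X p) : tailX g = toX (tail g) := rfl

/-- `tailX` is the adjoint of integration from `0`. -/
theorem inner_deriv_tailX {u : H1 p} (h : eval p.left u = 0) (g : X p) :
    ⟪deriv u, tailX g⟫_ℂ = ⟪toX u, g⟫_ℂ := by
  have h1 := integration_by_parts u (tail g)
  rw [eval_right_tail, h, deriv_tail, inner_neg_right, map_zero, zero_mul, mul_zero] at h1
  rw [tailX_apply]
  linear_combination h1

/-- A weak derivative is a derivative: the fundamental lemma of the calculus of variations on
`{u ∈ H¹ : u(0) = 0}`, with the natural boundary condition at `L`. -/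
theorem eq_tailX_of_weak {f g : X p}
    (h : ∀ u : H1 p, eval p.left u = 0 → ⟪deriv u, f⟫_ℂ = ⟪toX u, g⟫_ℂ) : f = tailX g := by
  refine ext_inner_left ℂ fun v => ?_
  have h1 := h (mk 0 v) (eval_left_mk 0 v)
  rw [← inner_deriv_tailX (eval_left_mk 0 v) g] at h1
  exact h1

theorem eq_zero_of_inner_toX {g : X p} (h : ∀ u : H1 p, eval p.left u = 0 → ⟪toX u, g⟫_ℂ = 0) :
    g = 0 := by
  have h1 : tailX g = 0 := (eq_tailX_of_weak (f := 0) (g := g) fun u hu => by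
    rw [h u hu, inner_zero_right]).symm
  have h2 : tail g = 0 := toX_injective (by rw [map_zero]; exact h1)
  have h3 := deriv_tail g
  rw [h2, map_zero] at h3
  exact neg_eq_zero.mp h3.symm

theorem integral_fn_eq_inner (u : H1 p) : ∫ x in (0 : ℝ)..p.L, fn u x = ⟪toX (mk 1 0), toX u⟫_ℂ := by
  rw [inner_X, intervalIntegral.integral_of_le p.L_pos.le,
    intervalIntegral.integral_of_le p.L_pos.le]
  refine integral_congr_ae ?_
  filter_upwards [coeFn_toX u, coeFn_toX (mk (p := p) 1 0), ae_restrict_mem measurableSet_Ioc]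
    with x h1 h2 hx
  have h3 := X.primitive_smul (p := p) 0 0 (Ioc_subset_Icc_self hx)
  rw [zero_smul, zero_mul] at h3
  rw [h1, h2, fn_eq (mk 1 0) (Ioc_subset_Icc_self hx), eval_left_mk, deriv_mk, h3]
  simp

end H1

end Interval

end RaoNakra

/-! ### Completeness of the energy space -/

namespace RaoNakra

section Hilbert

variable {E G : Type*} [NormedAddCommGroup E] [NormedSpace ℂ E] [NormedAddCommGroup G]
  [NormedSpace ℂ G]

theorem norm_le_inv_sqrt_mul {c a b : ℝ} (hc : 0 < c) (hb : 0 ≤ b)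
    (h : c * a ^ 2 ≤ b ^ 2) : a ≤ (√c)⁻¹ * b := by
  have hs := Real.sqrt_pos.mpr hc
  rw [inv_mul_eq_div, le_div_iff₀ hs]
  refine abs_le_of_sq_le_sq' ?_ hb |>.2
  rw [mul_pow, Real.sq_sqrt hc.le]
  linarith

/-- A linear map whose square is controlled by the squared norm, as a continuous linear map. -/
noncomputable def clmOfSq (f : E →ₗ[ℂ] G) {c : ℝ} (hc : 0 < c)
    (h : ∀ y, c * ‖f y‖ ^ 2 ≤ ‖y‖ ^ 2) : E →L[ℂ] G :=
  f.mkContinuous (√c)⁻¹ fun y => norm_le_inv_sqrt_mul hc (norm_nonneg _) (h y)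

theorem completeSpace_of_isClosed_range [CompleteSpace G] (T : E →L[ℂ] G) {C : ℝ}
    (hC : ∀ y, ‖y‖ ≤ C * ‖T y‖) (hr : IsClosed (range T)) : CompleteSpace E := by
  have h : AntilipschitzWith C.toNNReal T := AddMonoidHomClass.antilipschitz_of_bound T fun y =>
    (hC y).trans (mul_le_mul_of_nonneg_right (Real.le_coe_toNNReal C) (norm_nonneg _))
  exact (completeSpace_iff_isComplete_range (h.isUniformInducing T.uniformContinuous)).mpr
    hr.isComplete

/-- Lax–Milgram theorem for a bounded operator on a complex Hilbert space. -/
theorem surjective_of_coercive {E : Type*} [NormedAddCommGroup E] [InnerProductSpace ℂ E]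
    [CompleteSpace E] (T : E →L[ℂ] E) (h : ∀ x, ‖x‖ ^ 2 ≤ (⟪x, T x⟫_ℂ).re) :
    Function.Surjective T := by
  have hb : ∀ x, ‖x‖ ≤ 1 * ‖T x‖ := fun x => by
    have h1 := (h x).trans ((Complex.re_le_norm _).trans (norm_inner_le_norm (𝕜 := ℂ) x (T x)))
    rw [one_mul]
    by_contra hc
    push Not at hc
    have h2 := (norm_nonneg _).trans_lt hc
    nlinarith
  have ha : AntilipschitzWith 1 T := AddMonoidHomClass.antilipschitz_of_bound T fun y => by
    simpa using hb y
  have hc : IsClosed (range T) := ha.isClosed_range T.uniformContinuous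
  have hcs : CompleteSpace (LinearMap.range (T : E →ₗ[ℂ] E)) := hc.completeSpace_coe
  have h0 : (LinearMap.range (T : E →ₗ[ℂ] E))ᗮ = ⊥ := by
    rw [eq_bot_iff]
    intro x hx
    have h1 := (Submodule.mem_orthogonal' _ _).mp hx (T x) ⟨x, rfl⟩
    have h2 := h x
    rw [h1, Complex.zero_re] at h2
    have h3 : ‖x‖ ^ 2 = 0 := le_antisymm h2 (sq_nonneg _)
    simpa using h3
  have h1 := (Submodule.orthogonal_eq_bot_iff (K := LinearMap.range (T : E →ₗ[ℂ] E))).mp h0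
  exact LinearMap.range_eq_top.mp h1

end Hilbert

variable {p : BeamParams}

theorem norm_Pξ_sq_add_le (f : X p) :
    ‖Pξ f‖ ^ 2 + p.ξ * ‖H1.toX (H2.dx (neumannSol f))‖ ^ 2 ≤ ‖f‖ ^ 2 := by
  have h := congrArg Complex.re (inner_Pξ f f)
  rw [inner_self_eq_norm_sq_to_K, inner_self_eq_norm_sq_to_K] at h
  simp only [Complex.coe_algebraMap, ← Complex.ofReal_pow, ← Complex.ofReal_mul,
    ← Complex.ofReal_add, Complex.ofReal_re] at h
  have h1 := (Complex.re_le_norm _).trans (norm_inner_le_norm (𝕜 := ℂ) f (Pξ f))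
  have h2 := mul_nonneg p.ξ_pos.le (sq_nonneg ‖H1.toX (H2.dx (neumannSol f))‖)
  have h3 : ‖Pξ f‖ ≤ ‖f‖ := by
    by_contra hc
    push Not at hc
    have := (norm_nonneg _).trans_lt hc
    nlinarith
  nlinarith [norm_nonneg f]

namespace V

theorem inner_def (x y : V p) : ⟪x, y⟫_ℂ = innerV x y := rfl

theorem norm_sq (x : V p) : ‖x‖ ^ 2 =
    (p.α₁ * p.h₁) * ‖H1.deriv (y₁ x)‖ ^ 2 + (p.α₃ * p.h₃) * ‖H1.deriv (y₂ x)‖ ^ 2 +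
      (p.γ ^ 2 * p.h₃ / p.ε₃) * (‖Pξ (H1.deriv (y₂ x))‖ ^ 2 +
        p.ξ * ‖H1.toX (H2.dx (neumannSol (H1.deriv (y₂ x))))‖ ^ 2) +
      p.K₂ * ‖H2.dxx (y₃ x)‖ ^ 2 + (p.G₂ / p.h₂) * ‖shear x‖ ^ 2 +
      (p.μ * p.h₃) * ‖curl x‖ ^ 2 := by
  rw [norm_sq_eq_re_inner (𝕜 := ℂ) x, inner_def, innerV_self]
  exact Complex.ofReal_re _

theorem norm_sq_bounds (x : V p) :
    (p.α₁ * p.h₁) * ‖H1.deriv (y₁ x)‖ ^ 2 ≤ ‖x‖ ^ 2 ∧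
    (p.α₃ * p.h₃) * ‖H1.deriv (y₂ x)‖ ^ 2 ≤ ‖x‖ ^ 2 ∧
    p.K₂ * ‖H2.dxx (y₃ x)‖ ^ 2 ≤ ‖x‖ ^ 2 ∧ (p.G₂ / p.h₂) * ‖shear x‖ ^ 2 ≤ ‖x‖ ^ 2 ∧
    (p.μ * p.h₃) * ‖curl x‖ ^ 2 ≤ ‖x‖ ^ 2 := by
  have c1 := p.α₁_pos; have c2 := p.α₃_pos; have c3 := p.h₁_pos; have c4 := p.h₂_pos
  have c5 := p.h₃_pos; have c6 := p.ε₃_pos; have c7 := p.G₂_pos; have c8 := p.μ_pos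
  have c9 := p.K₂_pos; have c10 := p.ξ_pos
  have n1 : 0 ≤ (p.α₁ * p.h₁) * ‖H1.deriv (y₁ x)‖ ^ 2 := by positivity
  have n2 : 0 ≤ (p.α₃ * p.h₃) * ‖H1.deriv (y₂ x)‖ ^ 2 := by positivity
  have n3 : 0 ≤ (p.γ ^ 2 * p.h₃ / p.ε₃) * (‖Pξ (H1.deriv (y₂ x))‖ ^ 2 +
      p.ξ * ‖H1.toX (H2.dx (neumannSol (H1.deriv (y₂ x))))‖ ^ 2) := by positivity
  have n4 : 0 ≤ p.K₂ * ‖H2.dxx (y₃ x)‖ ^ 2 := by positivity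
  have n5 : 0 ≤ (p.G₂ / p.h₂) * ‖shear x‖ ^ 2 := by positivity
  have n6 : 0 ≤ (p.μ * p.h₃) * ‖curl x‖ ^ 2 := by positivity
  rw [norm_sq x]
  refine ⟨?_, ?_, ?_, ?_, ?_⟩ <;> linarith

/-- `y ↦ (y₁)_x` as a bounded operator. -/
noncomputable def Dy₁ : V p →L[ℂ] X p := clmOfSq (H1.deriv ∘ₗ y₁) (mul_pos p.α₁_pos p.h₁_pos)
  fun y => (norm_sq_bounds y).1
/-- `y ↦ (y₂)_x` as a bounded operator. -/
noncomputable def Dy₂ : V p →L[ℂ] X p := clmOfSq (H1.deriv ∘ₗ y₂) (mul_pos p.α₃_pos p.h₃_pos)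
  fun y => (norm_sq_bounds y).2.1
/-- `y ↦ (y₃)_xx` as a bounded operator. -/
noncomputable def DDy₃ : V p →L[ℂ] X p := clmOfSq (H2.dxx ∘ₗ y₃) p.K₂_pos
  fun y => (norm_sq_bounds y).2.2.1
/-- `shear` as a bounded operator. -/
noncomputable def shearL : V p →L[ℂ] X p := clmOfSq shear (div_pos p.G₂_pos p.h₂_pos)
  fun y => (norm_sq_bounds y).2.2.2.1
/-- `curl` as a bounded operator. -/
noncomputable def curlL : V p →L[ℂ] X p := clmOfSq curl (mul_pos p.μ_pos p.h₃_pos)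
  fun y => (norm_sq_bounds y).2.2.2.2

theorem Dy₁_apply (y : V p) : Dy₁ y = H1.deriv (y₁ y) := rfl
theorem Dy₂_apply (y : V p) : Dy₂ y = H1.deriv (y₂ y) := rfl
theorem DDy₃_apply (y : V p) : DDy₃ y = H2.dxx (y₃ y) := rfl
theorem curlL_apply (y : V p) : curlL y = curl y := rfl

/-- The elliptic estimate behind the gauge condition: `y₄ - ξ (y₄)_xx` controls `y₄` in `H¹`. -/
theorem norm_sq_le_curl (x : V p) :
    ‖H1.toX (y₄ x)‖ ^ 2 + p.ξ * ‖H1.deriv (y₄ x)‖ ^ 2 ≤ ‖curl x‖ ^ 2 := by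
  obtain ⟨-, -, -, -, s5, s6, s7⟩ := spec x
  have hξ := p.ξ_pos
  have hi := H1.integration_by_parts (y₄ x) (y₅ x)
  rw [s5, s6, map_zero, zero_mul, zero_mul, sub_zero, s7, inner_smul_right,
    inner_self_eq_norm_sq_to_K] at hi
  have hc : ⟪H1.toX (y₄ x), curl x⟫_ℂ =
      ((‖H1.toX (y₄ x)‖ ^ 2 + p.ξ * ‖H1.deriv (y₄ x)‖ ^ 2 : ℝ) : ℂ) := by
    change ⟪H1.toX (y₄ x), H1.toX (y₄ x) - H1.deriv (y₅ x)⟫_ℂ = _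
    rw [inner_sub_right, inner_self_eq_norm_sq_to_K]
    push_cast
    simp only [Complex.coe_algebraMap] at hi ⊢
    linear_combination -hi
  have h1 := (Complex.re_le_norm _).trans (norm_inner_le_norm (𝕜 := ℂ) (H1.toX (y₄ x)) (curl x))
  rw [hc, Complex.ofReal_re] at h1
  have h2 := mul_nonneg hξ.le (sq_nonneg ‖H1.deriv (y₄ x)‖)
  have h3 : ‖H1.toX (y₄ x)‖ ≤ ‖curl x‖ := by
    by_contra hc'
    push Not at hc'
    have := (norm_nonneg _).trans_lt hc'
    nlinarith
  nlinarith [norm_nonneg (curl x)]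

/-- The element of `V` with prescribed components. -/
noncomputable def of (u₁ u₂ : H1 p) (u₃ : H2 p) (u₄ u₅ : H1 p)
    (h : (u₁, u₂, u₃, u₄, u₅) ∈ VSubmodule p) : V p :=
  ⟨(u₁, u₂, u₃, u₄, u₅), h⟩

theorem shear_apply (x : V p) : shear x =
    -H1.toX (y₁ x) + H1.toX (y₂ x) + (p.H : ℂ) • H1.toX (H2.dx (y₃ x)) := rfl

theorem curl_apply (x : V p) : curl x = H1.toX (y₄ x) - H1.deriv (y₅ x) := rfl

/-- The derivatives that determine an element of `V`. -/
noncomputable def derivs : V p →L[ℂ] X p × X p × X p × X p := Dy₁.prod (Dy₂.prod (DDy₃.prod curlL))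

theorem surjective_derivs : Function.Surjective (derivs (p := p)) := by
  rintro ⟨a, b, c, d⟩
  obtain ⟨v, h1, h2, h3⟩ := exists_isNeumannSolution (H1.toX (H1.mk 0 d))
  have hmem : (H1.mk 0 a, H1.mk 0 b, H2.mk 0 (H1.mk 0 c), H2.dx v, H2.toH1 v - H1.mk 0 d) ∈
      VSubmodule p := by
    refine ⟨H1.eval_left_mk 0 a, H1.eval_left_mk 0 b, H1.eval_left_mk 0 _, H1.eval_left_mk 0 c,
      h1, h2, ?_⟩
    change H1.toX (H2.toH1 v - H1.mk 0 d) = (p.ξ : ℂ) • H2.dxx v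
    rw [map_sub, ← h3]
    abel
  refine ⟨of _ _ _ _ _ hmem, ?_⟩
  refine Prod.ext rfl (Prod.ext rfl (Prod.ext rfl ?_))
  change H1.toX (H2.dx v) - H1.deriv (H2.toH1 v - H1.mk 0 d) = d
  rw [map_sub, H2.deriv_toH1, H1.deriv_mk]
  abel

theorem norm_toX_le (x : V p) : ‖H1.toX (y₁ x)‖ ≤ 4 * p.L * ‖H1.deriv (y₁ x)‖ ∧
    ‖H1.toX (y₂ x)‖ ≤ 4 * p.L * ‖H1.deriv (y₂ x)‖ ∧
    ‖H1.toX (H2.dx (y₃ x))‖ ≤ 4 * p.L * ‖H2.dxx (y₃ x)‖ :=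
  ⟨H1.norm_toX_le_of_left (spec x).1, H1.norm_toX_le_of_left (spec x).2.1,
    H1.norm_toX_le_of_left (spec x).2.2.2.1⟩

theorem H_pos (p : BeamParams) : 0 < p.H := by
  have := p.h₁_pos; have := p.h₂_pos; have := p.h₃_pos
  unfold BeamParams.H; positivity

theorem exists_norm_le_derivs : ∃ C : ℝ, ∀ x : V p, ‖x‖ ≤ C * ‖derivs x‖ := by
  have c1 := p.α₁_pos; have c2 := p.α₃_pos; have c3 := p.h₁_pos; have c4 := p.h₂_pos
  have c5 := p.h₃_pos; have c6 := p.ε₃_pos; have c7 := p.G₂_pos; have c8 := p.μ_pos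
  have c9 := p.K₂_pos; have c10 := p.ξ_pos; have c11 := H_pos p; have c12 := p.L_pos
  set c : ℝ := p.α₁ * p.h₁ + p.α₃ * p.h₃ + p.γ ^ 2 * p.h₃ / p.ε₃ + p.K₂ +
    p.G₂ / p.h₂ * (4 * p.L * (2 + p.H)) ^ 2 + p.μ * p.h₃ with hc
  refine ⟨√c, fun x => ?_⟩
  set N := ‖derivs x‖ with hN
  have hN0 : 0 ≤ N := norm_nonneg _
  have b1 : ‖H1.deriv (y₁ x)‖ ≤ N := norm_fst_le (derivs x)
  have b' := norm_snd_le (derivs x)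
  have b2 : ‖H1.deriv (y₂ x)‖ ≤ N := (norm_fst_le (derivs x).2).trans b'
  have b3 : ‖H2.dxx (y₃ x)‖ ≤ N :=
    (norm_fst_le (derivs x).2.2).trans ((norm_snd_le (derivs x).2).trans b')
  have b4 : ‖curl x‖ ≤ N :=
    (norm_snd_le (derivs x).2.2).trans ((norm_snd_le (derivs x).2).trans b')
  obtain ⟨t1, t2, t3⟩ := norm_toX_le x
  have b5 : ‖shear x‖ ≤ 4 * p.L * (2 + p.H) * N := by
    rw [shear_apply]
    refine norm_add₃_le.trans ?_
    rw [norm_neg, norm_smul, Complex.norm_real, Real.norm_of_nonneg c11.le]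
    have e1 := t1.trans (mul_le_mul_of_nonneg_left b1 (by positivity))
    have e2 := t2.trans (mul_le_mul_of_nonneg_left b2 (by positivity))
    have e3 := mul_le_mul_of_nonneg_left (t3.trans (mul_le_mul_of_nonneg_left b3 (by positivity)))
      c11.le
    linarith
  have b6 := norm_Pξ_sq_add_le (H1.deriv (y₂ x))
  have sq : ∀ {a b : ℝ}, 0 ≤ a → a ≤ b → a ^ 2 ≤ b ^ 2 := fun h h' => pow_le_pow_left₀ h h' 2
  have hb2 := sq (norm_nonneg _) b2
  have key : ‖x‖ ^ 2 ≤ c * N ^ 2 := by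
    have hc' : c * N ^ 2 = p.α₁ * p.h₁ * N ^ 2 + p.α₃ * p.h₃ * N ^ 2 +
        p.γ ^ 2 * p.h₃ / p.ε₃ * N ^ 2 + p.K₂ * N ^ 2 +
        p.G₂ / p.h₂ * (4 * p.L * (2 + p.H) * N) ^ 2 + p.μ * p.h₃ * N ^ 2 := by rw [hc]; ring
    rw [norm_sq, hc']
    gcongr
    exact b6.trans hb2
  have hc0 : 0 ≤ c := by positivity
  refine abs_le_of_sq_le_sq' ?_ (by positivity) |>.2
  rwa [mul_pow, Real.sq_sqrt hc0]

instance : CompleteSpace (V p) := by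
  obtain ⟨C, hC⟩ := exists_norm_le_derivs (p := p)
  refine completeSpace_of_isClosed_range derivs hC ?_
  rw [surjective_derivs.range_eq]
  exact isClosed_univ

end V

namespace H

theorem inner_def (x y : H p) : ⟪x, y⟫_ℂ = innerH x y := rfl

theorem spec (z : H p) : H1.eval p.left (z₃ z) = 0 ∧
    ∀ ψ : H1 p, (p.ξ : ℂ) * ⟪H1.deriv ψ, z₄ z⟫_ℂ + ⟪H1.toX ψ, z₅ z⟫_ℂ = 0 := z.2

theorem norm_sq (x : H p) : ‖x‖ ^ 2 =
    (p.ρ₁ * p.h₁) * ‖z₁ x‖ ^ 2 + (p.ρ₃ * p.h₃) * ‖z₂ x‖ ^ 2 +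
      p.m * ‖H1.toX (z₃ x)‖ ^ 2 + p.K₁ * ‖H1.deriv (z₃ x)‖ ^ 2 +
      (p.ξ * p.h₃ * p.ε₃) * ‖z₄ x‖ ^ 2 + (p.ε₃ * p.h₃) * ‖z₅ x‖ ^ 2 := by
  rw [norm_sq_eq_re_inner (𝕜 := ℂ) x, inner_def, innerH_self]
  exact Complex.ofReal_re _

theorem norm_sq_bounds (x : H p) :
    (p.ρ₁ * p.h₁) * ‖z₁ x‖ ^ 2 ≤ ‖x‖ ^ 2 ∧ (p.ρ₃ * p.h₃) * ‖z₂ x‖ ^ 2 ≤ ‖x‖ ^ 2 ∧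
    p.m * ‖H1.toX (z₃ x)‖ ^ 2 ≤ ‖x‖ ^ 2 ∧ p.K₁ * ‖H1.deriv (z₃ x)‖ ^ 2 ≤ ‖x‖ ^ 2 ∧
    (p.ξ * p.h₃ * p.ε₃) * ‖z₄ x‖ ^ 2 ≤ ‖x‖ ^ 2 ∧ (p.ε₃ * p.h₃) * ‖z₅ x‖ ^ 2 ≤ ‖x‖ ^ 2 := by
  have := p.ρ₁_pos; have := p.ρ₃_pos; have := p.h₁_pos; have := p.h₃_pos
  have := p.ε₃_pos; have := p.m_pos; have := p.K₁_pos; have := p.ξ_pos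
  have n1 : 0 ≤ (p.ρ₁ * p.h₁) * ‖z₁ x‖ ^ 2 := by positivity
  have n2 : 0 ≤ (p.ρ₃ * p.h₃) * ‖z₂ x‖ ^ 2 := by positivity
  have n3 : 0 ≤ p.m * ‖H1.toX (z₃ x)‖ ^ 2 := by positivity
  have n4 : 0 ≤ p.K₁ * ‖H1.deriv (z₃ x)‖ ^ 2 := by positivity
  have n5 : 0 ≤ (p.ξ * p.h₃ * p.ε₃) * ‖z₄ x‖ ^ 2 := by positivity
  have n6 : 0 ≤ (p.ε₃ * p.h₃) * ‖z₅ x‖ ^ 2 := by positivity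
  rw [norm_sq x]
  refine ⟨?_, ?_, ?_, ?_, ?_, ?_⟩ <;> linarith

/-- `z ↦ z₁` as a bounded operator. -/
noncomputable def Z₁ : H p →L[ℂ] X p := clmOfSq z₁ (mul_pos p.ρ₁_pos p.h₁_pos)
  fun y => (norm_sq_bounds y).1
/-- `z ↦ z₂` as a bounded operator. -/
noncomputable def Z₂ : H p →L[ℂ] X p := clmOfSq z₂ (mul_pos p.ρ₃_pos p.h₃_pos)
  fun y => (norm_sq_bounds y).2.1
/-- `z ↦ z₃`, with values in `L²(0,L)`, as a bounded operator. -/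
noncomputable def Z₃ : H p →L[ℂ] X p := clmOfSq (H1.toX ∘ₗ z₃) p.m_pos
  fun y => (norm_sq_bounds y).2.2.1
/-- `z ↦ (z₃)_x` as a bounded operator. -/
noncomputable def DZ₃ : H p →L[ℂ] X p := clmOfSq (H1.deriv ∘ₗ z₃) p.K₁_pos
  fun y => (norm_sq_bounds y).2.2.2.1
/-- `z ↦ z₄` as a bounded operator. -/
noncomputable def Z₄ : H p →L[ℂ] X p := clmOfSq z₄ (mul_pos (mul_pos p.ξ_pos p.h₃_pos) p.ε₃_pos)
  fun y => (norm_sq_bounds y).2.2.2.2.1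
/-- `z ↦ z₅` as a bounded operator. -/
noncomputable def Z₅ : H p →L[ℂ] X p := clmOfSq z₅ (mul_pos p.ε₃_pos p.h₃_pos)
  fun y => (norm_sq_bounds y).2.2.2.2.2

/-- The functions that determine an element of `H`. -/
noncomputable def comps : H p →L[ℂ] X p × X p × X p × X p × X p :=
  Z₁.prod (Z₂.prod (DZ₃.prod (Z₄.prod Z₅)))

theorem range_comps : range (comps (p := p)) = {w | ∀ ψ : H1 p,
    (p.ξ : ℂ) * ⟪H1.deriv ψ, w.2.2.2.1⟫_ℂ + ⟪H1.toX ψ, w.2.2.2.2⟫_ℂ = 0} := by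
  ext w
  constructor
  · rintro ⟨z, rfl⟩
    exact (spec z).2
  · intro hw
    exact ⟨⟨(w.1, w.2.1, H1.mk 0 w.2.2.1, w.2.2.2.1, w.2.2.2.2), H1.eval_left_mk _ _, hw⟩, rfl⟩

theorem exists_norm_le_comps : ∃ C : ℝ, ∀ x : H p, ‖x‖ ≤ C * ‖comps x‖ := by
  have c1 := p.ρ₁_pos; have c2 := p.ρ₃_pos; have c3 := p.h₁_pos; have c4 := p.h₃_pos
  have c5 := p.ε₃_pos; have c6 := p.m_pos; have c7 := p.K₁_pos; have c8 := p.ξ_pos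
  have c9 := p.L_pos
  set c : ℝ := p.ρ₁ * p.h₁ + p.ρ₃ * p.h₃ + p.m * (4 * p.L) ^ 2 + p.K₁ + p.ξ * p.h₃ * p.ε₃ +
    p.ε₃ * p.h₃ with hc
  refine ⟨√c, fun x => ?_⟩
  set N := ‖comps x‖ with hN
  have hN0 : 0 ≤ N := norm_nonneg _
  have b1 : ‖z₁ x‖ ≤ N := norm_fst_le (comps x)
  have b' := norm_snd_le (comps x)
  have b2 : ‖z₂ x‖ ≤ N := (norm_fst_le (comps x).2).trans b'
  have b'' := (norm_snd_le (comps x).2).trans b'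
  have b3 : ‖H1.deriv (z₃ x)‖ ≤ N := (norm_fst_le (comps x).2.2).trans b''
  have b4 : ‖z₄ x‖ ≤ N := (norm_fst_le (comps x).2.2.2).trans ((norm_snd_le (comps x).2.2).trans b'')
  have b5 : ‖z₅ x‖ ≤ N := (norm_snd_le (comps x).2.2.2).trans ((norm_snd_le (comps x).2.2).trans b'')
  have b6 : ‖H1.toX (z₃ x)‖ ≤ 4 * p.L * N :=
    (H1.norm_toX_le_of_left (spec x).1).trans (mul_le_mul_of_nonneg_left b3 (by positivity))
  have key : ‖x‖ ^ 2 ≤ c * N ^ 2 := by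
    have hc' : c * N ^ 2 = p.ρ₁ * p.h₁ * N ^ 2 + p.ρ₃ * p.h₃ * N ^ 2 + p.m * (4 * p.L * N) ^ 2 +
        p.K₁ * N ^ 2 + p.ξ * p.h₃ * p.ε₃ * N ^ 2 + p.ε₃ * p.h₃ * N ^ 2 := by rw [hc]; ring
    rw [norm_sq, hc']
    gcongr
  have hc0 : 0 ≤ c := by positivity
  refine abs_le_of_sq_le_sq' ?_ (by positivity) |>.2
  rwa [mul_pow, Real.sq_sqrt hc0]

instance : CompleteSpace (H p) := by
  obtain ⟨C, hC⟩ := exists_norm_le_comps (p := p)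
  refine completeSpace_of_isClosed_range comps hC ?_
  rw [range_comps, Set.ofPred_forall]
  refine isClosed_iInter fun ψ => isClosed_eq ?_ continuous_const
  fun_prop

end H

theorem H2.toH1_injective : Function.Injective (H2.toH1 : H2 p →ₗ[ℂ] H1 p) := by
  intro u v h
  refine H2.eq_of (by rw [h]) (H1.toX_injective ?_)
  rw [← H2.deriv_toH1, ← H2.deriv_toH1, h]

theorem ι_injective : Function.Injective (ι : V p →ₗ[ℂ] H p) := by
  intro x y h
  have h' := congrArg Subtype.val h
  have e1 := congrArg Prod.fst h'
  have e2 := congrArg (fun a => a.2.1) h'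
  have e3 := congrArg (fun a => a.2.2.1) h'
  have e4 := congrArg (fun a => a.2.2.2.1) h'
  have e5 := congrArg (fun a => a.2.2.2.2) h'
  exact Subtype.ext (Prod.ext (H1.toX_injective e1) (Prod.ext (H1.toX_injective e2)
    (Prod.ext (H2.toH1_injective e3) (Prod.ext (H1.toX_injective e4) (H1.toX_injective e5)))))

theorem z₁_ι (y : V p) : H.z₁ (ι y) = H1.toX (V.y₁ y) := rfl
theorem z₂_ι (y : V p) : H.z₂ (ι y) = H1.toX (V.y₂ y) := rfl
theorem z₃_ι (y : V p) : H.z₃ (ι y) = H2.toH1 (V.y₃ y) := rfl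
theorem z₄_ι (y : V p) : H.z₄ (ι y) = H1.toX (V.y₄ y) := rfl
theorem z₅_ι (y : V p) : H.z₅ (ι y) = H1.toX (V.y₅ y) := rfl

theorem exists_norm_ι_le : ∃ C : ℝ, ∀ y : V p, ‖ι y‖ ≤ C * ‖y‖ := by
  obtain ⟨C, hC⟩ := H.exists_norm_le_comps (p := p)
  have c1 := p.ξ_pos; have c2 := p.L_pos
  have hC' : ∀ y : V p, ‖ι y‖ ≤ |C| * ‖H.comps (ι y)‖ := fun y =>
    (hC _).trans (mul_le_mul_of_nonneg_right (le_abs_self C) (norm_nonneg _))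
  set a := 4 * p.L with ha
  have ha0 : 0 < a := by positivity
  refine ⟨|C| * (a * ‖(V.Dy₁ : V p →L[ℂ] X p)‖ + (a * ‖(V.Dy₂ : V p →L[ℂ] X p)‖ +
    (a * ‖(V.DDy₃ : V p →L[ℂ] X p)‖ + (‖(V.curlL : V p →L[ℂ] X p)‖ +
      √p.ξ * ‖(V.curlL : V p →L[ℂ] X p)‖)))), fun y => (hC' y).trans ?_⟩
  rw [mul_assoc]
  refine mul_le_mul_of_nonneg_left ?_ (abs_nonneg C)
  obtain ⟨t1, t2, t3⟩ := V.norm_toX_le y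
  have n1 := V.Dy₁.le_opNorm y
  have n2 := V.Dy₂.le_opNorm y
  have n3 := V.DDy₃.le_opNorm y
  have n4 := V.curlL.le_opNorm y
  rw [V.Dy₁_apply] at n1
  rw [V.Dy₂_apply] at n2
  rw [V.DDy₃_apply] at n3
  rw [V.curlL_apply] at n4
  have t4 := V.norm_sq_le_curl y
  have t5 : ‖H1.toX (V.y₄ y)‖ ≤ ‖V.curl y‖ :=
    abs_le_of_sq_le_sq' (by nlinarith [sq_nonneg ‖H1.deriv (V.y₄ y)‖]) (norm_nonneg _) |>.2
  have t6 : ‖H1.toX (V.y₅ y)‖ ≤ √p.ξ * ‖V.curl y‖ := by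
    rw [(V.spec y).2.2.2.2.2.2, norm_smul, Complex.norm_real, Real.norm_of_nonneg c1.le]
    refine abs_le_of_sq_le_sq' ?_ (by positivity) |>.2
    rw [mul_pow, mul_pow, Real.sq_sqrt c1.le]
    nlinarith [sq_nonneg ‖H1.toX (V.y₄ y)‖]
  have m1 := t1.trans (mul_le_mul_of_nonneg_left n1 ha0.le)
  have m2 := t2.trans (mul_le_mul_of_nonneg_left n2 ha0.le)
  have m3 := t3.trans (mul_le_mul_of_nonneg_left n3 ha0.le)
  have m4 := t5.trans n4
  have m5 := t6.trans (mul_le_mul_of_nonneg_left n4 (Real.sqrt_nonneg _))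
  have m3' : ‖H1.deriv (H2.toH1 (V.y₃ y))‖ ≤ a * (‖(V.DDy₃ : V p →L[ℂ] X p)‖ * ‖y‖) := by
    rw [H2.deriv_toH1]; exact m3
  have pr : ∀ {A B : Type} [NormedAddCommGroup A] [NormedAddCommGroup B] (w : A × B),
      ‖w‖ ≤ ‖w.1‖ + ‖w.2‖ := fun w =>
    max_le (le_add_of_nonneg_right (norm_nonneg _)) (le_add_of_nonneg_left (norm_nonneg _))
  have key : ‖H.comps (ι y)‖ ≤ ‖H1.toX (V.y₁ y)‖ + (‖H1.toX (V.y₂ y)‖ +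
      (‖H1.deriv (H2.toH1 (V.y₃ y))‖ + (‖H1.toX (V.y₄ y)‖ + ‖H1.toX (V.y₅ y)‖))) :=
    (pr _).trans (add_le_add_right ((pr _).trans (add_le_add_right ((pr _).trans
      (add_le_add_right (pr _) _)) _)) _)
  refine key.trans ?_
  simp only [add_mul, mul_assoc]
  linarith

/-- The inclusion of `V` in `H` as a bounded operator. -/
noncomputable def ιL : V p →L[ℂ] H p := ι.mkContinuousOfExistsBound exists_norm_ι_le

theorem ιL_apply (y : V p) : ιL y = ι y := rfl

end RaoNakra

/-! ### The beam operator is skew-adjoint -/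

namespace RaoNakra

variable {p : BeamParams}

namespace H1

/-- The constant function `1`. -/
noncomputable def one (p : BeamParams) : H1 p := mk 1 0

theorem deriv_one : deriv (one p) = 0 := rfl

theorem eval_left_one : eval p.left (one p) = 1 := eval_left_mk 1 0

theorem eval_right_one : eval p.right (one p) = 1 := by
  have h := two_re_inner_deriv (one p)
  have h2 := integration_by_parts (one p) (one p)
  have hL : p.L ∈ Icc 0 p.L := ⟨p.L_pos.le, le_rfl⟩
  have h3 := X.primitive_smul (p := p) 0 0 hL
  rw [zero_smul, zero_mul] at h3
  rw [eval_eq_fn]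
  change fn (one p) p.L = 1
  rw [fn_eq _ hL, eval_left_one, deriv_one, h3, add_zero]

theorem inner_one_one : ⟪toX (one p), toX (one p)⟫_ℂ = p.L := by
  have h := integration_by_parts_mulX (one p) (one p)
  rw [deriv_one, eval_right_one, map_zero, inner_zero_left, inner_zero_right] at h
  simpa using h

theorem inner_one_deriv (u : H1 p) :
    ⟪toX (one p), deriv u⟫_ℂ = eval p.right u - eval p.left u := by
  have h := integration_by_parts (one p) u
  rw [deriv_one, eval_right_one, eval_left_one, inner_zero_left] at h
  simpa using h

end H1

namespace V

variable {u₁ u₂ : H1 p} {u₃ : H2 p} {u₄ u₅ : H1 p} {h : (u₁, u₂, u₃, u₄, u₅) ∈ VSubmodule p}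

@[simp] theorem y₁_of : y₁ (of u₁ u₂ u₃ u₄ u₅ h) = u₁ := rfl
@[simp] theorem y₂_of : y₂ (of u₁ u₂ u₃ u₄ u₅ h) = u₂ := rfl
@[simp] theorem y₃_of : y₃ (of u₁ u₂ u₃ u₄ u₅ h) = u₃ := rfl
@[simp] theorem y₄_of : y₄ (of u₁ u₂ u₃ u₄ u₅ h) = u₄ := rfl
@[simp] theorem y₅_of : y₅ (of u₁ u₂ u₃ u₄ u₅ h) = u₅ := rfl

theorem mem_test₁ (u : H1 p) (hu : H1.eval p.left u = 0) : (u, 0, 0, 0, 0) ∈ VSubmodule p :=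
  ⟨hu, map_zero _, map_zero _, map_zero _, map_zero _, map_zero _, (smul_zero _).symm⟩

theorem mem_test₂ (u : H1 p) (hu : H1.eval p.left u = 0) : (0, u, 0, 0, 0) ∈ VSubmodule p :=
  ⟨map_zero _, hu, map_zero _, map_zero _, map_zero _, map_zero _, (smul_zero _).symm⟩

theorem mem_test₃ (u : H1 p) (hu : H1.eval p.left u = 0) :
    (0, 0, H2.mk 0 u, 0, 0) ∈ VSubmodule p :=
  ⟨map_zero _, map_zero _, H1.eval_left_mk _ _, hu, map_zero _, map_zero _, (smul_zero _).symm⟩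

theorem mem_test₅ (u : H1 p) (hu : ⟪H1.toX (H1.one p), H1.toX u⟫_ℂ = 0) :
    (0, 0, 0, H1.mk 0 ((p.ξ : ℂ)⁻¹ • H1.toX u), u) ∈ VSubmodule p := by
  refine ⟨map_zero _, map_zero _, map_zero _, map_zero _, H1.eval_left_mk _ _, ?_, ?_⟩
  · have h := H1.inner_one_deriv (H1.mk 0 ((p.ξ : ℂ)⁻¹ • H1.toX u))
    rw [H1.deriv_mk, inner_smul_right, hu, mul_zero, H1.eval_left_mk, sub_zero] at h
    exact h.symm
  · have : (p.ξ : ℂ) ≠ 0 := by exact_mod_cast p.ξ_pos.ne'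
    change H1.toX u = (p.ξ : ℂ) • ((p.ξ : ℂ)⁻¹ • H1.toX u)
    rw [smul_smul, mul_inv_cancel₀ this, one_smul]

/-- The displacement `y₁ = u`, with all other components zero. -/
noncomputable def test₁ (u : H1 p) (hu : H1.eval p.left u = 0) : V p :=
  of u 0 0 0 0 (mem_test₁ u hu)

/-- The displacement `y₂ = u`, with all other components zero. -/
noncomputable def test₂ (u : H1 p) (hu : H1.eval p.left u = 0) : V p :=
  of 0 u 0 0 0 (mem_test₂ u hu)

/-- The displacement `y₃ = ∫₀ˣ u`, with all other components zero. -/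
noncomputable def test₃ (u : H1 p) (hu : H1.eval p.left u = 0) : V p :=
  of 0 0 (H2.mk 0 u) 0 0 (mem_test₃ u hu)

/-- The potential `y₅ = u`, `y₄ = ξ⁻¹ ∫₀ˣ u`; the mean of `u` has to vanish for `y₄(L) = 0`. -/
noncomputable def test₅ (u : H1 p) (hu : ⟪H1.toX (H1.one p), H1.toX u⟫_ℂ = 0) : V p :=
  of 0 0 0 (H1.mk 0 ((p.ξ : ℂ)⁻¹ • H1.toX u)) u (mem_test₅ u hu)

/-- Regularity of weak solutions `N` of `N - ξ N_xx = -ξ g_x`, `N(0) = N(L) = 0`, which is the adjoint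
of `ψ ↦ ψ₄ - (ψ₅)_x` on potentials with the gauge condition `ψ₅ = ξ (ψ₄)_x`. -/
theorem exists_of_inner_curl {N g : X p}
    (h : ∀ ψ : V p, ⟪curl ψ, N⟫_ℂ = ⟪H1.toX (y₅ ψ), g⟫_ℂ) :
    ∃ n r : H1 p, H1.toX n = N ∧ H1.eval p.left n = 0 ∧ H1.eval p.right n = 0 ∧
      H1.deriv n = g + H1.toX r ∧ H1.deriv r = (p.ξ : ℂ)⁻¹ • N := by
  have hL : (p.L : ℂ) ≠ 0 := by exact_mod_cast p.L_pos.ne'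
  let one := H1.one p
  -- test potentials have mean zero, so the equation determines the right-hand side up to a constant
  let w : X p := (p.ξ : ℂ)⁻¹ • H1.tailX N - g
  let κ : ℂ := ⟪H1.toX one, w⟫_ℂ / p.L
  have h5 : ∀ u : H1 p, ⟪H1.toX one, H1.toX u⟫_ℂ = 0 →
      ⟪H1.deriv u, N⟫_ℂ = ⟪H1.toX u, w⟫_ℂ := by
    intro u hu
    have h1 := h (test₅ u hu)
    rw [curl_apply, test₅, y₄_of, y₅_of, inner_sub_left] at h1
    have h2 := H1.inner_deriv_tailX (H1.eval_left_mk 0 ((p.ξ : ℂ)⁻¹ • H1.toX u)) N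
    rw [H1.deriv_mk, inner_smul_left, map_inv₀, Complex.conj_ofReal] at h2
    rw [inner_sub_right (H1.toX u), inner_smul_right]
    linear_combination -h1 - h2
  have hw : ∀ u : H1 p, ⟪H1.deriv u, N⟫_ℂ = ⟪H1.toX u, w - κ • H1.toX one⟫_ℂ := by
    intro u
    let c : ℂ := ⟪H1.toX one, H1.toX u⟫_ℂ / p.L
    have h1 := h5 (u - c • one) (by
      rw [map_sub, map_smul, inner_sub_right, inner_smul_right, H1.inner_one_one]
      simp only [c]
      field_simp
      ring)
    rw [map_sub, map_sub, map_smul, map_smul, H1.deriv_one, smul_zero, sub_zero, inner_sub_left,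
      inner_smul_left] at h1
    rw [h1, inner_sub_right _ w, inner_smul_right]
    simp only [c, κ, map_div₀, Complex.conj_ofReal, inner_conj_symm]
    ring
  have hN := H1.eq_tailX_of_weak (f := N) (g := w - κ • H1.toX one) fun u _ => hw u
  refine ⟨H1.tail (w - κ • H1.toX one), κ • one - (p.ξ : ℂ)⁻¹ • H1.tail N, hN.symm, ?_,
    H1.eval_right_tail _, ?_, ?_⟩
  · have h1 := H1.inner_one_deriv (H1.tail (w - κ • H1.toX one))
    have h2 := hw one
    rw [H1.deriv_one, inner_zero_left] at h2
    rw [H1.eval_right_tail, H1.deriv_tail, inner_neg_right, ← h2] at h1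
    linear_combination h1
  · rw [H1.deriv_tail, map_sub, map_smul, map_smul]
    simp only [w, H1.tailX_apply]
    abel
  · rw [map_sub, map_smul, map_smul, H1.deriv_one, H1.deriv_tail, smul_zero, smul_neg, zero_sub,
      neg_neg]

/-- The energy identity for the solution of `exists_of_inner_curl`. -/
theorem norm_sq_add_eq {g : X p} {n r : H1 p} (h0 : H1.eval p.left n = 0)
    (hL : H1.eval p.right n = 0) (hn : H1.deriv n = g + H1.toX r)
    (hr : H1.deriv r = (p.ξ : ℂ)⁻¹ • H1.toX n) :
    ‖H1.toX n‖ ^ 2 + p.ξ * ‖H1.toX r‖ ^ 2 = -(p.ξ * (⟪H1.toX r, g⟫_ℂ).re) := by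
  have hξ : (p.ξ : ℂ) ≠ 0 := by exact_mod_cast p.ξ_pos.ne'
  have h := H1.integration_by_parts r n
  rw [h0, hL, hn, hr, inner_smul_left, inner_add_right, map_inv₀, Complex.conj_ofReal,
    inner_self_eq_norm_sq_to_K, inner_self_eq_norm_sq_to_K, mul_zero, mul_zero, sub_zero] at h
  have h1 : ((‖H1.toX n‖ ^ 2 + p.ξ * ‖H1.toX r‖ ^ 2 : ℝ) : ℂ) =
      -((p.ξ : ℂ) * ⟪H1.toX r, g⟫_ℂ) := by
    push_cast
    simp only [Complex.coe_algebraMap] at h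
    field_simp at h
    linear_combination h
  have h2 := congrArg Complex.re h1
  rwa [Complex.ofReal_re, Complex.neg_re, Complex.re_ofReal_mul] at h2

end V

/-- The pairing of `V` with `H`; the gauge condition turns the last two terms into a single one. -/
theorem inner_ι (ψ : V p) (k : H p) : ⟪ι ψ, k⟫_ℂ =
    (p.ρ₁ * p.h₁ : ℝ) * ⟪H1.toX (V.y₁ ψ), H.z₁ k⟫_ℂ +
    (p.ρ₃ * p.h₃ : ℝ) * ⟪H1.toX (V.y₂ ψ), H.z₂ k⟫_ℂ +
    (p.m : ℝ) * ⟪H1.toX (H2.toH1 (V.y₃ ψ)), H1.toX (H.z₃ k)⟫_ℂ +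
    (p.K₁ : ℝ) * ⟪H1.toX (H2.dx (V.y₃ ψ)), H1.deriv (H.z₃ k)⟫_ℂ +
    (p.ξ * p.h₃ * p.ε₃ : ℝ) * ⟪V.curl ψ, H.z₄ k⟫_ℂ := by
  have h := (H.spec k).2 (V.y₅ ψ)
  rw [H.inner_def, H.innerH, z₁_ι, z₂_ι, z₃_ι, z₄_ι, z₅_ι, H2.deriv_toH1, V.curl_apply,
    inner_sub_left]
  push_cast
  linear_combination (p.h₃ * p.ε₃ : ℂ) * h

theorem inner_toX_test₃ (u : H1 p) (hu : H1.eval p.left u = 0) (k : X p) :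
    ⟪H1.toX (H2.toH1 (V.y₃ (V.test₃ u hu))), k⟫_ℂ = ⟪H1.toX u, H1.tailX k⟫_ℂ := by
  have h := H1.inner_deriv_tailX (H1.eval_left_mk 0 (H1.toX u)) k
  rw [H1.deriv_mk] at h
  exact h.symm

/-- `V` is dense in `H`. -/
theorem eq_zero_of_inner_ι {k : H p} (h : ∀ ψ : V p, ⟪ι ψ, k⟫_ℂ = 0) : k = 0 := by
  have c1 := p.ρ₁_pos; have c2 := p.ρ₃_pos; have c3 := p.h₁_pos; have c4 := p.h₃_pos
  have c5 := p.ε₃_pos; have c6 := p.m_pos; have c7 := p.K₁_pos; have c8 := p.ξ_pos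
  have hz : ∀ {c : ℝ} {w : ℂ}, 0 < c → (c : ℂ) * w = 0 → w = 0 := fun hc hw =>
    (mul_eq_zero.mp hw).resolve_left (by exact_mod_cast hc.ne')
  have k1 : H.z₁ k = 0 := H1.eq_zero_of_inner_toX fun u hu => by
    have h1 := h (V.test₁ u hu)
    rw [inner_ι] at h1
    simp only [V.test₁, V.y₁_of, V.y₂_of, V.y₃_of, V.curl_apply, V.y₄_of, V.y₅_of, map_zero,
      inner_zero_left, mul_zero, add_zero, sub_zero] at h1
    exact hz (mul_pos c1 c3) h1
  have k2 : H.z₂ k = 0 := H1.eq_zero_of_inner_toX fun u hu => by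
    have h1 := h (V.test₂ u hu)
    rw [inner_ι] at h1
    simp only [V.test₂, V.y₁_of, V.y₂_of, V.y₃_of, V.curl_apply, V.y₄_of, V.y₅_of, map_zero,
      inner_zero_left, mul_zero, add_zero, sub_zero, zero_add] at h1
    exact hz (mul_pos c2 c4) h1
  have k3' : (p.m : ℂ) • H1.tailX (H1.toX (H.z₃ k)) + (p.K₁ : ℂ) • H1.deriv (H.z₃ k) = 0 :=
    H1.eq_zero_of_inner_toX fun u hu => by
      have h1 := h (V.test₃ u hu)
      rw [inner_ι, inner_toX_test₃] at h1
      simp only [V.test₃, V.y₁_of, V.y₂_of, V.y₃_of, V.curl_apply, V.y₄_of, V.y₅_of, map_zero,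
        inner_zero_left, mul_zero, add_zero, sub_zero, zero_add] at h1
      rw [inner_add_right, inner_smul_right, inner_smul_right]
      exact h1
  -- the operator `m ∫ₓᴸ ∫₀ˣ + K₁` is positive
  have k3 : H.z₃ k = 0 := by
    have h1 := congrArg (fun v => ⟪H1.deriv (H.z₃ k), v⟫_ℂ) k3'
    simp only [inner_add_right, inner_smul_right, inner_zero_right] at h1
    rw [H1.inner_deriv_tailX (H.spec k).1, inner_self_eq_norm_sq_to_K,
      inner_self_eq_norm_sq_to_K] at h1
    have h2 : p.m * ‖H1.toX (H.z₃ k)‖ ^ 2 + p.K₁ * ‖H1.deriv (H.z₃ k)‖ ^ 2 = 0 := by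
      apply Complex.ofReal_injective
      push_cast
      exact h1
    have h3 : ‖H1.toX (H.z₃ k)‖ ^ 2 = 0 := by
      have := mul_nonneg c7.le (sq_nonneg ‖H1.deriv (H.z₃ k)‖)
      nlinarith [sq_nonneg ‖H1.toX (H.z₃ k)‖]
    have h4 : H1.toX (H.z₃ k) = 0 := by simpa using h3
    exact H1.toX_injective (by rw [h4, map_zero])
  have hcurl : ∀ ψ : V p, ⟪V.curl ψ, H.z₄ k⟫_ℂ = ⟪H1.toX (V.y₅ ψ), (0 : X p)⟫_ℂ := fun ψ => by
    have h1 := h ψ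
    rw [inner_ι, k1, k2, k3] at h1
    simp only [map_zero, inner_zero_right, mul_zero, zero_add] at h1
    rw [hz (by positivity) h1, inner_zero_right]
  have k4 : H.z₄ k = 0 := by
    obtain ⟨n, r, h1, h2, h3, h4, h5⟩ := V.exists_of_inner_curl hcurl
    rw [← h1] at h5
    have h6 := V.norm_sq_add_eq h2 h3 h4 h5
    rw [inner_zero_right, Complex.zero_re, mul_zero, neg_zero, h1] at h6
    have h7 : ‖H.z₄ k‖ ^ 2 = 0 := by
      have := mul_nonneg c8.le (sq_nonneg ‖H1.toX r‖)
      nlinarith [sq_nonneg ‖H.z₄ k‖]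
    simpa using h7
  have k5 : H.z₅ k = 0 := H1.eq_zero_of_inner_toX fun u _ => by
    have h1 := (H.spec k).2 u
    rwa [k4, inner_zero_right, mul_zero, zero_add] at h1
  exact Subtype.ext (Prod.ext k1 (Prod.ext k2 (Prod.ext k3 (Prod.ext k4 k5))))

theorem conj_formD (z ψ : V p) : conj (formD z ψ) = -formD ψ z := by
  simp only [formD, map_mul, map_sub, Complex.conj_ofReal, inner_conj_symm]
  ring

/-- The operator `D`, as a bounded skew-adjoint operator on `V`: `⟪ψ, D z⟫ = formD z ψ`. -/
noncomputable def opD : V p →L[ℂ] V p :=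
  ((p.γ * p.h₃ : ℝ) : ℂ) • (V.Dy₂.adjoint ∘L (H.Z₅ ∘L ιL) - (H.Z₅ ∘L ιL).adjoint ∘L V.Dy₂)

theorem inner_opD (z ψ : V p) : ⟪ψ, opD z⟫_ℂ = formD z ψ := by
  simp only [opD, smul_apply, sub_apply, inner_smul_right, inner_sub_right,
    ContinuousLinearMap.comp_apply, ContinuousLinearMap.adjoint_inner_right]
  rfl

/-- Solvability of the stationary problem in `V` at a real `l`. -/
theorem exists_stationary (l : ℝ) (f : V p) : ∃ z : V p, ∀ ψ : V p,
    ((l : ℂ) ^ 2 * ⟪ι ψ, ι z⟫_ℂ + ⟪ψ, z⟫_ℂ) + l * formD z ψ = ⟪ψ, f⟫_ℂ := by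
  let T : V p →L[ℂ] V p := ((l : ℂ) ^ 2) • (ιL.adjoint ∘L ιL) + ContinuousLinearMap.id ℂ _ +
    (l : ℂ) • opD
  have hT : ∀ z ψ, ⟪ψ, T z⟫_ℂ = ((l : ℂ) ^ 2 * ⟪ι ψ, ι z⟫_ℂ + ⟪ψ, z⟫_ℂ) + l * formD z ψ := by
    intro z ψ
    simp only [T, add_apply, smul_apply, inner_add_right, inner_smul_right, inner_opD,
      ContinuousLinearMap.comp_apply, ContinuousLinearMap.adjoint_inner_right, ιL_apply,
      ContinuousLinearMap.id_apply]
  obtain ⟨z, hz⟩ := surjective_of_coercive T (fun z => by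
    have h1 : (formD z z).re = 0 := by
      have := congrArg Complex.re (conj_formD z z)
      rw [Complex.conj_re, Complex.neg_re] at this
      linarith
    rw [hT, Complex.add_re, Complex.re_ofReal_mul, h1, mul_zero, add_zero, Complex.add_re,
      inner_self_eq_norm_sq_to_K, inner_self_eq_norm_sq_to_K]
    simp only [Complex.coe_algebraMap]
    norm_cast
    nlinarith [mul_nonneg (sq_nonneg l) (sq_nonneg ‖ι z‖)]) f
  exact ⟨z, fun ψ => by rw [← hT, hz]⟩

theorem energy_inner (φ g : EnergySpace p) :
    ⟪φ, g⟫_ℂ = ⟪φ.fst, g.fst⟫_ℂ + ⟪φ.snd, g.snd⟫_ℂ := rfl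

variable (p) in
/-- The graph of `𝒜`. -/
noncomputable def graphA : Submodule ℂ (EnergySpace p × EnergySpace p) where
  carrier := {a | IsAValue a.1 a.2}
  zero_mem' := ⟨0, 0, by rw [map_zero]; rfl, by simp, fun ψ => by
    have h : formD 0 ψ = 0 := by simp [formD]
    simp [h]⟩
  add_mem' := by
    rintro a b ⟨y, z, h1, h2, h3⟩ ⟨y', z', h1', h2', h3'⟩
    refine ⟨y + y', z + z', ?_, ?_, fun ψ => ?_⟩
    · rw [Prod.fst_add, h1, h1', map_add]; rfl
    · rw [Prod.snd_add, WithLp.add_fst, h2, h2']; abel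
    · rw [Prod.snd_add, WithLp.add_snd, inner_add_right, inner_add_right, ← h3, ← h3']
      simp only [← inner_opD, map_add, inner_add_right]
      ring
  smul_mem' := by
    rintro c a ⟨y, z, h1, h2, h3⟩
    refine ⟨c • y, c • z, ?_, ?_, fun ψ => ?_⟩
    · rw [Prod.smul_fst, h1, map_smul]; rfl
    · rw [Prod.smul_snd, WithLp.smul_fst, h2, smul_neg]
    · rw [Prod.smul_snd, WithLp.smul_snd, inner_smul_right, inner_smul_right, ← h3]
      simp only [← inner_opD, map_smul, inner_smul_right]
      ring

theorem mem_graphA {φ g : EnergySpace p} : (φ, g) ∈ graphA p ↔ IsAValue φ g := Iff.rfl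

variable (p) in
/-- `𝒜` is skew-adjoint: the coupling `D` is skew-symmetric, the range condition is the stationary
problem, and density of `V` in `H` makes `𝒜` single-valued. -/
theorem isSkewAdjointGraph_graphA : IsSkewAdjointGraph (graphA p) where
  skew := by
    rintro ⟨a, g⟩ ⟨y, z, h1, h2, h3⟩ ⟨a', g'⟩ ⟨y', z', h1', h2', h3'⟩
    simp only at h1 h2 h3 h1' h2' h3' ⊢
    have e1 := h3 z'
    have e2 := h3' z
    have e3 := conj_formD z z'
    have e1' := congrArg (starRingEnd ℂ) e1
    rw [map_add, inner_conj_symm, inner_conj_symm, e3] at e1'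
    rw [energy_inner, energy_inner, h2, h2', h1, h1']
    change ⟪y, -z'⟫_ℂ + ⟪ι z, g'.snd⟫_ℂ = -(⟪-z, y'⟫_ℂ + ⟪g.snd, ι z'⟫_ℂ)
    simp only [inner_neg_left, inner_neg_right]
    linear_combination -e2 - e1'
  surj := by
    intro l hl f
    have hl' : (l : ℂ) ≠ 0 := by exact_mod_cast hl
    obtain ⟨z, hz⟩ := exists_stationary l ((l : ℂ) • ιL.adjoint f.snd - f.fst)
    refine ⟨WithLp.toLp 2 ((l : ℂ)⁻¹ • (z + f.fst), ι z), (l : ℂ)⁻¹ • (z + f.fst), z, rfl, ?_,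
      fun ψ => ?_⟩
    · change f.fst - (l : ℂ) • ((l : ℂ)⁻¹ • (z + f.fst)) = -z
      rw [smul_smul, mul_inv_cancel₀ hl', one_smul]
      abel
    · change _ = ⟪ι ψ, f.snd - (l : ℂ) • ι z⟫_ℂ
      have h1 := hz ψ
      rw [inner_sub_right, inner_smul_right, ContinuousLinearMap.adjoint_inner_right,
        ιL_apply] at h1
      rw [inner_smul_right, inner_add_right, inner_sub_right, inner_smul_right]
      field_simp
      linear_combination h1
  single := by
    rintro f ⟨y, z, h1, h2, h3⟩
    have hy : y = 0 := (congrArg WithLp.fst h1).symm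
    have hz : z = 0 := ι_injective (by rw [map_zero]; exact (congrArg WithLp.snd h1).symm)
    have hs : f.snd = 0 := eq_zero_of_inner_ι fun ψ => by
      rw [← h3 ψ, hy, hz, inner_zero_right, ← inner_opD, map_zero, inner_zero_right, add_zero]
    rw [hz, neg_zero] at h2
    exact WithLp.ofLp_injective 2 (Prod.ext h2 hs)

end RaoNakra

/-! ### Regularity and weighted identities for the stationary equations -/

namespace RaoNakra

variable {p : BeamParams}

/-- The weighted real inner product `Re ∫ x f̄ g` of `L²(0,L)`. -/
noncomputable def wre (f g : X p) : ℝ := (⟪f, mulX g⟫_ℂ).re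

theorem wre_comm (f g : X p) : wre f g = wre g f := by
  rw [wre, wre, ← inner_mulX_left, ← inner_conj_symm, Complex.conj_re]

theorem wre_add_left (f f' g : X p) : wre (f + f') g = wre f g + wre f' g := by
  rw [wre, inner_add_left, Complex.add_re]; rfl

theorem wre_neg_left (f g : X p) : wre (-f) g = -wre f g := by
  rw [wre, inner_neg_left, Complex.neg_re]; rfl

theorem wre_smul_left (c : ℝ) (f g : X p) : wre ((c : ℂ) • f) g = c * wre f g := by
  rw [wre, inner_smul_left, Complex.conj_ofReal, Complex.re_ofReal_mul]; rfl

theorem wre_sub_left (f f' g : X p) : wre (f - f') g = wre f g - wre f' g := by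
  rw [sub_eq_add_neg, wre_add_left, wre_neg_left, sub_eq_add_neg]

theorem wre_neg_right (f g : X p) : wre f (-g) = -wre f g := by
  rw [wre_comm, wre_neg_left, wre_comm]

theorem wre_sub_right (f g g' : X p) : wre f (g - g') = wre f g - wre f g' := by
  rw [wre_comm, wre_sub_left, wre_comm g, wre_comm g']

theorem abs_wre_le (f g : X p) : |wre f g| ≤ p.L * (‖f‖ * ‖g‖) :=
  (Complex.abs_re_le_norm _).trans (norm_inner_mulX_le f g)

theorem abs_wre_le_of_le {f g : X p} {M N : ℝ} (hf : ‖f‖ ≤ M) (hg : ‖g‖ ≤ N) :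
    |wre f g| ≤ p.L * (M * N) :=
  (abs_wre_le f g).trans (mul_le_mul_of_nonneg_left (mul_le_mul hf hg (norm_nonneg _)
    ((norm_nonneg _).trans hf)) p.L_pos.le)

namespace H1

theorem two_wre_deriv (u : H1 p) :
    2 * wre (toX u) (deriv u) = p.L * ‖eval p.right u‖ ^ 2 - ‖toX u‖ ^ 2 :=
  two_re_inner_mulX_deriv u

/-- If `c f = ∫ₓᴸ g`, then `g` is tested against `x f` by the Pohozaev identity, without boundary
term. -/
theorem two_wre_of_eq_tailX {c : ℝ} (hc : 0 < c) {f g : X p} (h : (c : ℂ) • f = tailX g) :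
    2 * wre g f = c * ‖f‖ ^ 2 := by
  have h1 := two_wre_deriv (tail g)
  rw [eval_right_tail, deriv_tail, ← tailX_apply, ← h, wre_neg_right, wre_smul_left, norm_smul,
    Complex.norm_real, Real.norm_of_nonneg hc.le, wre_comm, norm_zero] at h1
  have h2 : c * (2 * wre g f - c * ‖f‖ ^ 2) = 0 := by linear_combination -h1
  linarith [(mul_eq_zero.mp h2).resolve_left hc.ne']

theorem wre_tailX_deriv (g : X p) (v : H1 p) :
    wre (tailX g) (deriv v) = wre g (toX v) - (⟪tailX g, toX v⟫_ℂ).re := by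
  have h := congrArg Complex.re (integration_by_parts_mulX (tail g) v)
  rw [eval_right_tail, deriv_tail, inner_neg_left, map_zero, zero_mul, mul_zero] at h
  simp only [Complex.add_re, Complex.neg_re, Complex.zero_re] at h
  rw [tailX_apply, wre, wre]
  linarith

/-- The analogue of `two_wre_of_eq_tailX` for the stretching equation of the piezoelectric layer, where
the stress contains the smoothing term `Pξ f` and the potential `v`. -/
theorem wre_le_of_eq_tailX {a b d : ℝ} (ha : 0 < a) (hb : 0 ≤ b) {f g : X p} {v : H1 p}
    (h : (a : ℂ) • f + (b : ℂ) • Pξ f + (d : ℂ) • toX v = tailX g) :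
    wre g f + d * wre (deriv v) f ≤ (a / 2 + b * (p.L * (√p.ξ)⁻¹)) * ‖f‖ ^ 2 := by
  have ha' : (a : ℂ) ≠ 0 := by exact_mod_cast ha.ne'
  have hL := p.L_pos
  -- the equation shows that `f` is a function of class `H¹`
  let U : H1 p := (a : ℂ)⁻¹ • (tail g - (b : ℂ) • H2.toH1 (neumannSol f) - (d : ℂ) • v)
  have hU : toX U = f := by
    have e : toX U = (a : ℂ)⁻¹ • (tailX g - (b : ℂ) • Pξ f - (d : ℂ) • toX v) := by
      simp only [U, map_smul, map_sub]; rfl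
    rw [e, ← h, inv_smul_eq_iff₀ ha']
    abel
  have hd : g = -((a : ℂ) • deriv U + (b : ℂ) • toX (H2.dx (neumannSol f)) +
      (d : ℂ) • deriv v) := by
    have e : (a : ℂ) • deriv U = -g - (b : ℂ) • toX (H2.dx (neumannSol f)) -
        (d : ℂ) • deriv v := by
      simp only [U, map_smul, map_sub, smul_smul, mul_inv_cancel₀ ha', one_smul, deriv_tail,
        H2.deriv_toH1]
    rw [e]; abel
  have h1 := two_wre_deriv U
  rw [hU, wre_comm] at h1
  have h2 : ‖toX (H2.dx (neumannSol f))‖ ≤ (√p.ξ)⁻¹ * ‖f‖ :=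
    norm_le_inv_sqrt_mul p.ξ_pos (norm_nonneg _) (by
      have := norm_Pξ_sq_add_le f
      nlinarith [sq_nonneg ‖Pξ f‖])
  have h3 := (_root_.abs_le.mp (abs_wre_le_of_le h2 (le_refl ‖f‖))).1
  have h4 := mul_le_mul_of_nonneg_left h3 hb
  have h5 : wre g f = -(a * wre (deriv U) f + b * wre (toX (H2.dx (neumannSol f))) f +
      d * wre (deriv v) f) := by
    conv_lhs => rw [hd]
    rw [wre_neg_left, wre_add_left, wre_add_left, wre_smul_left, wre_smul_left, wre_smul_left]
  have h6 : 0 ≤ a * (p.L * ‖eval p.right U‖ ^ 2) := by positivity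
  rw [h5]
  nlinarith

end H1

/-- The potential part of an element of `V` is an element of `V`. -/
theorem V.mem_potential (ψ : V p) : (0, 0, 0, V.y₄ ψ, V.y₅ ψ) ∈ VSubmodule p :=
  ⟨map_zero _, map_zero _, map_zero _, map_zero _, (V.spec ψ).2.2.2.2⟩

/-- The equation `A y + D z = M k` in `V'`. -/
def IsWeakSolution (y z : V p) (k : H p) : Prop :=
  ∀ ψ : V p, ⟪ψ, y⟫_ℂ + formD z ψ = ⟪ι ψ, k⟫_ℂ

namespace IsWeakSolution

variable {y z : V p} {k : H p}

theorem deriv_y₁ (h : IsWeakSolution y z k) : ((p.α₁ * p.h₁ : ℝ) : ℂ) • H1.deriv (V.y₁ y) =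
    H1.tailX (((p.ρ₁ * p.h₁ : ℝ) : ℂ) • H.z₁ k + ((p.G₂ / p.h₂ : ℝ) : ℂ) • V.shear y) :=
  H1.eq_tailX_of_weak fun u hu => by
    have h1 := h (V.test₁ u hu)
    rw [inner_ι, V.inner_def, V.innerV, formD] at h1
    simp only [V.test₁, V.y₁_of, V.y₂_of, V.y₃_of, V.curl_apply, V.shear_apply (V.of _ _ _ _ _ _), V.y₄_of, V.y₅_of,
      map_zero, inner_zero_left, mul_zero, add_zero, sub_zero, smul_zero, inner_neg_left] at h1
    rw [inner_smul_right, inner_add_right, inner_smul_right, inner_smul_right]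
    linear_combination h1

theorem deriv_y₂ (h : IsWeakSolution y z k) : ((p.α₃ * p.h₃ : ℝ) : ℂ) • H1.deriv (V.y₂ y) +
    ((p.γ ^ 2 * p.h₃ / p.ε₃ : ℝ) : ℂ) • Pξ (H1.deriv (V.y₂ y)) +
    ((p.γ * p.h₃ : ℝ) : ℂ) • H1.toX (V.y₅ z) =
    H1.tailX (((p.ρ₃ * p.h₃ : ℝ) : ℂ) • H.z₂ k - ((p.G₂ / p.h₂ : ℝ) : ℂ) • V.shear y) :=
  H1.eq_tailX_of_weak fun u hu => by
    have h1 := h (V.test₂ u hu)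
    rw [inner_ι, V.inner_def, V.innerV, formD] at h1
    simp only [V.test₂, V.y₁_of, V.y₂_of, V.y₃_of, V.curl_apply, V.shear_apply (V.of _ _ _ _ _ _), V.y₄_of, V.y₅_of,
      map_zero, inner_zero_left, mul_zero, add_zero, sub_zero, zero_add, smul_zero,
      neg_zero] at h1
    rw [inner_add_right, inner_add_right, inner_smul_right, inner_smul_right, inner_smul_right,
      inner_sub_right, inner_smul_right, inner_smul_right]
    linear_combination h1

theorem dxx_y₃ (h : IsWeakSolution y z k) : (p.K₂ : ℂ) • H2.dxx (V.y₃ y) =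
    H1.tailX ((p.K₁ : ℂ) • H1.deriv (H.z₃ k) + (p.m : ℂ) • H1.tailX (H1.toX (H.z₃ k)) -
      ((p.G₂ / p.h₂ * p.H : ℝ) : ℂ) • V.shear y) :=
  H1.eq_tailX_of_weak fun u hu => by
    have h1 := h (V.test₃ u hu)
    rw [inner_ι, V.inner_def, V.innerV, formD, inner_toX_test₃] at h1
    have e1 : H2.dx (H2.mk 0 u) = u := rfl
    have e2 : H2.dxx (H2.mk 0 u) = H1.deriv u := rfl
    simp only [V.test₃, V.y₁_of, V.y₂_of, V.y₃_of, V.curl_apply, V.shear_apply (V.of _ _ _ _ _ _), V.y₄_of, V.y₅_of,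
      map_zero, inner_zero_left, mul_zero, add_zero, sub_zero, zero_add, neg_zero, e1, e2,
      inner_smul_left, Complex.conj_ofReal] at h1
    rw [inner_smul_right, inner_sub_right, inner_add_right, inner_smul_right, inner_smul_right,
      inner_smul_right]
    push_cast at h1 ⊢
    linear_combination h1

theorem inner_curl (h : IsWeakSolution y z k) (ψ : V p) :
    ⟪V.curl ψ, (p.μ : ℂ) • V.curl y - ((p.ξ * p.ε₃ : ℝ) : ℂ) • H.z₄ k⟫_ℂ =
      ⟪H1.toX (V.y₅ ψ), (p.γ : ℂ) • H1.deriv (V.y₂ z)⟫_ℂ := by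
  have h1 := h (V.of 0 0 0 (V.y₄ ψ) (V.y₅ ψ) (V.mem_potential ψ))
  rw [inner_ι, V.inner_def, V.innerV, formD] at h1
  simp only [V.y₁_of, V.y₂_of, V.y₃_of, V.curl_apply (V.of _ _ _ _ _ _), V.shear_apply (V.of _ _ _ _ _ _), V.y₄_of,
    V.y₅_of, map_zero, inner_zero_left, mul_zero, add_zero, zero_add, neg_zero, smul_zero,
    zero_sub, ← V.curl_apply] at h1
  have h3 : (p.h₃ : ℂ) ≠ 0 := by exact_mod_cast p.h₃_pos.ne'
  rw [inner_sub_right, inner_smul_right, inner_smul_right, inner_smul_right]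
  refine mul_left_cancel₀ h3 ?_
  push_cast at h1 ⊢
  linear_combination h1

end IsWeakSolution

/-- The gauge condition: `ξ z₄` has the weak derivative `z₅` and vanishes at `L`. -/
theorem H.smul_z₄ (k : H p) : (p.ξ : ℂ) • H.z₄ k = H1.tailX (-H.z₅ k) :=
  H1.eq_tailX_of_weak fun u _ => by
    rw [inner_smul_right, inner_neg_right]
    linear_combination (H.spec k).2 u

/-- A bound of `S` that is quadratic in `(a, b)` from one in which `a` and `b` occur with factors of
order `√S`. -/
theorem le_of_le_mul_add {S τ x g e N a b : ℝ} (hτ : 0 ≤ τ) (hS : 0 ≤ S)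
    (he : e ^ 2 ≤ τ * S) (hN : N ^ 2 ≤ S) (h : S ≤ g * (x * (e * a) + N * b)) :
    S ≤ 2 * g ^ 2 * (x ^ 2 * τ + 1) * (a ^ 2 + b ^ 2) := by
  have i1 : S ^ 2 ≤ (g * (x * (e * a) + N * b)) ^ 2 := pow_le_pow_left₀ hS h 2
  have i2 : (x * (e * a) + N * b) ^ 2 ≤ 2 * (x ^ 2 * (e ^ 2 * a ^ 2) + N ^ 2 * b ^ 2) := by
    linarith [sq_nonneg (x * (e * a) - N * b)]
  have ha : a ^ 2 ≤ a ^ 2 + b ^ 2 := le_add_of_nonneg_right (sq_nonneg b)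
  have hb : b ^ 2 ≤ a ^ 2 + b ^ 2 := le_add_of_nonneg_left (sq_nonneg a)
  have i3 : e ^ 2 * a ^ 2 ≤ τ * S * (a ^ 2 + b ^ 2) :=
    mul_le_mul he ha (sq_nonneg _) (mul_nonneg hτ hS)
  have i4 : N ^ 2 * b ^ 2 ≤ S * (a ^ 2 + b ^ 2) := mul_le_mul hN hb (sq_nonneg _) hS
  have i5 := mul_le_mul_of_nonneg_left i3 (sq_nonneg x)
  have i6 : S * S ≤ S * (2 * g ^ 2 * (x ^ 2 * τ + 1) * (a ^ 2 + b ^ 2)) :=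
    calc S * S ≤ g ^ 2 * (x * (e * a) + N * b) ^ 2 := by rw [← mul_pow, ← sq]; exact i1
      _ ≤ g ^ 2 * (2 * (x ^ 2 * (τ * S * (a ^ 2 + b ^ 2)) + S * (a ^ 2 + b ^ 2))) :=
        mul_le_mul_of_nonneg_left (by linarith) (sq_nonneg g)
      _ = _ := by ring
  rcases hS.eq_or_lt with h | h
  · rw [← h]; positivity
  · exact le_of_mul_le_mul_left i6 h

/-- The auxiliary field `r` of `V.exists_of_inner_curl`, for `g = γ Z_x`, is controlled by the trace
and the `L²` norm of `Z`. -/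
theorem V.exists_norm_sq_le : ∃ C : ℝ, 0 ≤ C ∧ ∀ Z n r : H1 p, H1.eval p.left Z = 0 →
    H1.eval p.left n = 0 → H1.eval p.right n = 0 →
    H1.deriv n = (p.γ : ℂ) • H1.deriv Z + H1.toX r → H1.deriv r = (p.ξ : ℂ)⁻¹ • H1.toX n →
    ‖H1.toX r‖ ^ 2 ≤ C * (‖H1.eval p.right Z‖ ^ 2 + ‖H1.toX Z‖ ^ 2) := by
  have hξ := p.ξ_pos
  have hL := p.L_pos
  -- `τ` is the constant of the trace inequality for `r` in terms of `‖n‖² + ξ ‖r‖²`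
  set τ : ℝ := p.ξ⁻¹ * (1 + p.ξ⁻¹ + p.L⁻¹) with hτ
  have hτ0 : 0 ≤ τ := by positivity
  refine ⟨p.ξ⁻¹ * (2 * p.γ ^ 2 * (p.ξ ^ 2 * τ + 1)), by positivity,
    fun Z n r hZ h0 h1 h2 h3 => ?_⟩
  have he := V.norm_sq_add_eq h0 h1 h2 h3
  set N := ‖H1.toX n‖
  set R := ‖H1.toX r‖
  set a := ‖H1.eval p.right Z‖
  set b := ‖H1.toX Z‖
  have hN : 0 ≤ N := norm_nonneg _
  have hR : 0 ≤ R := norm_nonneg _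
  have ha : 0 ≤ a := norm_nonneg _
  have hb : 0 ≤ b := norm_nonneg _
  set S := N ^ 2 + p.ξ * R ^ 2 with hS
  have hrx : ‖H1.deriv r‖ = p.ξ⁻¹ * N := by
    rw [h3, norm_smul, norm_inv, Complex.norm_real, Real.norm_of_nonneg hξ.le]
  have htr := H1.norm_eval_right_sq_le r
  rw [hrx] at htr
  set e := ‖H1.eval p.right r‖
  have he0 : 0 ≤ e := norm_nonneg _
  have htr' : e ^ 2 ≤ τ * S := by
    have i1 : p.L * e ^ 2 ≤ p.L * (p.ξ⁻¹ * (R ^ 2 + N ^ 2) + p.L⁻¹ * R ^ 2) := by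
      have : p.L * (p.ξ⁻¹ * (R ^ 2 + N ^ 2) + p.L⁻¹ * R ^ 2) =
          p.L * p.ξ⁻¹ * (R ^ 2 + N ^ 2) + R ^ 2 := by field_simp
      rw [this]
      have h5 : 0 < p.L * p.ξ⁻¹ := by positivity
      nlinarith [mul_nonneg h5.le (sq_nonneg (R - N))]
    have i2 := le_of_mul_le_mul_left i1 hL
    have i3 : τ * S = p.ξ⁻¹ * N ^ 2 + (p.ξ⁻¹ + p.L⁻¹) * (p.ξ⁻¹ * N ^ 2) + R ^ 2 +
        (p.ξ⁻¹ + p.L⁻¹) * R ^ 2 := by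
      rw [hτ, hS]; field_simp; ring
    have i4 : 0 ≤ (p.ξ⁻¹ + p.L⁻¹) * (p.ξ⁻¹ * N ^ 2) := by positivity
    rw [i3]
    nlinarith [sq_nonneg R]
  have hip := H1.integration_by_parts r Z
  rw [hZ, mul_zero, sub_zero, h3, inner_smul_left, map_inv₀, Complex.conj_ofReal] at hip
  have hb1 : ‖⟪H1.toX r, H1.deriv Z⟫_ℂ‖ ≤ e * a + p.ξ⁻¹ * (N * b) := by
    have : ⟪H1.toX r, H1.deriv Z⟫_ℂ = conj (H1.eval p.right r) * H1.eval p.right Z -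
        (p.ξ : ℂ)⁻¹ * ⟪H1.toX n, H1.toX Z⟫_ℂ := by linear_combination hip
    rw [this]
    refine (norm_sub_le _ _).trans ?_
    rw [norm_mul, RCLike.norm_conj, norm_mul, norm_inv, Complex.norm_real,
      Real.norm_of_nonneg hξ.le]
    have := norm_inner_le_norm (𝕜 := ℂ) (H1.toX n) (H1.toX Z)
    gcongr
  have hb2 : S ≤ |p.γ| * (p.ξ * (e * a) + N * b) := by
    rw [he, inner_smul_right, Complex.re_ofReal_mul]
    have h6 := (Complex.abs_re_le_norm _).trans hb1
    have h7 : -(p.ξ * (p.γ * (⟪H1.toX r, H1.deriv Z⟫_ℂ).re)) ≤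
        |p.γ| * (p.ξ * |(⟪H1.toX r, H1.deriv Z⟫_ℂ).re|) := by
      refine (neg_le_abs _).trans ?_
      rw [abs_mul, abs_mul, abs_of_pos hξ]
      exact le_of_eq (by ring)
    refine h7.trans (mul_le_mul_of_nonneg_left ?_ (abs_nonneg _))
    calc _ ≤ p.ξ * (e * a + p.ξ⁻¹ * (N * b)) := mul_le_mul_of_nonneg_left h6 hξ.le
      _ = _ := by field_simp
  have hS0 : 0 ≤ S := by positivity
  have hfin := le_of_le_mul_add hτ0 hS0 htr' (by nlinarith [mul_nonneg hξ.le (sq_nonneg R)]) hb2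
  rw [sq_abs] at hfin
  have hR2 : p.ξ * R ^ 2 ≤ S := by linarith [sq_nonneg N]
  rw [mul_assoc, ← div_eq_inv_mul, le_div_iff₀ hξ, mul_comm]
  exact hR2.trans hfin

/-- The magnetic equation tested against `x (y₄ - (y₅)_x)`. -/
theorem IsWeakSolution.exists_wre_curl : ∃ C : ℝ, 0 ≤ C ∧ ∀ (y z : V p) (k : H p),
    IsWeakSolution y z k → ∃ r : X p,
      ‖r‖ ^ 2 ≤ C * (‖H1.eval p.right (V.y₂ z)‖ ^ 2 + ‖H1.toX (V.y₂ z)‖ ^ 2) ∧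
      -(p.μ / 2 * ‖V.curl y‖ ^ 2) - wre r (V.curl y) ≤
        p.ε₃ * wre (H.z₅ k) (V.curl y) + p.γ * wre (H1.deriv (V.y₂ z)) (V.curl y) := by
  obtain ⟨C, hC0, hC⟩ := V.exists_norm_sq_le (p := p)
  refine ⟨C, hC0, fun y z k h => ?_⟩
  obtain ⟨n, r, h1, h2, h3, h4, h5⟩ := V.exists_of_inner_curl h.inner_curl
  rw [← h1] at h5
  refine ⟨H1.toX r, hC _ n r (V.spec z).2.1 h2 h3 h4 h5, ?_⟩
  have hμ : (p.μ : ℂ) ≠ 0 := by exact_mod_cast p.μ_pos.ne'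
  -- the magnetic strain `y₄ - (y₅)_x` is of class `H¹`
  let c : H1 p := (p.μ : ℂ)⁻¹ • (n + (p.ε₃ : ℂ) • H1.tail (-H.z₅ k))
  have hc : H1.toX c = V.curl y := by
    simp only [c, map_smul, map_add]
    rw [inv_smul_eq_iff₀ hμ, h1, ← H1.tailX_apply, ← H.smul_z₄, smul_smul, ← Complex.ofReal_mul,
      mul_comm p.ε₃, sub_add_cancel]
  have hd : (p.μ : ℂ) • H1.deriv c =
      (p.γ : ℂ) • H1.deriv (V.y₂ z) + H1.toX r + (p.ε₃ : ℂ) • H.z₅ k := by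
    simp only [c, map_smul, map_add]
    rw [smul_inv_smul₀ hμ, h4, H1.deriv_tail, neg_neg]
  have h6 := congrArg (fun f => wre f (V.curl y)) hd
  simp only [wre_add_left, wre_smul_left] at h6
  have h7 := H1.two_wre_deriv c
  rw [hc, wre_comm] at h7
  have h8 : 0 ≤ p.μ * (p.L * ‖H1.eval p.right c‖ ^ 2) := by
    have := p.μ_pos; have := p.L_pos; positivity
  linear_combination (1 / 2) * h8 + h6 - (p.μ / 2) * h7

end RaoNakra

/-! ### The multiplier inequality -/

namespace RaoNakra

variable {p : BeamParams}

/-- The sesquilinear form behind the multiplier `x ∂ₓ`: the velocity `z` and the strain `(y₂)_x` of one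
state against the strains of another state `w`. -/
noncomputable def multiplierForm (y : V p) (z : H p) (w : V p) : ℝ :=
  (p.ρ₁ * p.h₁) * wre (H.z₁ z) (H1.deriv (V.y₁ w)) +
  (p.ρ₃ * p.h₃) * wre (H.z₂ z) (H1.deriv (V.y₂ w)) +
  wre ((p.K₁ : ℂ) • H1.deriv (H.z₃ z) + (p.m : ℂ) • H1.tailX (H1.toX (H.z₃ z)))
    (H2.dxx (V.y₃ w)) -
  (p.ε₃ * p.h₃) * wre (H.z₅ z) (V.curl w) +
  (p.γ * p.h₃) * wre (H1.deriv (V.y₂ y)) (V.curl w)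

theorem norm_tailX_le (f : X p) : ‖H1.tailX f‖ ≤ 2 * p.L * ‖f‖ := by
  have := H1.norm_toX_le_of_right (H1.eval_right_tail f)
  rwa [H1.deriv_tail, norm_neg] at this

/-- The static multiplier inequality. All boundary terms at `x = L` that are produced by the weight `x`
have the same sign, and the terms that couple the derivatives of `z₂` and `z₅` with the strains
cancel. -/
theorem exists_multiplierForm_ge : ∃ C : ℝ, 0 ≤ C ∧ ∀ (M : ℝ) (y z : V p) (k : H p),
    IsWeakSolution y z k → ‖H1.deriv (V.y₁ y)‖ ≤ M → ‖H1.deriv (V.y₂ y)‖ ≤ M →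
    ‖H2.dxx (V.y₃ y)‖ ≤ M → ‖V.shear y‖ ≤ M → ‖V.curl y‖ ≤ M → ‖H1.toX (V.y₁ z)‖ ≤ M →
    ‖H1.toX (V.y₂ z)‖ ≤ M → ‖H1.toX (H2.toH1 (V.y₃ z))‖ ≤ M → ‖H1.toX (H2.dx (V.y₃ z))‖ ≤ M →
    ‖H1.toX (V.y₄ z)‖ ≤ M → ‖H1.toX (V.y₅ z)‖ ≤ M →
    p.L / 2 * ((p.ρ₁ * p.h₁) * ‖H1.eval p.right (V.y₁ z)‖ ^ 2 +
      (p.ρ₃ * p.h₃) / 2 * ‖H1.eval p.right (V.y₂ z)‖ ^ 2 +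
      p.K₁ * ‖H1.eval p.right (H2.dx (V.y₃ z))‖ ^ 2) ≤
    multiplierForm y (ι z) z + multiplierForm z (-k) y + C * M ^ 2 := by
  obtain ⟨Cr, hCr, hr⟩ := IsWeakSolution.exists_wre_curl (p := p)
  have c1 := p.ρ₁_pos; have c2 := p.ρ₃_pos; have c3 := p.h₁_pos; have c4 := p.h₂_pos
  have c5 := p.h₃_pos; have c6 := p.ε₃_pos; have c7 := p.G₂_pos; have c8 := p.μ_pos
  have c9 := p.K₂_pos; have c10 := p.ξ_pos; have c11 := V.H_pos p; have c12 := p.L_pos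
  have c13 := p.α₁_pos; have c14 := p.α₃_pos; have c15 := p.K₁_pos; have c16 := p.m_pos
  -- `δ` is small enough for the trace of `z₂` in the bound of `r` to be absorbed
  let δ : ℝ := p.ρ₃ / (4 * (Cr + 1))
  have hδ : 0 < δ := by positivity
  have hδC : δ * Cr ≤ p.ρ₃ / 4 := by
    simp only [δ]
    rw [div_mul_eq_mul_div, div_le_div_iff₀ (by positivity) (by norm_num)]
    nlinarith
  have ha : 0 < p.α₃ * p.h₃ := by positivity
  have hb : 0 ≤ p.γ ^ 2 * p.h₃ / p.ε₃ := by positivity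
  let C₂ : ℝ := p.α₃ * p.h₃ / 2 + p.γ ^ 2 * p.h₃ / p.ε₃ * (p.L * (√p.ξ)⁻¹)
  have hC₂ : 0 ≤ C₂ := by positivity
  let C : ℝ := p.ρ₁ * p.h₁ / 2 + p.α₁ * p.h₁ / 2 + p.G₂ / p.h₂ * p.L + C₂ +
    p.G₂ / p.h₂ * p.L + p.K₁ / 2 + p.m * (p.L + 2 * p.L) + p.K₂ / 2 +
    p.G₂ / p.h₂ * p.H * p.L + p.ε₃ * p.h₃ * (p.L + 1 / 2) + |p.γ * p.h₃| * p.L + p.h₃ * p.μ / 2 +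
    p.ρ₃ * p.h₃ / 2 + p.h₃ * p.L * (p.ρ₃ / 4 + (4 * δ)⁻¹)
  refine ⟨C, by positivity, fun M y z k h m1 m2 m3 m4 m5 m6 m7 m8 m9 m10 m11 => ?_⟩
  have hM : 0 ≤ M := (norm_nonneg _).trans m1
  have sq : ∀ {f : X p}, ‖f‖ ≤ M → ‖f‖ ^ 2 ≤ M ^ 2 := fun hf => pow_le_pow_left₀ (norm_nonneg _) hf 2
  have wb : ∀ {f g : X p}, ‖f‖ ≤ M → ‖g‖ ≤ M → |wre f g| ≤ p.L * M ^ 2 := fun hf hg => by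
    rw [_root_.sq]; exact abs_wre_le_of_le hf hg
  -- the layer `1`
  have t1 := H1.two_wre_deriv (V.y₁ z)
  have t2 := H1.two_wre_of_eq_tailX (by positivity) h.deriv_y₁
  rw [wre_add_left, wre_smul_left, wre_smul_left] at t2
  -- the layer `3`
  have t3 := H1.two_wre_deriv (V.y₂ z)
  have t4 := H1.wre_le_of_eq_tailX ha hb h.deriv_y₂
  rw [wre_sub_left, wre_smul_left, wre_smul_left] at t4
  -- the bending equation
  have t5 := H1.two_wre_deriv (H2.dx (V.y₃ z))
  have t6 := H1.wre_tailX_deriv (H1.toX (H2.toH1 (V.y₃ z))) (H2.dx (V.y₃ z))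
  have t7 := H1.two_wre_of_eq_tailX c9 h.dxx_y₃
  rw [wre_sub_left, wre_smul_left] at t7
  have t8 : (⟪H1.tailX (H1.toX (H2.toH1 (V.y₃ z))), H1.toX (H2.dx (V.y₃ z))⟫_ℂ).re ≤
      2 * p.L * M ^ 2 := by
    refine (Complex.re_le_norm _).trans ((norm_inner_le_norm _ _).trans ?_)
    calc _ ≤ (2 * p.L * M) * M := mul_le_mul ((norm_tailX_le _).trans (by gcongr)) m9
          (norm_nonneg _) (by positivity)
      _ = _ := by ring
  -- the magnetic equation
  have t9 := H1.two_wre_deriv (V.y₅ z)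
  obtain ⟨r, hr1, hr2⟩ := hr y z k h
  have t10 : wre r (V.curl y) ≤ p.L * (δ * ‖r‖ ^ 2 + (4 * δ)⁻¹ * M ^ 2) := by
    refine (le_abs_self _).trans ((abs_wre_le_of_le (le_refl ‖r‖) m5).trans ?_)
    refine mul_le_mul_of_nonneg_left ?_ c12.le
    have e : δ * ‖r‖ ^ 2 + (4 * δ)⁻¹ * M ^ 2 - ‖r‖ * M = (4 * δ)⁻¹ * (2 * δ * ‖r‖ - M) ^ 2 := by
      field_simp; ring
    have e' : 0 ≤ (4 * δ)⁻¹ * (2 * δ * ‖r‖ - M) ^ 2 := by positivity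
    linarith
  have t11 : δ * ‖r‖ ^ 2 ≤ p.ρ₃ / 4 * (‖H1.eval p.right (V.y₂ z)‖ ^ 2 + M ^ 2) := by
    calc δ * ‖r‖ ^ 2 ≤ δ * (Cr * (‖H1.eval p.right (V.y₂ z)‖ ^ 2 + M ^ 2)) := by
          refine mul_le_mul_of_nonneg_left (hr1.trans ?_) hδ.le
          have := sq m7
          gcongr
      _ = δ * Cr * (‖H1.eval p.right (V.y₂ z)‖ ^ 2 + M ^ 2) := by ring
      _ ≤ _ := mul_le_mul_of_nonneg_right hδC (by positivity)
  have t12 : wre r (V.curl y) ≤ p.L * (p.ρ₃ / 4 * (‖H1.eval p.right (V.y₂ z)‖ ^ 2 + M ^ 2) +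
      (4 * δ)⁻¹ * M ^ 2) := t10.trans (mul_le_mul_of_nonneg_left (by linarith) c12.le)
  have t13 := mul_le_mul_of_nonneg_left t12 c5.le
  have t14 := mul_le_mul_of_nonneg_left hr2 c5.le
  -- the terms without derivatives of the velocity
  have b1 : p.ρ₁ * p.h₁ * ‖H1.toX (V.y₁ z)‖ ^ 2 ≤ p.ρ₁ * p.h₁ * M ^ 2 := by
    have := sq m6; gcongr
  have b2 : p.ρ₃ * p.h₃ * ‖H1.toX (V.y₂ z)‖ ^ 2 ≤ p.ρ₃ * p.h₃ * M ^ 2 := by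
    have := sq m7; gcongr
  have b3 : p.α₁ * p.h₁ * ‖H1.deriv (V.y₁ y)‖ ^ 2 ≤ p.α₁ * p.h₁ * M ^ 2 := by
    have := sq m1; gcongr
  have b4 : C₂ * ‖H1.deriv (V.y₂ y)‖ ^ 2 ≤ C₂ * M ^ 2 := by
    have := sq m2; gcongr
  have b5 : p.K₁ * ‖H1.toX (H2.dx (V.y₃ z))‖ ^ 2 ≤ p.K₁ * M ^ 2 := by
    have := sq m9; gcongr
  have b6 : p.K₂ * ‖H2.dxx (V.y₃ y)‖ ^ 2 ≤ p.K₂ * M ^ 2 := by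
    have := sq m3; gcongr
  have b7 : p.h₃ * (p.μ / 2 * ‖V.curl y‖ ^ 2) ≤ p.h₃ * (p.μ / 2 * M ^ 2) := by
    have := sq m5; gcongr
  have b8 : p.ε₃ * p.h₃ * ‖H1.toX (V.y₅ z)‖ ^ 2 ≤ p.ε₃ * p.h₃ * M ^ 2 := by
    have := sq m11; gcongr
  have hG : 0 ≤ p.G₂ / p.h₂ := by positivity
  have d1 := mul_le_mul_of_nonneg_left (neg_le_of_abs_le (wb m4 m1)) hG
  have d2 := mul_le_mul_of_nonneg_left (le_of_abs_le (wb m4 m2)) hG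
  have d3 := mul_le_mul_of_nonneg_left (le_of_abs_le (wb m4 m3)) (mul_nonneg hG c11.le)
  have d4 := mul_le_mul_of_nonneg_left (neg_le_of_abs_le (wb m8 m9)) c16.le
  have d5 := mul_le_mul_of_nonneg_left (le_of_abs_le (wb m11 m10)) (mul_pos c6 c5).le
  have d6 : -(|p.γ * p.h₃| * (p.L * M ^ 2)) ≤
      p.γ * p.h₃ * wre (H1.deriv (V.y₂ y)) (H1.toX (V.y₄ z)) := by
    refine neg_le_of_abs_le ?_
    rw [abs_mul]
    exact mul_le_mul_of_nonneg_left (wb m2 m10) (abs_nonneg _)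
  have d7 := mul_le_mul_of_nonneg_left t8 c16.le
  have s8 : 0 ≤ p.ε₃ * p.h₃ * (p.L * ‖H1.eval p.right (V.y₅ z)‖ ^ 2) := by positivity
  simp only [multiplierForm, z₁_ι, z₂_ι, z₃_ι, z₅_ι, H2.deriv_toH1, map_neg, smul_neg,
    ← neg_add, wre_neg_left, V.curl_apply z, wre_sub_right]
  rw [wre_add_left (_ • H1.toX (H2.dx (V.y₃ z))), wre_smul_left, wre_smul_left]
  change wre _ (H2.dxx (V.y₃ z)) = _ at t6
  change 2 * wre _ (H2.dxx (V.y₃ z)) = _ at t5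
  rw [t6]
  rw [wre_comm (H1.deriv (V.y₅ z))] at t4
  simp only [C]
  linear_combination -(p.ρ₁ * p.h₁ / 2) * t1 + b1 / 2 + t2 / 2 + b3 / 2 + d1 -
    (p.ρ₃ * p.h₃ / 2) * t3 + b2 / 2 + t4 + d2 + b4 - (p.K₁ / 2) * t5 + b5 / 2 + d4 + d7 + t7 / 2 +
    d3 + b6 / 2 - (p.ε₃ * p.h₃ / 2) * t9 + s8 / 2 + b8 / 2 + d5 + t14 + b7 + t13 + d6

end RaoNakra

/-! ### The multiplier of the beam -/

namespace RaoNakra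

variable {p : BeamParams}

section Form

variable {E : Type*} [NormedAddCommGroup E] [InnerProductSpace ℂ E] [CompleteSpace E]

/-- The operator of the form `(x, w) ↦ ⟪P x, x R w⟫`. -/
noncomputable def sandwich (P R : E →L[ℂ] X p) : E →L[ℂ] E := P.adjoint ∘L (mulX ∘L R)

theorem re_inner_sandwich (P R : E →L[ℂ] X p) (c : ℝ) (x w : E) :
    (⟪x, ((c : ℂ) • sandwich P R) w⟫_ℂ).re = c * wre (P x) (R w) := by
  rw [smul_apply, inner_smul_right, Complex.re_ofReal_mul, sandwich,
    ContinuousLinearMap.comp_apply, ContinuousLinearMap.adjoint_inner_right]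
  rfl

omit [CompleteSpace E] in
/-- The quadratic form of a bounded operator satisfies the chain rule. -/
theorem hasDerivAt_re_inner (Q : E →L[ℂ] E) {f : ℝ → E} {f' : E} {t : ℝ} (h : HasDerivAt f f' t) :
    HasDerivAt (fun s => (⟪f s, Q (f s)⟫_ℂ).re) ((⟪f t, Q f'⟫_ℂ).re + (⟪f', Q (f t)⟫_ℂ).re) t := by
  have h1 := h.inner ℂ ((Q.restrictScalars ℝ).hasFDerivAt.comp_hasDerivAt t h)
  exact Complex.reCLM.hasFDerivAt.comp_hasDerivAt t h1

end Form

namespace EnergySpace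

/-- The projection to the displacement. -/
noncomputable def fstL : EnergySpace p →L[ℂ] V p := WithLp.fstL 2 ℂ (V p) (H p)
/-- The projection to the velocity. -/
noncomputable def sndL : EnergySpace p →L[ℂ] H p := WithLp.sndL 2 ℂ (V p) (H p)

theorem norm_fst_le (φ : EnergySpace p) : ‖φ.fst‖ ≤ ‖φ‖ := by
  have h := WithLp.prod_norm_sq_eq_of_L2 φ
  exact abs_le_of_sq_le_sq' (by nlinarith [sq_nonneg ‖φ.snd‖]) (norm_nonneg _) |>.2

theorem norm_snd_le (φ : EnergySpace p) : ‖φ.snd‖ ≤ ‖φ‖ := by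
  have h := WithLp.prod_norm_sq_eq_of_L2 φ
  exact abs_le_of_sq_le_sq' (by nlinarith [sq_nonneg ‖φ.fst‖]) (norm_nonneg _) |>.2

end EnergySpace

open EnergySpace in
variable (p) in
/-- The bounded operator of `multiplierForm`. -/
noncomputable def opMultiplier : EnergySpace p →L[ℂ] EnergySpace p :=
  ((p.ρ₁ * p.h₁ : ℝ) : ℂ) • sandwich (H.Z₁ ∘L sndL) (V.Dy₁ ∘L fstL) +
  ((p.ρ₃ * p.h₃ : ℝ) : ℂ) • sandwich (H.Z₂ ∘L sndL) (V.Dy₂ ∘L fstL) +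
  ((1 : ℝ) : ℂ) • sandwich ((((p.K₁ : ℂ) • H.DZ₃) + ((p.m : ℂ) • (H1.tailX ∘L H.Z₃))) ∘L sndL)
    (V.DDy₃ ∘L fstL) +
  ((-(p.ε₃ * p.h₃) : ℝ) : ℂ) • sandwich (H.Z₅ ∘L sndL) (V.curlL ∘L fstL) +
  ((p.γ * p.h₃ : ℝ) : ℂ) • sandwich (V.Dy₂ ∘L fstL) (V.curlL ∘L fstL)

theorem re_inner_opMultiplier (φ w : EnergySpace p) :
    (⟪φ, opMultiplier p w⟫_ℂ).re = multiplierForm φ.fst φ.snd w.fst := by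
  simp only [opMultiplier, add_apply, inner_add_right, Complex.add_re, re_inner_sandwich]
  rw [multiplierForm, one_mul, neg_mul, ← sub_eq_add_neg]
  rfl

namespace H1

theorem norm_integral_sq_le (u : H1 p) :
    ‖∫ x in (0 : ℝ)..p.L, fn u x‖ ^ 2 ≤ p.L * ‖toX u‖ ^ 2 := by
  have h1 : ‖toX (one p)‖ ^ 2 = p.L := by
    have := inner_one_one (p := p)
    rw [inner_self_eq_norm_sq_to_K] at this
    simp only [Complex.coe_algebraMap] at this
    exact_mod_cast this
  have h2 := pow_le_pow_left₀ (norm_nonneg _)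
    (norm_inner_le_norm (𝕜 := ℂ) (toX (one p)) (toX u)) 2
  rw [mul_pow, h1] at h2
  rw [integral_fn_eq_inner]
  exact h2

end H1

/-- Apart from three traces at `x = L`, the dual control operator is bounded on the velocities. -/
theorem sum_norm_B₀star_sq_le {M : ℝ} {z : V p} (h1 : ‖H1.toX (V.y₁ z)‖ ≤ M)
    (h2 : ‖H1.toX (V.y₂ z)‖ ≤ M) (h3 : ‖H1.toX (H2.toH1 (V.y₃ z))‖ ≤ M)
    (h4 : ‖H1.toX (H2.dx (V.y₃ z))‖ ≤ M) (h5 : ‖H1.toX (V.y₄ z)‖ ≤ M) :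
    ∑ j, ‖B₀star z j‖ ^ 2 ≤ ‖H1.eval p.right (V.y₁ z)‖ ^ 2 +
      (p.γ / p.ε₃) ^ 2 * ‖H1.eval p.right (V.y₂ z)‖ ^ 2 +
      p.K₂ ^ 2 * ‖H1.eval p.right (H2.dx (V.y₃ z))‖ ^ 2 +
      p.L * (11 + (1 / (p.h₃ * p.ε₃)) ^ 2) * M ^ 2 := by
  have hL := p.L_pos
  have sq : ∀ {f : X p}, ‖f‖ ≤ M → p.L * ‖f‖ ^ 2 ≤ p.L * M ^ 2 := fun hf =>
    mul_le_mul_of_nonneg_left (pow_le_pow_left₀ (norm_nonneg _) hf 2) hL.le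
  have e1 := (H1.norm_integral_sq_le _).trans (sq h1)
  have e2 := (H1.norm_integral_sq_le _).trans (sq h2)
  have e3 := (H1.norm_integral_sq_le _).trans (sq h3)
  have e4 := mul_le_mul_of_nonneg_left ((H1.norm_integral_sq_le _).trans (sq h5))
    (sq_nonneg (1 / (p.h₃ * p.ε₃)))
  have e5 := H1.norm_eval_right_le_of_left (V.spec z).2.2.1
  rw [H2.deriv_toH1] at e5
  have e6 := sq h4
  have s : ∀ a b c d e f g h : ℂ, ∑ j, ‖(![a, b, c, d, e, f, g, h] : Fin 8 → ℂ) j‖ ^ 2 =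
      ‖a‖ ^ 2 + ‖b‖ ^ 2 + ‖c‖ ^ 2 + ‖d‖ ^ 2 + ‖e‖ ^ 2 + ‖f‖ ^ 2 + ‖g‖ ^ 2 + ‖h‖ ^ 2 := by
    intros
    simp [Fin.sum_univ_succ]
    ring
  rw [B₀star, s]
  simp only [norm_mul, norm_neg, Complex.norm_real, mul_pow, Real.norm_eq_abs, sq_abs]
  rw [neg_div, neg_sq]
  linarith

theorem exists_norm_components_le : ∃ C : ℝ, 0 ≤ C ∧ (∀ y : V p, ‖H1.deriv (V.y₁ y)‖ ≤ C * ‖y‖ ∧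
    ‖H1.deriv (V.y₂ y)‖ ≤ C * ‖y‖ ∧ ‖H2.dxx (V.y₃ y)‖ ≤ C * ‖y‖ ∧ ‖V.shear y‖ ≤ C * ‖y‖ ∧
    ‖V.curl y‖ ≤ C * ‖y‖) ∧ ∀ z : V p, ‖H1.toX (V.y₁ z)‖ ≤ C * ‖ι z‖ ∧
    ‖H1.toX (V.y₂ z)‖ ≤ C * ‖ι z‖ ∧ ‖H1.toX (H2.toH1 (V.y₃ z))‖ ≤ C * ‖ι z‖ ∧
    ‖H1.toX (H2.dx (V.y₃ z))‖ ≤ C * ‖ι z‖ ∧ ‖H1.toX (V.y₄ z)‖ ≤ C * ‖ι z‖ ∧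
    ‖H1.toX (V.y₅ z)‖ ≤ C * ‖ι z‖ := by
  have key : ∀ {E : Type} [NormedAddCommGroup E] [NormedSpace ℂ E] (T : E →L[ℂ] X p),
      ∃ c : ℝ, 0 ≤ c ∧ ∀ c', c ≤ c' → ∀ y, ‖T y‖ ≤ c' * ‖y‖ := fun T =>
    ⟨‖T‖, norm_nonneg _, fun c' hc y => T.le_of_opNorm_le hc y⟩
  obtain ⟨v1, v1', h1⟩ := key (V.Dy₁ : V p →L[ℂ] X p)
  obtain ⟨v2, v2', h2⟩ := key (V.Dy₂ : V p →L[ℂ] X p)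
  obtain ⟨v3, v3', h3⟩ := key (V.DDy₃ : V p →L[ℂ] X p)
  obtain ⟨v4, v4', h4⟩ := key (V.shearL : V p →L[ℂ] X p)
  obtain ⟨v5, v5', h5⟩ := key (V.curlL : V p →L[ℂ] X p)
  obtain ⟨w1, w1', g1⟩ := key (H.Z₁ : H p →L[ℂ] X p)
  obtain ⟨w2, w2', g2⟩ := key (H.Z₂ : H p →L[ℂ] X p)
  obtain ⟨w3, w3', g3⟩ := key (H.Z₃ : H p →L[ℂ] X p)
  obtain ⟨w4, w4', g4⟩ := key (H.DZ₃ : H p →L[ℂ] X p)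
  obtain ⟨w5, w5', g5⟩ := key (H.Z₄ : H p →L[ℂ] X p)
  obtain ⟨w6, w6', g6⟩ := key (H.Z₅ : H p →L[ℂ] X p)
  refine ⟨v1 + v2 + v3 + v4 + v5 + w1 + w2 + w3 + w4 + w5 + w6, by linarith, fun y =>
    ⟨h1 _ (by linarith) y, h2 _ (by linarith) y, h3 _ (by linarith) y, h4 _ (by linarith) y,
      h5 _ (by linarith) y⟩, fun z => ⟨g1 _ (by linarith) (ι z), g2 _ (by linarith) (ι z),
      g3 _ (by linarith) (ι z), ?_, g5 _ (by linarith) (ι z), g6 _ (by linarith) (ι z)⟩⟩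
  rw [← H2.deriv_toH1]
  exact g4 _ (by linarith) (ι z)

theorem exists_norm_B₀star_le : ∃ C : ℝ, ∀ (z : V p) (j : Fin 8), ‖B₀star z j‖ ≤ C * ‖z‖ := by
  obtain ⟨C, hC, h1, h2⟩ := exists_norm_components_le (p := p)
  have hL := p.L_pos
  obtain ⟨N, hN, hιN⟩ : ∃ N : ℝ, 0 ≤ N ∧ ∀ z : V p, ‖ι z‖ ≤ N * ‖z‖ :=
    ⟨_, norm_nonneg _, (ιL : V p →L[ℂ] H p).le_opNorm⟩
  set D : ℝ := 8 * p.L * C ^ 2 * (1 + (p.γ / p.ε₃) ^ 2 + p.K₂ ^ 2) +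
    p.L * (11 + (1 / (p.h₃ * p.ε₃)) ^ 2) * (C * N) ^ 2
  have hD : 0 ≤ D := by positivity
  refine ⟨√D, fun z j => ?_⟩
  obtain ⟨a1, a2, a3, a4, a5, -⟩ := h2 z
  have hι : C * ‖ι z‖ ≤ C * N * ‖z‖ := by
    rw [mul_assoc]; exact mul_le_mul_of_nonneg_left (hιN z) hC
  have h3 := sum_norm_B₀star_sq_le (a1.trans hι) (a2.trans hι) (a3.trans hι) (a4.trans hι)
    (a5.trans hι)
  obtain ⟨d1, d2, d3, -, -⟩ := h1 z
  have tr : ∀ {u : H1 p}, H1.eval p.left u = 0 → ‖H1.deriv u‖ ≤ C * ‖z‖ →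
      ‖H1.eval p.right u‖ ^ 2 ≤ 8 * p.L * (C * ‖z‖) ^ 2 := fun hu hd =>
    (H1.norm_eval_right_le_of_left hu).trans
      (mul_le_mul_of_nonneg_left (pow_le_pow_left₀ (norm_nonneg _) hd 2) (by positivity))
  have e1 := tr (V.spec z).1 d1
  have e2 := mul_le_mul_of_nonneg_left (tr (V.spec z).2.1 d2) (sq_nonneg (p.γ / p.ε₃))
  have e3 := mul_le_mul_of_nonneg_left (tr (V.spec z).2.2.2.1 d3) (sq_nonneg p.K₂)
  have h4 := Finset.single_le_sum (f := fun j => ‖B₀star z j‖ ^ 2) (fun j _ => sq_nonneg _)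
    (Finset.mem_univ j)
  refine abs_le_of_sq_le_sq' ?_ (by positivity) |>.2
  rw [mul_pow, Real.sq_sqrt hD]
  simp only [D]
  linarith

/-- The components of `B₀*` as bounded functionals on `V`. -/
noncomputable def B₀starL (j : Fin 8) : V p →L[ℂ] ℂ :=
  LinearMap.mkContinuousOfExistsBound
    { toFun := fun z => B₀star z j
      map_add' := fun z w => by
        fin_cases j <;> simp [B₀star, H1.integral_fn_eq_inner, inner_add_right] <;> ring
      map_smul' := fun c z => by
        fin_cases j <;> simp [B₀star, H1.integral_fn_eq_inner, inner_smul_right] <;> ring }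
    (let ⟨C, hC⟩ := exists_norm_B₀star_le (p := p); ⟨C, fun z => hC z j⟩)

theorem exists_isResolventOfInput (j : Fin 8) : ∃ b : EnergySpace p,
    IsResolventOfInput (Pi.single j 1) b := by
  obtain ⟨r, hr⟩ : ∃ r : V p, ∀ ψ, ⟪r, ψ⟫_ℂ = B₀star ψ j :=
    ⟨(InnerProductSpace.toDual ℂ (V p)).symm (B₀starL j), fun ψ =>
      InnerProductSpace.toDual_symm_apply⟩
  obtain ⟨y, hy⟩ := exists_stationary 1 r
  refine ⟨WithLp.toLp 2 (y, ι y), y, y, rfl, sub_self y, fun ψ => ?_⟩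
  have h := hy ψ
  rw [← inner_conj_symm ψ r, hr] at h
  simp only [Complex.ofReal_one, one_pow, one_mul] at h
  rw [B₀, Finset.sum_eq_single j (fun i _ hi => by rw [Pi.single_eq_of_ne hi, zero_mul])
    (fun hj => absurd (Finset.mem_univ j) hj), Pi.single_eq_same, one_mul, ← h, add_assoc]

/-- The observation through `b j` is the dual control operator, by skew-symmetry of `D`. -/
theorem IsResolventOfInput.inner_sub {j : Fin 8} {b : EnergySpace p}
    (hb : IsResolventOfInput (Pi.single j 1) b) {y z : V p} {g : EnergySpace p}
    (hg : g.fst = -z) (h : IsWeakSolution y z g.snd) :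
    ⟪b, WithLp.toLp 2 (y, ι z) - g⟫_ℂ = B₀star z j := by
  obtain ⟨u, v, rfl, huv, hu⟩ := hb
  obtain rfl := sub_eq_zero.mp huv
  have h1 := congrArg (starRingEnd ℂ) (hu z)
  rw [B₀, Finset.sum_eq_single j (fun i _ hi => by rw [Pi.single_eq_of_ne hi, zero_mul])
    (fun hj => absurd (Finset.mem_univ j) hj), Pi.single_eq_same, one_mul, Complex.conj_conj,
    map_add, map_add, inner_conj_symm, inner_conj_symm, conj_formD] at h1
  have h2 := h u
  rw [inner_sub_right, energy_inner, energy_inner, hg, ← h1]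
  change ⟪u, y⟫_ℂ + ⟪ι u, ι z⟫_ℂ - (⟪u, -z⟫_ℂ + ⟪ι u, g.snd⟫_ℂ) = _
  rw [inner_neg_right]
  linear_combination h2

/-- The control operator admits a multiplier. -/
theorem exists_isMultiplier {b : Fin 8 → EnergySpace p}
    (hb : ∀ j, IsResolventOfInput (Pi.single j 1) (b j)) :
    ∃ (K : ℝ) (q : EnergySpace p → ℝ) (q' : EnergySpace p → EnergySpace p → ℝ), 0 ≤ K ∧
      IsMultiplier (graphA p) b K q q' := by
  obtain ⟨C, hC, hC1⟩ := exists_multiplierForm_ge (p := p)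
  obtain ⟨N, hN, hN1, hN2⟩ := exists_norm_components_le (p := p)
  have c1 := p.ρ₁_pos; have c2 := p.ρ₃_pos; have c3 := p.h₁_pos; have c5 := p.h₃_pos
  have c12 := p.L_pos; have c15 := p.K₁_pos
  -- `A` times the multiplier inequality dominates each of the three traces
  let A₁ : ℝ := (p.L / 2 * (p.ρ₁ * p.h₁))⁻¹
  let A₂ : ℝ := (p.γ / p.ε₃) ^ 2 * (p.L / 2 * (p.ρ₃ * p.h₃ / 2))⁻¹
  let A₃ : ℝ := p.K₂ ^ 2 * (p.L / 2 * p.K₁)⁻¹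
  let A : ℝ := A₁ + A₂ + A₃
  have hA₁ : 0 ≤ A₁ := by positivity
  have hA₂ : 0 ≤ A₂ := by positivity
  have hA₃ : 0 ≤ A₃ := by positivity
  have hA : 0 ≤ A := by positivity
  let K₀ : ℝ := (A * C + p.L * (11 + (1 / (p.h₃ * p.ε₃)) ^ 2)) * N ^ 2
  have hK₀ : 0 ≤ K₀ := by positivity
  let Q := opMultiplier p
  refine ⟨K₀ + A * ‖Q‖, fun φ => A * (⟪φ, Q φ⟫_ℂ).re,
    fun φ v => A * ((⟪φ, Q v⟫_ℂ).re + (⟪v, Q φ⟫_ℂ).re), by positivity, ?_, ?_, ?_⟩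
  · intro f f' t hf
    exact (hasDerivAt_re_inner Q hf).const_mul A
  · intro φ
    rw [abs_mul, abs_of_nonneg hA, add_mul]
    have h1 := (Complex.abs_re_le_norm _).trans (norm_inner_le_norm (𝕜 := ℂ) φ (Q φ))
    have h2 := mul_le_mul_of_nonneg_left (Q.le_opNorm φ) (norm_nonneg φ)
    have h3 := mul_le_mul_of_nonneg_left (h1.trans h2) hA
    have h4 : 0 ≤ K₀ * ‖φ‖ ^ 2 := by positivity
    linarith
  · rintro φ g ⟨y, z, rfl, hg, h⟩
    set φ : EnergySpace p := WithLp.toLp 2 (y, ι z) with hφ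
    have hy : N * ‖y‖ ≤ N * ‖φ‖ := mul_le_mul_of_nonneg_left (EnergySpace.norm_fst_le φ) hN
    have hz : N * ‖ι z‖ ≤ N * ‖φ‖ := mul_le_mul_of_nonneg_left (EnergySpace.norm_snd_le φ) hN
    obtain ⟨a1, a2, a3, a4, a5⟩ := hN1 y
    obtain ⟨d1, d2, d3, d4, d5, d6⟩ := hN2 z
    have k1 := hC1 _ y z g.snd h (a1.trans hy) (a2.trans hy) (a3.trans hy) (a4.trans hy)
      (a5.trans hy) (d1.trans hz) (d2.trans hz) (d3.trans hz) (d4.trans hz) (d5.trans hz)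
      (d6.trans hz)
    have k2 := sum_norm_B₀star_sq_le (d1.trans hz) (d2.trans hz) (d3.trans hz) (d4.trans hz)
      (d5.trans hz)
    have k3 : ∀ j, ⟪b j, φ - g⟫_ℂ = B₀star z j := fun j => (hb j).inner_sub hg h
    simp only [k3]
    have k4 : (⟪φ, Q (-g)⟫_ℂ).re + (⟪-g, Q φ⟫_ℂ).re =
        multiplierForm y (ι z) z + multiplierForm z (-g.snd) y := by
      rw [re_inner_opMultiplier, re_inner_opMultiplier, WithLp.neg_fst, WithLp.neg_snd, hg, neg_neg]
      rfl
    rw [k4]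
    set e₁ := ‖H1.eval p.right (V.y₁ z)‖ ^ 2
    set e₂ := ‖H1.eval p.right (V.y₂ z)‖ ^ 2
    set e₃ := ‖H1.eval p.right (H2.dx (V.y₃ z))‖ ^ 2
    set S := p.L / 2 * ((p.ρ₁ * p.h₁) * e₁ + (p.ρ₃ * p.h₃) / 2 * e₂ + p.K₁ * e₃) with hS
    have he₁ : 0 ≤ e₁ := sq_nonneg _
    have he₂ : 0 ≤ e₂ := sq_nonneg _
    have he₃ : 0 ≤ e₃ := sq_nonneg _
    have s1 : e₁ ≤ A₁ * S := by
      have : e₁ = A₁ * (p.L / 2 * ((p.ρ₁ * p.h₁) * e₁)) := by simp only [A₁]; field_simp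
      rw [this, hS]
      gcongr
      rw [add_assoc]
      exact le_add_of_nonneg_right (by positivity)
    have s2 : (p.γ / p.ε₃) ^ 2 * e₂ ≤ A₂ * S := by
      have : (p.γ / p.ε₃) ^ 2 * e₂ = A₂ * (p.L / 2 * ((p.ρ₃ * p.h₃) / 2 * e₂)) := by
        simp only [A₂]; field_simp
      rw [this, hS]
      gcongr
      have : 0 ≤ p.ρ₁ * p.h₁ * e₁ := by positivity
      have : 0 ≤ p.K₁ * e₃ := by positivity
      linarith
    have s3 : p.K₂ ^ 2 * e₃ ≤ A₃ * S := by
      have : p.K₂ ^ 2 * e₃ = A₃ * (p.L / 2 * (p.K₁ * e₃)) := by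
        simp only [A₃]; field_simp
      rw [this, hS]
      gcongr
      exact le_add_of_nonneg_left (by positivity)
    have k5 := mul_le_mul_of_nonneg_left k1 hA
    have k6 : 0 ≤ A * ‖Q‖ * ‖φ‖ ^ 2 := by positivity
    simp only [A, K₀] at k5 k6 ⊢
    linarith

end RaoNakra

/-! ### Solutions of the controlled beam -/

namespace RaoNakra

variable {p : BeamParams}

/-- The extension of a control by zero. -/
noncomputable def Control.extend {T : ℝ} (F : Control T) (j : Fin 8) : ℝ → ℂ :=
  (Ioc 0 T).indicator (F j)

namespace Control

variable {T : ℝ} (F : Control T)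

theorem memLp_extend (j : Fin 8) : MemLp (F.extend j) 2 :=
  (memLp_indicator_iff_restrict measurableSet_Ioc).mpr (Lp.memLp (F j))

theorem extend_of_mem (j : Fin 8) {s : ℝ} (hs : s ∈ Ioc 0 T) : F.extend j s = F j s :=
  indicator_of_mem hs _

theorem integral_norm_sq_extend (hT : 0 ≤ T) :
    ∫ s in (0 : ℝ)..T, ∑ j, ‖F.extend j s‖ ^ 2 = ∑ j, ‖F j‖ ^ 2 := by
  rw [intervalIntegral.integral_finsetSum fun j _ =>
    intervalIntegrable_norm_sq (F.memLp_extend j) 0 T]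
  refine Finset.sum_congr rfl fun j _ => ?_
  rw [norm_sq_eq_re_inner (𝕜 := ℂ) (F j), L2.inner_def, intervalIntegral.integral_of_le hT]
  simp only [inner_self_eq_norm_sq_to_K, RCLike.re_eq_complex_re, Complex.coe_algebraMap]
  simp only [← Complex.ofReal_pow]
  rw [integral_complex_ofReal, Complex.ofReal_re]
  exact setIntegral_congr_fun measurableSet_Ioc fun s hs => by
    simp only [F.extend_of_mem j hs]

theorem integral_B₀ {t : ℝ} (ht : t ∈ Icc 0 T) (ψ : V p) :
    ∫ s in (0 : ℝ)..t, B₀ (fun j => F j s) ψ = B₀ (fun j => ∫ s in (0 : ℝ)..t, F.extend j s) ψ := by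
  have h : ∫ s in (0 : ℝ)..t, B₀ (fun j => F j s) ψ =
      ∫ s in (0 : ℝ)..t, B₀ (fun j => F.extend j s) ψ := by
    refine intervalIntegral.integral_congr_ae (Filter.Eventually.of_forall fun s hs => ?_)
    rw [uIoc_of_le ht.1] at hs
    simp only [F.extend_of_mem _ (Ioc_subset_Ioc_right ht.2 hs)]
  rw [h]
  simp only [B₀]
  rw [intervalIntegral.integral_finsetSum fun j _ =>
    (intervalIntegrable_of_memLp_two (F.memLp_extend j) 0 t).mul_const _]
  exact Finset.sum_congr rfl fun j _ => intervalIntegral.integral_mul_const _ _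

end Control

/-- The integrated equation, in terms of `𝒜` and the resolvent image `(u, ι u)` of the input. -/
theorem isAValue_sub_iff {Y φ φ₀ : EnergySpace p} {u : V p} {β : Fin 8 → ℂ}
    (hu : ∀ ψ : V p, ⟪ι ψ, ι u⟫_ℂ + (⟪ψ, u⟫_ℂ + formD u ψ) = B₀ β ψ) :
    IsAValue (Y - WithLp.toLp 2 (u, ι u)) (φ₀ - φ + WithLp.toLp 2 (u, ι u)) ↔
      ι (φ.fst - φ₀.fst) = Y.snd ∧ ∀ ψ : V p,
        ⟪ι ψ, φ.snd - φ₀.snd⟫_ℂ + ⟪ψ, Y.fst⟫_ℂ + formD (φ.fst - φ₀.fst) ψ = B₀ β ψ := by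
  constructor
  · rintro ⟨y, z, h1, h2, h3⟩
    have e1 : Y.fst - u = y := congrArg WithLp.fst h1
    have e2 : Y.snd - ι u = ι z := congrArg WithLp.snd h1
    have e3 : φ₀.fst - φ.fst + u = -z := h2
    have e4 : φ.fst - φ₀.fst = z + u := by rw [← neg_eq_iff_eq_neg.mpr e3]; abel
    refine ⟨by rw [e4, map_add, ← e2, sub_add_cancel], fun ψ => ?_⟩
    have h4 : _ = ⟪ι ψ, φ₀.snd - φ.snd + ι u⟫_ℂ := h3 ψ
    rw [← e1] at h4
    rw [e4]
    simp only [← inner_opD, map_add, inner_add_right, inner_sub_right] at h4 hu ⊢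
    linear_combination h4 + hu ψ
  · rintro ⟨h1, h2⟩
    refine ⟨Y.fst - u, φ.fst - φ₀.fst - u, ?_, ?_, fun ψ => ?_⟩
    · rw [map_sub, h1]; rfl
    · change φ₀.fst - φ.fst + u = _; abel
    · change _ = ⟪ι ψ, φ₀.snd - φ.snd + ι u⟫_ℂ
      have h3 := h2 ψ
      have h4 := hu ψ
      simp only [← inner_opD, map_sub, inner_add_right, inner_sub_right] at h3 h4 ⊢
      linear_combination h3 - h4

theorem inner_integral_fst {φ : ℝ → EnergySpace p} {t : ℝ}
    (hφ : IntervalIntegrable φ volume 0 t) (ψ : V p) :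
    ∫ s in (0 : ℝ)..t, ⟪ψ, (φ s).fst⟫_ℂ = ⟪ψ, (∫ s in (0 : ℝ)..t, φ s).fst⟫_ℂ :=
  (innerSL ℂ ψ ∘L EnergySpace.fstL).intervalIntegral_comp_comm hφ

theorem inner_integral_snd {φ : ℝ → EnergySpace p} {t : ℝ}
    (hφ : IntervalIntegrable φ volume 0 t) (h : H p) :
    ∫ s in (0 : ℝ)..t, ⟪h, (φ s).snd⟫_ℂ = ⟪h, (∫ s in (0 : ℝ)..t, φ s).snd⟫_ℂ :=
  (innerSL ℂ h ∘L EnergySpace.sndL).intervalIntegral_comp_comm hφ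

theorem exists_sum_smul_eq {b : Fin 8 → EnergySpace p}
    (hb : ∀ j, IsResolventOfInput (Pi.single j 1) (b j)) (β : Fin 8 → ℂ) :
    ∃ u : V p, ∑ j, β j • b j = WithLp.toLp 2 (u, ι u) ∧
      ∀ ψ : V p, ⟪ι ψ, ι u⟫_ℂ + (⟪ψ, u⟫_ℂ + formD u ψ) = B₀ β ψ := by
  choose y z h1 h2 h3 using hb
  have hyz : ∀ j, y j = z j := fun j => sub_eq_zero.mp (h2 j)
  obtain rfl : y = z := funext hyz
  refine ⟨∑ j, β j • y j, ?_, fun ψ => ?_⟩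
  · let J : V p →ₗ[ℂ] EnergySpace p :=
      (WithLp.linearEquiv 2 ℂ (V p × H p)).symm.toLinearMap ∘ₗ LinearMap.prod LinearMap.id ι
    have hJ : ∀ u, J u = WithLp.toLp 2 (u, ι u) := fun u => rfl
    rw [← hJ, map_sum]
    exact Finset.sum_congr rfl fun j _ => by rw [map_smul, h1, hJ]
  · simp only [← inner_opD] at h3 ⊢
    simp only [map_sum, map_smul, inner_sum, inner_smul_right]
    rw [← Finset.sum_add_distrib, ← Finset.sum_add_distrib, B₀]
    refine Finset.sum_congr rfl fun j _ => ?_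
    have h4 := h3 j ψ
    rw [B₀, Finset.sum_eq_single j (fun i _ hi => by rw [Pi.single_eq_of_ne hi, zero_mul])
      (fun hj => absurd (Finset.mem_univ j) hj), Pi.single_eq_same, one_mul] at h4
    rw [← h4]
    ring

/-- The weak form of the system is equivalent to the integrated abstract equation. -/
theorem isSolution_iff {b : Fin 8 → EnergySpace p}
    (hb : ∀ j, IsResolventOfInput (Pi.single j 1) (b j)) {T : ℝ} {φ₀ : EnergySpace p}
    {F : Control T} {φ : ℝ → EnergySpace p} : IsSolution T φ₀ F φ ↔
      ContinuousOn φ (Icc 0 T) ∧ φ 0 = φ₀ ∧ ∀ t ∈ Icc 0 T,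
        ((∫ s in (0 : ℝ)..t, φ s) - ∑ j, (∫ s in (0 : ℝ)..t, F.extend j s) • b j,
          φ₀ - φ t + ∑ j, (∫ s in (0 : ℝ)..t, F.extend j s) • b j) ∈ graphA p := by
  have hi : ContinuousOn φ (Icc 0 T) → ∀ t ∈ Icc 0 T, IntervalIntegrable φ volume 0 t :=
    fun hc t ht => ContinuousOn.intervalIntegrable (by
      rw [uIcc_of_le ht.1]; exact hc.mono (Icc_subset_Icc_right ht.2))
  constructor
  · rintro ⟨hc, h0, h1, h2⟩
    refine ⟨hc, h0, fun t ht => ?_⟩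
    obtain ⟨u, hu1, hu2⟩ := exists_sum_smul_eq hb fun j => ∫ s in (0 : ℝ)..t, F.extend j s
    rw [hu1, mem_graphA, isAValue_sub_iff hu2]
    refine ⟨ext_inner_left ℂ fun h => ?_, fun ψ => ?_⟩
    · rw [h1 t ht, inner_integral_snd (hi hc t ht)]
    · rw [← F.integral_B₀ ht, ← h2 t ht, inner_integral_fst (hi hc t ht)]
  · rintro ⟨hc, h0, h1⟩
    have key : ∀ t ∈ Icc 0 T, ι ((φ t).fst - φ₀.fst) = (∫ s in (0 : ℝ)..t, φ s).snd ∧ ∀ ψ : V p,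
        ⟪ι ψ, (φ t).snd - φ₀.snd⟫_ℂ + ⟪ψ, (∫ s in (0 : ℝ)..t, φ s).fst⟫_ℂ +
          formD ((φ t).fst - φ₀.fst) ψ = B₀ (fun j => ∫ s in (0 : ℝ)..t, F.extend j s) ψ :=
        fun t ht => by
      obtain ⟨u, hu1, hu2⟩ := exists_sum_smul_eq hb fun j => ∫ s in (0 : ℝ)..t, F.extend j s
      have h2 := h1 t ht
      rw [hu1, mem_graphA] at h2
      exact (isAValue_sub_iff hu2).mp h2
    refine ⟨hc, h0, fun t ht h => ?_, fun t ht ψ => ?_⟩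
    · rw [(key t ht).1, inner_integral_snd (hi hc t ht)]
    · rw [F.integral_B₀ ht, ← (key t ht).2, inner_integral_fst (hi hc t ht)]

theorem IsSolution.eqOn {T : ℝ} (hT : 0 ≤ T) {φ₀ : EnergySpace p} {F : Control T}
    {φ φ' : ℝ → EnergySpace p} (h : IsSolution T φ₀ F φ) (h' : IsSolution T φ₀ F φ') :
    EqOn φ φ' (Icc 0 T) := by
  choose b hb using exists_isResolventOfInput (p := p)
  obtain ⟨hc, -, h1⟩ := (isSolution_iff hb).mp h
  obtain ⟨hc', -, h1'⟩ := (isSolution_iff hb).mp h'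
  have key := (isSkewAdjointGraph_graphA p).eq_zero_of_integral_mem hT (φ := fun t => φ t - φ' t)
    (hc.sub hc') fun t ht => by
      have h2 := (graphA p).sub_mem (h1 t ht) (h1' t ht)
      have hi : ∀ {f : ℝ → EnergySpace p}, ContinuousOn f (Icc 0 T) →
          IntervalIntegrable f volume 0 t := fun hf => ContinuousOn.intervalIntegrable (by
        rw [uIcc_of_le ht.1]; exact hf.mono (Icc_subset_Icc_right ht.2))
      rw [intervalIntegral.integral_sub (hi hc) (hi hc')]
      rw [Prod.mk_sub_mk, sub_sub_sub_cancel_right, add_sub_add_right_eq_sub,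
        sub_sub_sub_cancel_left, ← neg_sub (φ t)] at h2
      exact h2
  exact fun t ht => sub_eq_zero.mp (key t ht)

variable (p) in
/-- The group generated by `-𝒜`. -/
noncomputable def groupA : ℝ → EnergySpace p →L[ℂ] EnergySpace p :=
  (isSkewAdjointGraph_graphA p).group

variable (p) in
theorem isUnitaryGroup_groupA : IsUnitaryGroup (graphA p) (groupA p) :=
  (isSkewAdjointGraph_graphA p).isUnitaryGroup_group

theorem isContractionSemigroup_groupA : IsContractionSemigroup (groupA p) where
  zero := ContinuousLinearMap.ext fun φ => (isUnitaryGroup_groupA p).zero_apply φ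
  add s t _ _ := ContinuousLinearMap.ext fun φ => (isUnitaryGroup_groupA p).add_apply s t φ
  continuous φ := ((isUnitaryGroup_groupA p).continuous_apply φ).continuousOn
  contraction t _ := ContinuousLinearMap.opNorm_le_bound _ zero_le_one fun φ => by
    rw [(isUnitaryGroup_groupA p).norm_apply, one_mul]

theorem isGeneratedByNegA_groupA : IsGeneratedByNegA (groupA p) := fun φ g =>
  (isUnitaryGroup_groupA p).mem_iff_tendsto (isSkewAdjointGraph_graphA p) φ g

theorem isAdmissible_groupA : IsAdmissible (groupA p) := by
  choose b hb using exists_isResolventOfInput (p := p)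
  obtain ⟨K, q, q', hK, hq⟩ := exists_isMultiplier hb
  have hΓ := isSkewAdjointGraph_graphA p
  have hS := isUnitaryGroup_groupA p
  refine ⟨b, hb, fun T hT F => ?_⟩
  obtain ⟨ψ, -, -, h1, -⟩ := hq.exists_input hK hΓ hS F.memLp_extend hT.le
  have h2 := h1 T ⟨hT.le, le_rfl⟩
  have h3 : ∫ s in (0 : ℝ)..T, groupA p (T - s) (∑ j, (F j s : ℂ) • b j) =
      groupA p T (∫ s in (0 : ℝ)..T, ∑ j, F.extend j s • groupA p (-s) (b j)) := by
    rw [← (groupA p T).intervalIntegral_comp_comm (intervalIntegrable_input hS F.memLp_extend 0 T)]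
    refine intervalIntegral.integral_congr_ae (Filter.Eventually.of_forall fun s hs => ?_)
    rw [uIoc_of_le hT.le] at hs
    rw [sub_eq_add_neg, hS.add_apply, map_sum]
    simp only [map_smul, F.extend_of_mem _ hs]
  rw [h3, ← h2]
  exact ⟨_, mem_graphA.mp (hS.apply_mem T _ _ (hΓ.res_mem one_ne_zero (ψ T)))⟩

end RaoNakra

theorem mainTheorem1 (p : RaoNakra.BeamParams) :
    (∃ S : ℝ → RaoNakra.EnergySpace p →L[ℂ] RaoNakra.EnergySpace p,
      RaoNakra.IsContractionSemigroup S ∧ RaoNakra.IsGeneratedByNegA S ∧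
        RaoNakra.IsAdmissible S) ∧
    ∀ T : ℝ, 0 < T → ∃ c₁ : ℝ, 0 < c₁ ∧
      ∀ (φ₀ : RaoNakra.EnergySpace p) (F : RaoNakra.Control T),
        (∃ φ : ℝ → RaoNakra.EnergySpace p, RaoNakra.IsSolution T φ₀ F φ) ∧
        (∀ φ φ' : ℝ → RaoNakra.EnergySpace p, RaoNakra.IsSolution T φ₀ F φ →
          RaoNakra.IsSolution T φ₀ F φ' → Set.EqOn φ φ' (Set.Icc 0 T)) ∧
        (∀ φ : ℝ → RaoNakra.EnergySpace p, RaoNakra.IsSolution T φ₀ F φ →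
          ‖φ T‖ ^ 2 ≤ c₁ * (‖φ₀‖ ^ 2 + ∑ j, ‖F j‖ ^ 2)) := by
  refine ⟨⟨RaoNakra.groupA p, RaoNakra.isContractionSemigroup_groupA,
    RaoNakra.isGeneratedByNegA_groupA, RaoNakra.isAdmissible_groupA⟩, fun T hT => ?_⟩
  choose b hb using RaoNakra.exists_isResolventOfInput (p := p)
  obtain ⟨K, q, q', hK, hq⟩ := RaoNakra.exists_isMultiplier hb
  have hK' : 0 ≤ K * (2 + T) := by positivity
  refine ⟨2 * (1 + K * (2 + T)), by positivity, fun φ₀ F => ?_⟩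
  obtain ⟨φ, h1, h2, h3, h4⟩ := hq.exists_solution hK (RaoNakra.isSkewAdjointGraph_graphA p)
    (RaoNakra.isUnitaryGroup_groupA p) F.memLp_extend hT.le φ₀
  have hφ : RaoNakra.IsSolution T φ₀ F φ := (RaoNakra.isSolution_iff hb).mpr ⟨h1, h2, h3⟩
  refine ⟨⟨φ, hφ⟩, fun _ _ h h' => h.eqOn hT.le h', fun φ' h => ?_⟩
  rw [h.eqOn hT.le hφ ⟨hT.le, le_rfl⟩]
  rw [F.integral_norm_sq_extend hT.le] at h4
  have hF : 0 ≤ ∑ j, ‖F j‖ ^ 2 := Finset.sum_nonneg fun j _ => sq_nonneg _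
  have h5 := Real.sq_sqrt (mul_nonneg hK' hF)
  set r := √(K * (2 + T) * ∑ j, ‖F j‖ ^ 2)
  calc ‖φ T‖ ^ 2 ≤ (‖φ₀‖ + r) ^ 2 := pow_le_pow_left₀ (norm_nonneg _) h4 2
    _ ≤ 2 * ‖φ₀‖ ^ 2 + 2 * r ^ 2 := by linarith [sq_nonneg (‖φ₀‖ - r)]
    _ ≤ _ := by
      rw [h5]
      nlinarith [mul_nonneg hK' (sq_nonneg ‖φ₀‖)]
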